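/- **Setting.** One risk-free asset with rate $\mu_0>0$ and $m$ risky assets with constant drift vector $\mu\in\mathbb R^m$ and constant diffusion matrix $\bar\Sigma\in\mathbb R^{m\times L}$ such that $\Sigma=\bar\Sigma\bar\Sigma'$ is positive definite; $\bar z$ is an $L$-dimensional standard Brownian motion on a filtered probability space. Let $a,\gamma,T>0$, $u(c)=-e^{-\gamma c}/\gamma$, $F(W)=-a e^{-\gamma W}$, and $\kappa=(\mu-\mu_0\mathbf 1)'\Sigma^{-1}(\mu-\mu_0\mathbf 1)$. For a continuous discount rate $r:[0,T]\to\mathbb R$ put $\theta(\tau)=e^{-\int_0^\tau r}$. Write $$\mathcal H[V](t,W;c,w)=u(c)+\Big[\sum_j w_j(\mu_j-\mu_0)W+(\mu_0W-c)\Big]V_W+\tfrac12\sum_{j,k}w_jw_k\sigma_{jk}W^2V_{WW},\quad c\in\mathbb R,\ w\in\mathbb R^m .$$ The standard HJB equation with discount rate $q$ is $q(t)V-V_t=\max_{c,w}\mathcal H[V]$, $V(W,T)=F(W)$ (constant rate: $q=\rho$ on $[0,T]$; pre-commitment: $q=r$ on $[0,T]$; naive $t_0$-agent, $0\le t_0<T$: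 $q(s)=r(s-t_0)$ on $[t_0,T]$). The modified HJB equation of the sophisticated agent is $$r(T-t)V^S+K-V^S_t=\max_{c,w}\mathcal H[V^S],\qquad V^S(W,T)=F(W),$$ $$K(W,t)=E\int_t^T\theta(s-t)[r(s-t)-r(T-t)]\,u\big(c(W(s),s)\big)\,ds,$$ where $(c,w)$ is the maximising rule and $W(\cdot)$ is the wealth process started from $W$ at time $t$ under this rule, i.e. the solution of $dW=[\sum_i w_iW(\mu_i-\mu_0)+(\mu_0W-c)]ds+\sum_{i,k}w_iW\bar\sigma_{ik}\,d\bar z_k$. Solutions are of class $C^{1}$ in $t$ and $C^2$ in $W$, and the equations are required for $W\ne0$; in the wealth equation the amounts $w_iW$ are continued to $W=0$ by the constant-in-$W$ values which they have for $W\neq0$. Let $$\beta(t)=\frac{\mu_0}{1+(\mu_0-1)e^{-\mu_0(T-t)}},\quad \delta(t)=\beta(t)-\tfrac12\kappa-\beta(t)\ln(a\gamma\beta(t)),\quad \alpha_q(t)=-\tfrac1\gamma e^{-\int_t^T\beta}\int_t^T[\delta(s)-q(s)]e^{\int_s^T\beta}\,ds .$$ **Theorem.** 1. On $[0,T]$,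 $\beta>0$, $\dot\beta=\beta^2-\mu_0\beta$, and $\beta(T)=1$. 2. Let $\alpha,b$ be functions with $b>0$. In the constant-rate, pre-commitment and naive cases, $V=-ae^{-\gamma(\alpha(t)+b(t)W)}$ solves the standard HJB equation with discount rate $q$, with maximising rule as in 3, if and only if $b=\beta$ and $\alpha=\alpha_q$ on the time interval. 3. Let $V=-ae^{-\gamma(\alpha(t)+b(t)W)}$, where $\alpha,b$ are differentiable at $t\in[0,T]$ (relative to $[0,T]$) and $b(t)>0$, and let $W\neq0$. The unique maximiser of $\mathcal H[V](t,W;\cdot)$ is $$c=\alpha(t)+b(t)W-\frac{\ln(a\gamma b(t))}{\gamma},\qquad w=\frac1{\gamma b(t)W}\Sigma^{-1}(\mu-\mu_0\mathbf 1),$$ and, for every real $K$, $r(T-t)V+K-V_t=\max_{c,w}\mathcal H[V]$ is equivalent to $$-ar(T-t)e^{-\gamma(\alpha+bW)}+K-a\gamma(\dot\alpha+\dot bW)e^{-\gamma(\alpha+bW)}=-ab\,e^{-\gamma(\alpha+bW)}+\tfrac a2\kappa e^{-\gamma(\alpha+bW)}+\Big(\mu_0W-\alpha-bW+\tfrac{\ln(a\gamma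 b)}{\gamma}\Big)a\gamma b\,e^{-\gamma(\alpha+bW)} .$$ 4. For every continuous $\alpha$ on $[0,T]$, the non-local term belonging to the rule in 3 with $b=\beta$ is, for all $t\in[0,T]$ and $W\in\mathbb R$, $K(W,t)=aA(\alpha,t)e^{-\gamma(\alpha(t)+\beta(t)W)}$, where $$A(\alpha,t)=-\int_t^T\theta(s-t)[r(s-t)-r(T-t)]\,\beta(s)\,e^{-\gamma[\alpha(s)-\alpha(t)+\int_t^s\beta(\tau)B(\tau)d\tau]}\,e^{\frac{\kappa}{2}(s-t)}\,ds,\qquad B=\frac{\kappa}{\gamma\beta}-\alpha+\frac{\ln(a\gamma\beta)}{\gamma},$$ does not depend on $W$. 5. The function $V^S=-ae^{-\gamma(\alpha^S(t)+\beta(t)W)}$, with the rule in 3 for $\alpha=\alpha^S$, $b=\beta$, solves the modified HJB equation if and only if $\alpha^S$ is $C^1$ on $[0,T]$, $\alpha^S(T)=0$ and $$-r(T-t)+A(\alpha^S,t)-\gamma\dot\alpha^S+\beta-\tfrac12\kappa+\gamma\alpha^S\beta-\beta\ln(a\gamma\beta)=0\quad\text{on }[0,T].$$ Exactly one such $\alpha^S$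 exists on $[0,T]$. So the guess is consistent with the modified HJB equation with $\beta^S=\beta$, the same $\beta$ as in 2; the integral term enters only the equation of $\alpha^S$; and the portfolio rule is the same function $\frac{1}{\gamma\beta(t)W}\Sigma^{-1}(\mu-\mu_0\mathbf 1)$ of $(W,t)$ in all cases. 6. The portfolio is nevertheless not independent of the discount factor: if $\mu\neq\mu_0\mathbf 1$ and $r_1,r_2$ are continuous discount rates whose discount factors differ somewhere on $[0,T]$, and $W_1,W_2$ are the wealth processes, started at time $0$ from the same wealth, of the corresponding sophisticated solutions of the form in 5, then for some $s\in(0,T]$ the portfolios $w(W_1(s),s)$ and $w(W_2(s),s)$ have different laws. -/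

import Mathlib

open MeasureTheory ProbabilityTheory Set Filter Topology
open scoped NNReal ENNReal Matrix

noncomputable section

namespace CARA

/-! ### The market -/

/-- One risk-free asset with rate `mu0 > 0` and `m` risky assets with constant drifts `mu i` and a
constant `m × L` diffusion matrix `sigma` such that `sigma * sigmaᵀ` is positive definite. -/
structure Market (m L : ℕ) where
  mu0 : ℝ
  mu : Fin m → ℝ
  sigma : Matrix (Fin m) (Fin L) ℝ
  mu0_pos : 0 < mu0
  cov_posDef : (sigma * sigmaᵀ).PosDef

namespace Market

variable {m L : ℕ}

/-- The variance-covariance matrix. -/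
def cov (M : Market m L) : Matrix (Fin m) (Fin m) ℝ := M.sigma * M.sigmaᵀ

/-- The vector of excess returns. -/
def excess (M : Market m L) : Fin m → ℝ := fun i => M.mu i - M.mu0

/-- `(μ - μ₀ 1)' Σ⁻¹ (μ - μ₀ 1)`. -/
def kappa (M : Market m L) : ℝ := M.excess ⬝ᵥ (M.cov⁻¹ *ᵥ M.excess)

end Market

/-- The discount factor `θ(τ) = exp (-∫₀^τ r)`. -/
def discount (r : ℝ → ℝ) (τ : ℝ) : ℝ := Real.exp (-∫ x in (0 : ℝ)..τ, r x)

/-! ### Brownian motion, the Itô integral, the wealth process -/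

section Stochastic

variable {Ω : Type*} [mΩ : MeasurableSpace Ω]

/-- `z` is an `L`-dimensional standard Brownian motion with respect to the filtration `ℱ`. -/
structure IsBrownianBasis {L : ℕ} (ℱ : Filtration ℝ≥0 mΩ) (z : Fin L → ℝ≥0 → Ω → ℝ)
    (P : Measure Ω) : Prop where
  brownian : ∀ k, IsBrownianReal (z k) P
  indep : iIndepFun (fun k ω (t : ℝ≥0) => z k t ω) P
  adapted : ∀ k t, Measurable[ℱ t] (z k t)
  indep_past : ∀ s t, s ≤ t →
    Indep (MeasurableSpace.comap (fun ω k => z k t ω - z k s ω) inferInstance) (ℱ s) P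

/-- A simple process on `[t, T]`: on `(time i, time (i+1)]` it has the bounded,
`ℱ (time i)`-measurable value `ξ i`, for `i < n`. -/
structure SimpleProc (ℱ : Filtration ℝ≥0 mΩ) (t T : ℝ) where
  n : ℕ
  time : ℕ → ℝ
  ξ : ℕ → Ω → ℝ
  mono : Monotone time
  mem : ∀ i, time i ∈ Icc t T
  meas : ∀ i, Measurable[ℱ (time i).toNNReal] (ξ i)
  bdd : ∃ C, ∀ i ω, |ξ i ω| ≤ C

namespace SimpleProc

variable {ℱ : Filtration ℝ≥0 mΩ} {t T : ℝ}

/-- The value of a simple process at time `s`. -/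
def val (H : SimpleProc ℱ t T) (s : ℝ) (ω : Ω) : ℝ :=
  ∑ i ∈ Finset.range H.n, (Ioc (H.time i) (H.time (i + 1))).indicator (fun _ => H.ξ i ω) s

/-- The elementary stochastic integral over `[t, s]` of a simple process. -/
def integral (H : SimpleProc ℱ t T) (z : ℝ≥0 → Ω → ℝ) (s : ℝ) (ω : Ω) : ℝ :=
  ∑ i ∈ Finset.range H.n, H.ξ i ω *
    (z (min (H.time (i + 1)) s).toNNReal ω - z (min (H.time i) s).toNNReal ω)

end SimpleProc

/-- `I s = ∫_t^s H dz` (Itô) for all `s ∈ [t, T]`: the integrand is in `L²([t, T] × Ω)`, and is the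
limit in this space of simple processes whose elementary integrals up to `s` converge to `I s`
in `L²(Ω)`, for every `s ∈ [t, T]`. -/
def IsItoIntegral (ℱ : Filtration ℝ≥0 mΩ) (z : ℝ≥0 → Ω → ℝ) (P : Measure Ω) (t T : ℝ)
    (H I : ℝ → Ω → ℝ) : Prop :=
  MemLp (fun p : ℝ × Ω => H p.1 p.2) 2 ((volume.restrict (Ioc t T)).prod P) ∧
  (∀ s ∈ Icc t T, MemLp (I s) 2 P) ∧
  ∃ S : ℕ → SimpleProc ℱ t T,
    Tendsto (fun n => eLpNorm (fun p : ℝ × Ω => (S n).val p.1 p.2 - H p.1 p.2) 2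
      ((volume.restrict (Ioc t T)).prod P)) atTop (𝓝 0) ∧
    ∀ s ∈ Icc t T,
      Tendsto (fun n => eLpNorm (fun ω => (S n).integral z s ω - I s ω) 2 P) atTop (𝓝 0)

end Stochastic

/-- A feedback rule `(t, W) ↦` consumption, amounts invested in the risky assets. -/
structure FeedbackRule (m : ℕ) where
  cons : ℝ → ℝ → ℝ
  amount : ℝ → ℝ → Fin m → ℝ

/-- The shares of wealth `w = amount / W` invested in the risky assets (meaningful for `W ≠ 0`). -/
def FeedbackRule.share {m : ℕ} (R : FeedbackRule m) (t W : ℝ) : Fin m → ℝ :=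
  W⁻¹ • R.amount t W

section Stochastic

variable {Ω : Type*} [mΩ : MeasurableSpace Ω] {m L : ℕ}

/-- On `[t, T]`, the process `X` solves the budget equation
`dX = [∑ᵢ πᵢ (μᵢ - μ₀) + (μ₀ X - c)] ds + ∑ᵢ ∑ₖ πᵢ σᵢₖ dzₖ`, `X(t) = W`,
where consumption `c` and the amounts `πᵢ = wᵢ X` follow the feedback rule `R`. -/
structure IsWealthProcess (M : Market m L) (ℱ : Filtration ℝ≥0 mΩ) (z : Fin L → ℝ≥0 → Ω → ℝ)
    (P : Measure Ω) (T : ℝ) (R : FeedbackRule m) (t W : ℝ) (X : ℝ → Ω → ℝ) : Prop where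
  adapted : ∀ s ∈ Icc t T, Measurable[ℱ s.toNNReal] (X s)
  cont : ∀ᵐ ω ∂P, ContinuousOn (fun s => X s ω) (Icc t T)
  drift_integrable : ∀ᵐ ω ∂P, IntervalIntegrable (fun s =>
    (∑ i, R.amount s (X s ω) i * (M.mu i - M.mu0)) + (M.mu0 * X s ω - R.cons s (X s ω)))
    volume t T
  sde : ∃ I : Fin L → ℝ → Ω → ℝ,
    (∀ k, IsItoIntegral ℱ (z k) P t T
      (fun s ω => ∑ i, R.amount s (X s ω) i * M.sigma i k) (I k)) ∧
    ∀ s ∈ Icc t T, ∀ᵐ ω ∂P, X s ω = W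
      + (∫ τ in t..s, ((∑ i, R.amount τ (X τ ω) i * (M.mu i - M.mu0))
          + (M.mu0 * X τ ω - R.cons τ (X τ ω))))
      + ∑ k, I k s ω

/-- `K` is the value at `(t, W)` of the non-local term
`E ∫_t^T θ(s-t) [r(s-t) - r(T-t)] u(c(X(s), s)) ds` of the modified HJB equation, where `X` is the
wealth process started from `W` at time `t` under the rule `R`: such a process exists, and for
every such process the expectation is well defined and equal to `K`. -/
def IsNonlocalTerm (M : Market m L) (ℱ : Filtration ℝ≥0 mΩ) (z : Fin L → ℝ≥0 → Ω → ℝ)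
    (P : Measure Ω) (T : ℝ) (r u : ℝ → ℝ) (R : FeedbackRule m) (t W K : ℝ) : Prop :=
  (∃ X, IsWealthProcess M ℱ z P T R t W X) ∧
  ∀ X, IsWealthProcess M ℱ z P T R t W X →
    Integrable (fun p : ℝ × Ω => discount r (p.1 - t) * (r (p.1 - t) - r (T - t))
      * u (R.cons p.1 (X p.1 p.2))) ((volume.restrict (Ioc t T)).prod P) ∧
    K = ∫ ω, (∫ s in t..T, discount r (s - t) * (r (s - t) - r (T - t))
      * u (R.cons s (X s ω))) ∂P

end Stochastic

/-! ### The HJB equations -/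

section HJB

variable {m L : ℕ}

/-- The expression maximised over `(c, w)` in the HJB equations; `p` and `q` stand for the first
and second derivatives of the value function in `W`. -/
def hamiltonian (M : Market m L) (u : ℝ → ℝ) (W p q : ℝ) (c : ℝ) (w : Fin m → ℝ) : ℝ :=
  u c + ((∑ j, w j * (M.mu j - M.mu0) * W) + (M.mu0 * W - c)) * p
    + 1 / 2 * ∑ j, ∑ k, w j * w k * M.cov j k * W ^ 2 * q

/-- The same expression for a value function `V t W`. -/
def hamiltonianOf (M : Market m L) (u : ℝ → ℝ) (V : ℝ → ℝ → ℝ) (t W : ℝ)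
    (c : ℝ) (w : Fin m → ℝ) : ℝ :=
  hamiltonian M u W (deriv (V t) W) (deriv (deriv (V t)) W) c w

/-- `y = max_{c, w} {...}`, the maximum over all `c ∈ ℝ`, `w ∈ ℝᵐ` being attained. -/
def IsHamiltonianMax (M : Market m L) (u : ℝ → ℝ) (V : ℝ → ℝ → ℝ) (t W y : ℝ) : Prop :=
  IsGreatest (range fun x : ℝ × (Fin m → ℝ) => hamiltonianOf M u V t W x.1 x.2) y

/-- The partial derivative of `V` in time on `[t0, T]` (one-sided at the end points). -/
def timeDeriv (t0 T : ℝ) (V : ℝ → ℝ → ℝ) (t W : ℝ) : ℝ :=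
  derivWithin (fun s => V s W) (Icc t0 T) t

/-- `V` is of class `C^1` in time and `C^2` in wealth on `[t0, T] × ℝ`. -/
structure IsC12 (t0 T : ℝ) (V : ℝ → ℝ → ℝ) : Prop where
  diff_time : ∀ W, DifferentiableOn ℝ (fun s => V s W) (Icc t0 T)
  diff_wealth : ∀ t ∈ Icc t0 T, ContDiff ℝ 2 (V t)
  cont : ContinuousOn (fun x : ℝ × ℝ => V x.1 x.2) (Icc t0 T ×ˢ univ)
  cont_time : ContinuousOn (fun x : ℝ × ℝ => timeDeriv t0 T V x.1 x.2) (Icc t0 T ×ˢ univ)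
  cont_wealth : ContinuousOn (fun x : ℝ × ℝ => deriv (V x.1) x.2) (Icc t0 T ×ˢ univ)
  cont_wealth2 : ContinuousOn (fun x : ℝ × ℝ => deriv (deriv (V x.1)) x.2) (Icc t0 T ×ˢ univ)

/-- `V` is a classical solution on `[t0, T]`, with maximising rule `R`, of the standard HJB equation
`q(t) V - V_t = max_{c, w} {...}`, `V(T, W) = F(W)`. -/
structure SolvesHJB (M : Market m L) (u F q : ℝ → ℝ) (t0 T : ℝ) (V : ℝ → ℝ → ℝ)
    (R : FeedbackRule m) : Prop where
  smooth : IsC12 t0 T V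
  terminal : ∀ W, V T W = F W
  hjb : ∀ t ∈ Icc t0 T, ∀ W, W ≠ 0 →
    IsHamiltonianMax M u V t W (q t * V t W - timeDeriv t0 T V t W) ∧
    IsHamiltonianMax M u V t W (hamiltonianOf M u V t W (R.cons t W) (R.share t W))

/-- `V` is a classical solution on `[0, T]`, with maximising (equilibrium) rule `R`, of the modified
HJB equation `r(T-t) V + K - V_t = max_{c, w} {...}`, `V(T, W) = F(W)`, where `K(W, t)` is
the non-local term evaluated along the wealth process of the rule `R`. -/
structure SolvesModifiedHJB {Ω : Type*} [mΩ : MeasurableSpace Ω] (M : Market m L)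
    (ℱ : Filtration ℝ≥0 mΩ) (z : Fin L → ℝ≥0 → Ω → ℝ) (P : Measure Ω)
    (u F r : ℝ → ℝ) (T : ℝ) (V : ℝ → ℝ → ℝ) (R : FeedbackRule m) : Prop where
  smooth : IsC12 0 T V
  terminal : ∀ W, V T W = F W
  hjb : ∀ t ∈ Icc 0 T, ∀ W, W ≠ 0 → ∃ K,
    IsNonlocalTerm M ℱ z P T r u R t W K ∧
    IsHamiltonianMax M u V t W (r (T - t) * V t W + K - timeDeriv 0 T V t W) ∧
    IsHamiltonianMax M u V t W (hamiltonianOf M u V t W (R.cons t W) (R.share t W))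

end HJB

/-! ### Exponential utility -/

/-- `u(c) = -exp(-γ c) / γ`. -/
def utility (γ c : ℝ) : ℝ := -Real.exp (-γ * c) / γ

/-- `F(W) = -a exp(-γ W)`. -/
def bequest (a γ W : ℝ) : ℝ := -a * Real.exp (-γ * W)

/-- The guess `V(W, t) = -a exp(-γ (α(t) + b(t) W))`. -/
def guess (a γ : ℝ) (α b : ℝ → ℝ) (t W : ℝ) : ℝ := -a * Real.exp (-γ * (α t + b t * W))

/-- `β(t) = μ₀ / (1 + (μ₀ - 1) exp(-μ₀ (T - t)))`. -/
def beta (mu0 T t : ℝ) : ℝ := mu0 / (1 + (mu0 - 1) * Real.exp (-mu0 * (T - t)))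

section Exponential

variable {m L : ℕ}

/-- Consumption `α(t) + b(t) W - ln(a γ b(t)) / γ` and amounts
`w W = (1 / (γ b(t))) Σ⁻¹ (μ - μ₀ 1)` invested in the risky assets. -/
def caraRule (M : Market m L) (a γ : ℝ) (α b : ℝ → ℝ) : FeedbackRule m where
  cons := fun t W => α t + b t * W - Real.log (a * γ * b t) / γ
  amount := fun t _ => (1 / (γ * b t)) • (M.cov⁻¹ *ᵥ M.excess)

/-- `δ(t) = β(t) - ½ (μ - μ₀ 1)' Σ⁻¹ (μ - μ₀ 1) - β(t) ln(a γ β(t))`. -/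
def delta (M : Market m L) (a γ T t : ℝ) : ℝ :=
  beta M.mu0 T t - 1 / 2 * M.kappa - beta M.mu0 T t * Real.log (a * γ * beta M.mu0 T t)

/-- `-(1/γ) e^{-∫_t^T β} ∫_t^T [δ(s) - q(s)] e^{∫_s^T β} ds`. -/
def alphaStd (M : Market m L) (a γ T : ℝ) (q : ℝ → ℝ) (t : ℝ) : ℝ :=
  -(1 / γ) * Real.exp (-∫ s in t..T, beta M.mu0 T s)
    * ∫ s in t..T, (delta M a γ T s - q s) * Real.exp (∫ τ in s..T, beta M.mu0 T τ)

/-- `B(s) = (1 / (γ β(s))) (μ - μ₀ 1)' Σ⁻¹ (μ - μ₀ 1) - α(s) + ln(a γ β(s)) / γ`. -/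
def driftB (M : Market m L) (a γ T : ℝ) (α : ℝ → ℝ) (s : ℝ) : ℝ :=
  1 / (γ * beta M.mu0 T s) * M.kappa - α s + Real.log (a * γ * beta M.mu0 T s) / γ

/-- The coefficient `A(α, t)` of the non-local term,
`-∫_t^T θ(s-t) [r(s-t) - r(T-t)] β(s) E exp(-γ [α(s) - α(t) + ∫_t^s β B + N]) ds`, where
`N = (1/γ) (μ - μ₀ 1)' Σ⁻¹ sigma (z(s) - z(t))`, so that `E exp(-γ N) = exp((s - t) κ / 2)`. -/
def nonlocalCoeff (M : Market m L) (a γ T : ℝ) (r α : ℝ → ℝ) (t : ℝ) : ℝ :=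
  -∫ s in t..T, discount r (s - t) * (r (s - t) - r (T - t)) * beta M.mu0 T s
    * Real.exp (-γ * (α s - α t + ∫ τ in t..s, beta M.mu0 T τ * driftB M a γ T α τ))
    * Real.exp (M.kappa / 2 * (s - t))

/-- `α` is a `C¹` solution on `[0, T]`, with `α(T) = 0`, of the integro-differential equation
`-r(T-t) + A(α, t) - γ α' + β - ½ κ + γ α β - β ln(a γ β) = 0`. -/
structure SolvesAlphaEq (M : Market m L) (a γ T : ℝ) (r α : ℝ → ℝ) : Prop where
  smooth : ContDiffOn ℝ 1 α (Icc 0 T)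
  terminal : α T = 0
  eqn : ∀ t ∈ Icc 0 T,
    -r (T - t) + nonlocalCoeff M a γ T r α t - γ * derivWithin α (Icc 0 T) t + beta M.mu0 T t
      - 1 / 2 * M.kappa + γ * α t * beta M.mu0 T t
      - beta M.mu0 T t * Real.log (a * γ * beta M.mu0 T t) = 0

end Exponential

end CARA

end

namespace CARA

/-! ### The coefficient `β` -/

/-! For the exponential guess the Hamiltonian is its maximal value minus two nonnegative defects: a
convexity gap `e^y - (y + 1)` in consumption and a positive definite quadratic form in the amounts
invested (`hamiltonianOf_guess`). This gives the maximiser and its uniqueness. Dividing the HJB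
equation by `a` times the exponential leaves an identity affine in `W`
(`isHamiltonianMax_time_iff`): its slope is a Riccati equation for `b`, linear in `1 / b`, and its
constant part is an equation for `α`, which is a linear ODE in the standard cases.

Under the rule with `b = β`, wealth has a linear drift and a deterministic diffusion coefficient.
Since `1 / β` solves the homogeneous part of the drift, `β X` is a deterministic function plus
Gaussian noise `N / γ`, where `N` has variance `κ (s - t)`. Hence `u(c)` is a deterministic factor
times `e^{-N}`, initial wealth enters only through `e^{-γ β(t) W}`, and the non-local term has the
same exponential form as the guess (`IsBrownianBasis.isNonlocalTerm`). It therefore changes only the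
equation of `α`. The integrands being deterministic and smooth, integration by parts replaces Itô's
formula; the isometry for simple processes gives uniqueness of the integral, and a pathwise linear
ODE gives uniqueness of wealth.

The equation of `α` is nonlinear, but the weight `h = expWeight` turns it into the linear Volterra
equation `h(t) = ∫_t^T θ(s-t) β(s) h(s) ds + θ(T-t)` (`SolvesAlphaEq.solvesVolterra`). That equation
has exactly one continuous solution, which is positive, and `α` is recovered from it by a linear ODE
(`exists_solvesAlphaEq`, `SolvesAlphaEq.eqOn`).

For the dependence on the discount factor, equal laws of the portfolios give equal mean wealth,
hence equal `B`, equal `α` and equal weights. With `h` common to both Volterra equations, their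
difference is a homogeneous Volterra equation for `θ₁ - θ₂`, so the discount factors coincide
(`discount_eq_of_solvesVolterra`). -/

lemma beta_den_pos {mu0 T t : ℝ} (h0 : 0 < mu0) (ht : t ≤ T) :
    0 < 1 + (mu0 - 1) * Real.exp (-mu0 * (T - t)) := by
  have h1 : Real.exp (-mu0 * (T - t)) ≤ 1 := Real.exp_le_one_iff.2 (by nlinarith)
  have h2 := Real.exp_pos (-mu0 * (T - t))
  -- With `E` the exponential, the denominator is `(1 - E) + mu0 * E`.
  nlinarith

lemma beta_pos {mu0 T t : ℝ} (h0 : 0 < mu0) (ht : t ≤ T) : 0 < beta mu0 T t :=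
  div_pos h0 (beta_den_pos h0 ht)

lemma beta_terminal {mu0 : ℝ} (h0 : 0 < mu0) (T : ℝ) : beta mu0 T T = 1 := by
  simp [beta, h0.ne']

lemma hasDerivAt_beta_den (mu0 T t : ℝ) :
    HasDerivAt (fun t => 1 + (mu0 - 1) * Real.exp (-mu0 * (T - t)))
      ((mu0 - 1) * (Real.exp (-mu0 * (T - t)) * mu0)) t := by
  have h1 : HasDerivAt (fun t : ℝ => -mu0 * (T - t)) mu0 t := by
    simpa using ((hasDerivAt_id t).const_sub T).const_mul (-mu0)
  exact (h1.exp.const_mul _).const_add _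

lemma hasDerivAt_beta {mu0 T t : ℝ} (h0 : 0 < mu0) (ht : t ≤ T) :
    HasDerivAt (beta mu0 T) (beta mu0 T t ^ 2 - mu0 * beta mu0 T t) t := by
  have hd := beta_den_pos h0 ht
  have h := (hasDerivAt_const t mu0).div (hasDerivAt_beta_den mu0 T t) hd.ne'
  refine h.congr_deriv ?_
  simp only [beta]
  field_simp
  ring

lemma continuousOn_beta {mu0 : ℝ} (h0 : 0 < mu0) (t0 T : ℝ) :
    ContinuousOn (beta mu0 T) (Icc t0 T) := fun _ ht =>
  (hasDerivAt_beta h0 ht.2).continuousAt.continuousWithinAt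

/-! ### Calculus on a compact interval -/

/-- Replaces data given on a compact interval by globally continuous data, so that two-sided
calculus is available up to the end points. -/
lemma exists_continuous_eqOn_Icc {f : ℝ → ℝ} {a b : ℝ} (hab : a ≤ b)
    (hf : ContinuousOn f (Icc a b)) : ∃ g : ℝ → ℝ, Continuous g ∧ EqOn f g (Icc a b) :=
  ⟨IccExtend hab ((Icc a b).domRestrict f), (continuousOn_iff_continuous_domRestrict.1 hf).Icc_extend',
    fun x hx => by simp [IccExtend_of_mem hab _ hx, domRestrict]⟩

lemma integral_congr_Icc {f g : ℝ → ℝ} {a b s t : ℝ} (h : EqOn f g (Icc a b))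
    (hs : s ∈ Icc a b) (ht : t ∈ Icc a b) : ∫ x in s..t, f x = ∫ x in s..t, g x :=
  intervalIntegral.integral_congr (h.mono (uIcc_subset_Icc hs ht))

lemma intervalIntegrable_of_continuousOn_Icc {f : ℝ → ℝ} {a b s t : ℝ}
    (hf : ContinuousOn f (Icc a b)) (hs : s ∈ Icc a b) (ht : t ∈ Icc a b) :
    IntervalIntegrable f volume s t :=
  (hf.mono (uIcc_subset_Icc hs ht)).intervalIntegrable

lemma hasDerivWithinAt_integral_right {f : ℝ → ℝ} {a b c t : ℝ} (hf : ContinuousOn f (Icc a b))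
    (hc : c ∈ Icc a b) (ht : t ∈ Icc a b) :
    HasDerivWithinAt (fun s => ∫ x in c..s, f x) (f t) (Icc a b) t := by
  obtain ⟨g, hg, hfg⟩ := exists_continuous_eqOn_Icc (hc.1.trans hc.2) hf
  rw [hfg ht]
  exact (hg.integral_hasStrictDerivAt c t).hasDerivAt.hasDerivWithinAt.congr_of_mem
    (fun s hs => integral_congr_Icc hfg hc hs) ht

lemma hasDerivWithinAt_integral_left {f : ℝ → ℝ} {a b c t : ℝ} (hf : ContinuousOn f (Icc a b))
    (hc : c ∈ Icc a b) (ht : t ∈ Icc a b) :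
    HasDerivWithinAt (fun s => ∫ x in s..c, f x) (-f t) (Icc a b) t := by
  have h := (hasDerivWithinAt_integral_right hf hc ht).neg
  refine h.congr_of_mem (fun s _ => ?_) ht
  simp [intervalIntegral.integral_symm s c]

lemma eq_of_hasDerivWithinAt_zero {f : ℝ → ℝ} {a b : ℝ}
    (hf : ∀ t ∈ Icc a b, HasDerivWithinAt f 0 (Icc a b) t) {s t : ℝ} (hs : s ∈ Icc a b)
    (ht : t ∈ Icc a b) : f s = f t := by
  have h := (convex_Icc a b).norm_image_sub_le_of_norm_hasDerivWithin_le (f' := fun _ => 0)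
    (C := 0) hf (by simp) ht hs
  simpa [sub_eq_zero] using h

/-- A solution of a linear homogeneous equation that vanishes somewhere vanishes everywhere. -/
lemma eq_zero_of_linear_ode {f k : ℝ → ℝ} {a b c : ℝ} (hk : ContinuousOn k (Icc a b))
    (hf : ∀ t ∈ Icc a b, HasDerivWithinAt f (k t * f t) (Icc a b) t) (hc : c ∈ Icc a b)
    (h0 : f c = 0) {t : ℝ} (ht : t ∈ Icc a b) : f t = 0 := by
  -- Integrating factor: `f * exp (∫_t^c k)` has derivative zero.
  have h := eq_of_hasDerivWithinAt_zero
    (f := fun t => f t * Real.exp (∫ x in t..c, k x)) (a := a) (b := b) (fun t ht => by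
      have h1 := (hf t ht).mul (hasDerivWithinAt_integral_left hk hc ht).exp
      exact h1.congr_deriv (by ring)) ht hc
  simpa [h0, Real.exp_ne_zero] using h

/-! ### The Hamiltonian of the exponential guess -/

section Hamiltonian

variable {m L : ℕ} (M : Market m L)

lemma cov_isUnit_det : IsUnit M.cov.det := M.cov_posDef.det_pos.ne'.isUnit

lemma cov_symm (x y : Fin m → ℝ) : x ⬝ᵥ (M.cov *ᵥ y) = y ⬝ᵥ (M.cov *ᵥ x) := by
  have h : M.covᵀ = M.cov := by simp [Market.cov, Matrix.transpose_mul]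
  rw [Matrix.dotProduct_mulVec, ← Matrix.mulVec_transpose, h, dotProduct_comm]

lemma cov_mulVec_inv (x : Fin m → ℝ) : M.cov *ᵥ (M.cov⁻¹ *ᵥ x) = x := by
  rw [Matrix.mulVec_mulVec, Matrix.mul_nonsing_inv _ (cov_isUnit_det M), Matrix.one_mulVec]

lemma cov_quadForm_pos {x : Fin m → ℝ} (hx : x ≠ 0) : 0 < x ⬝ᵥ (M.cov *ᵥ x) := by
  have h := M.cov_posDef.dotProduct_mulVec_pos hx
  rwa [star_trivial] at h

lemma cov_quadForm_nonneg (x : Fin m → ℝ) : 0 ≤ x ⬝ᵥ (M.cov *ᵥ x) := by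
  have h := M.cov_posDef.posSemidef.dotProduct_mulVec_nonneg x
  rwa [star_trivial] at h

/-- The vertex is `k⁻¹ Σ⁻¹ (μ - μ₀ 1)`. Applied with `k = γ b(t)`, the absolute risk aversion of the
guess, and with `x` the amounts `W • w`. -/
lemma complete_square {k : ℝ} (hk : 0 < k) (x : Fin m → ℝ) :
    x ⬝ᵥ M.excess - k / 2 * (x ⬝ᵥ (M.cov *ᵥ x)) = M.kappa / (2 * k)
      - k / 2 * ((x - k⁻¹ • (M.cov⁻¹ *ᵥ M.excess)) ⬝ᵥ
        (M.cov *ᵥ (x - k⁻¹ • (M.cov⁻¹ *ᵥ M.excess)))) := by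
  have h1 : (M.cov⁻¹ *ᵥ M.excess) ⬝ᵥ (M.cov *ᵥ x) = x ⬝ᵥ M.excess := by
    rw [cov_symm, cov_mulVec_inv]
  have h2 : (M.cov⁻¹ *ᵥ M.excess) ⬝ᵥ M.excess = M.kappa := dotProduct_comm _ _
  simp only [Matrix.mulVec_sub, Matrix.mulVec_smul, cov_mulVec_inv, sub_dotProduct,
    dotProduct_sub, smul_dotProduct, dotProduct_smul, smul_eq_mul, h1, h2]
  field_simp
  ring

/-- The shares enter only through the amounts `W • w`; `W ≠ 0` is needed just to recover `w` from
them. -/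
lemma hamiltonian_eq (u : ℝ → ℝ) (W p q c : ℝ) (w : Fin m → ℝ) :
    hamiltonian M u W p q c w = u c + (((W • w) ⬝ᵥ M.excess) + (M.mu0 * W - c)) * p
      + 1 / 2 * q * ((W • w) ⬝ᵥ (M.cov *ᵥ (W • w))) := by
  have h1 : (W • w) ⬝ᵥ M.excess = ∑ j, w j * (M.mu j - M.mu0) * W := by
    simp only [dotProduct, Market.excess, Pi.smul_apply, smul_eq_mul]
    exact Finset.sum_congr rfl fun _ _ => by ring
  have h2 : q * ((W • w) ⬝ᵥ (M.cov *ᵥ (W • w)))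
      = ∑ j, ∑ k, w j * w k * M.cov j k * W ^ 2 * q := by
    simp only [dotProduct, Matrix.mulVec, Pi.smul_apply, smul_eq_mul, Finset.mul_sum]
    exact Finset.sum_congr rfl fun _ _ => Finset.sum_congr rfl fun _ _ => by ring
  rw [hamiltonian, h1, ← h2]
  ring

lemma hasDerivAt_guess (a γ : ℝ) (α b : ℝ → ℝ) (t W : ℝ) :
    HasDerivAt (guess a γ α b t)
      (a * γ * b t * Real.exp (-γ * (α t + b t * W))) W := by
  have h1 : HasDerivAt (fun W => -γ * (α t + b t * W)) (-γ * b t) W := by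
    simpa using (((hasDerivAt_id W).const_mul (b t)).const_add (α t)).const_mul (-γ)
  exact (h1.exp.const_mul (-a)).congr_deriv (by ring)

lemma deriv_guess (a γ : ℝ) (α b : ℝ → ℝ) (t : ℝ) :
    deriv (guess a γ α b t)
      = fun W => a * γ * b t * Real.exp (-γ * (α t + b t * W)) :=
  funext fun W => (hasDerivAt_guess a γ α b t W).deriv

lemma deriv_deriv_guess (a γ : ℝ) (α b : ℝ → ℝ) (t : ℝ) :
    deriv (deriv (guess a γ α b t))
      = fun W => -a * γ ^ 2 * b t ^ 2 * Real.exp (-γ * (α t + b t * W)) := by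
  rw [deriv_guess]
  funext W
  have h := (hasDerivAt_guess (-a * γ * b t * a⁻¹) γ α b t W).deriv
  rcases eq_or_ne a 0 with rfl | ha
  · simp
  -- The first derivative is again a guess, with `-a * γ * b t` in place of `a`, so the formula for
  -- the first derivative applies a second time.
  have h2 : (fun W => a * γ * b t * Real.exp (-γ * (α t + b t * W)))
      = guess (-a * γ * b t) γ α b t := by
    funext W
    simp [guess]
  rw [h2, deriv_guess]
  ring

/-- The maximal value of the Hamiltonian of the guess. -/
noncomputable def hamiltonianMax (a γ : ℝ) (α b : ℝ → ℝ) (t W : ℝ) : ℝ :=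
  -a * b t * Real.exp (-γ * (α t + b t * W))
    + a / 2 * M.kappa * Real.exp (-γ * (α t + b t * W))
    + (M.mu0 * W - α t - b t * W + Real.log (a * γ * b t) / γ)
      * (a * γ * b t * Real.exp (-γ * (α t + b t * W)))

variable {a γ : ℝ} {α b : ℝ → ℝ} {t : ℝ}

/-- This is the first-order condition `u'(c) = V_W` at the candidate consumption. -/
lemma utility_caraRule_cons (hγ : 0 < γ) (hb : 0 < a * γ * b t) (W : ℝ) :
    Real.exp (-γ * (α t + b t * W - Real.log (a * γ * b t) / γ))
      = a * γ * b t * Real.exp (-γ * (α t + b t * W)) := by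
  have : -γ * (α t + b t * W - Real.log (a * γ * b t) / γ)
      = Real.log (a * γ * b t) + -γ * (α t + b t * W) := by
    field_simp
    ring
  rw [this, Real.exp_add, Real.exp_log hb]

/-- An exact identity rather than an estimate: the subtracted terms are the gap of `e^y ≥ y + 1` and
the quadratic form of the deviation from the optimal amounts, so the bound and its equality case can
both be read off. -/
lemma hamiltonianOf_guess (ha : 0 < a) (hγ : 0 < γ) (hb : 0 < b t) (W c : ℝ)
    (w : Fin m → ℝ) :
    hamiltonianOf M (utility γ) (guess a γ α b) t W c w = hamiltonianMax M a γ α b t W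
      - a * b t * Real.exp (-γ * (α t + b t * W)) *
        (Real.exp (-γ * (c - (α t + b t * W - Real.log (a * γ * b t) / γ)))
          - (-γ * (c - (α t + b t * W - Real.log (a * γ * b t) / γ)) + 1))
      - a * γ * b t * Real.exp (-γ * (α t + b t * W)) * (γ * b t / 2) *
        ((W • w - (γ * b t)⁻¹ • (M.cov⁻¹ *ᵥ M.excess)) ⬝ᵥ
          (M.cov *ᵥ (W • w - (γ * b t)⁻¹ • (M.cov⁻¹ *ᵥ M.excess)))) := by
  have hc := utility_caraRule_cons (α := α) hγ (by positivity : 0 < a * γ * b t) W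
  have hsq := complete_square M (by positivity : 0 < γ * b t) (W • w)
  rw [hamiltonianOf, deriv_deriv_guess, deriv_guess, hamiltonian_eq, hamiltonianMax, utility]
  generalize hC : α t + b t * W - Real.log (a * γ * b t) / γ = C at hc ⊢
  have hC' : Real.log (a * γ * b t) / γ = α t + b t * W - C := by linarith
  have he : Real.exp (-γ * c) = Real.exp (-γ * (c - C)) * Real.exp (-γ * C) := by
    rw [← Real.exp_add]
    ring_nf
  generalize (W • w) ⬝ᵥ M.excess = x at hsq ⊢
  generalize (W • w) ⬝ᵥ (M.cov *ᵥ (W • w)) = y at hsq ⊢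
  generalize (W • w - (γ * b t)⁻¹ • (M.cov⁻¹ *ᵥ M.excess)) ⬝ᵥ
    (M.cov *ᵥ (W • w - (γ * b t)⁻¹ • (M.cov⁻¹ *ᵥ M.excess))) = q at hsq ⊢
  have hx : x = M.kappa / (2 * (γ * b t)) - γ * b t / 2 * q + γ * b t / 2 * y := by linarith
  rw [he, hc, hC', hx]
  field_simp
  ring

lemma hamiltonianOf_guess_le (ha : 0 < a) (hγ : 0 < γ) (hb : 0 < b t) (W c : ℝ)
    (w : Fin m → ℝ) :
    hamiltonianOf M (utility γ) (guess a γ α b) t W c w ≤ hamiltonianMax M a γ α b t W := by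
  rw [hamiltonianOf_guess M ha hγ hb]
  have h1 := Real.add_one_le_exp (-γ * (c - (α t + b t * W - Real.log (a * γ * b t) / γ)))
  have h2 := cov_quadForm_nonneg M (W • w - (γ * b t)⁻¹ • (M.cov⁻¹ *ᵥ M.excess))
  have h3 := mul_nonneg (by positivity : 0 ≤ a * b t * Real.exp (-γ * (α t + b t * W)))
    (sub_nonneg.2 h1)
  have h4 := mul_nonneg (by positivity :
    0 ≤ a * γ * b t * Real.exp (-γ * (α t + b t * W)) * (γ * b t / 2)) h2
  linarith

lemma hamiltonianOf_guess_eq_iff (ha : 0 < a) (hγ : 0 < γ) (hb : 0 < b t) {W : ℝ} (hW : W ≠ 0)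
    (c : ℝ) (w : Fin m → ℝ) :
    hamiltonianOf M (utility γ) (guess a γ α b) t W c w = hamiltonianMax M a γ α b t W ↔
      c = α t + b t * W - Real.log (a * γ * b t) / γ ∧
        w = (1 / (γ * b t * W)) • (M.cov⁻¹ *ᵥ M.excess) := by
  rw [hamiltonianOf_guess M ha hγ hb]
  have h1 := Real.add_one_le_exp (-γ * (c - (α t + b t * W - Real.log (a * γ * b t) / γ)))
  have h2 := cov_quadForm_nonneg M (W • w - (γ * b t)⁻¹ • (M.cov⁻¹ *ᵥ M.excess))
  have p3 : 0 < a * b t * Real.exp (-γ * (α t + b t * W)) := by positivity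
  have p4 : 0 < a * γ * b t * Real.exp (-γ * (α t + b t * W)) * (γ * b t / 2) := by positivity
  -- Passage between optimal shares and optimal amounts; the only place where `W ≠ 0` is used.
  have hw : w = (1 / (γ * b t * W)) • (M.cov⁻¹ *ᵥ M.excess) ↔
      W • w - (γ * b t)⁻¹ • (M.cov⁻¹ *ᵥ M.excess) = 0 := by
    have : (γ * b t)⁻¹ • (M.cov⁻¹ *ᵥ M.excess)
        = W • ((1 / (γ * b t * W)) • (M.cov⁻¹ *ᵥ M.excess)) := by
      rw [smul_smul]
      congr 1
      field_simp
    rw [this, sub_eq_zero]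
    exact ⟨fun h => by rw [← h], fun h => smul_right_injective _ hW h⟩
  constructor
  · intro h
    have h3 := mul_nonneg p3.le (sub_nonneg.2 h1)
    have h4 := mul_nonneg p4.le h2
    constructor
    · by_contra hne
      have : -γ * (c - (α t + b t * W - Real.log (a * γ * b t) / γ)) ≠ 0 :=
        mul_ne_zero (by linarith) (sub_ne_zero.2 hne)
      have h5 := mul_pos p3 (sub_pos.2 (Real.add_one_lt_exp this))
      linarith
    · rw [hw]
      by_contra hne
      have h5 := mul_pos p4 (cov_quadForm_pos M hne)
      linarith
  · rintro ⟨hc, h⟩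
    rw [hw.1 h, hc]
    simp

lemma isHamiltonianMax_guess_iff (ha : 0 < a) (hγ : 0 < γ) (hb : 0 < b t) {W : ℝ} (hW : W ≠ 0)
    (y : ℝ) :
    IsHamiltonianMax M (utility γ) (guess a γ α b) t W y ↔ y = hamiltonianMax M a γ α b t W := by
  have h : IsHamiltonianMax M (utility γ) (guess a γ α b) t W (hamiltonianMax M a γ α b t W) := by
    refine ⟨⟨(α t + b t * W - Real.log (a * γ * b t) / γ,
      (1 / (γ * b t * W)) • (M.cov⁻¹ *ᵥ M.excess)),
      (hamiltonianOf_guess_eq_iff M ha hγ hb hW _ _).2 ⟨rfl, rfl⟩⟩, ?_⟩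
    rintro _ ⟨x, rfl⟩
    exact hamiltonianOf_guess_le M ha hγ hb W x.1 x.2
  exact ⟨fun h' => h'.unique h, fun h' => h' ▸ h⟩

lemma isHamiltonianMax_caraRule (ha : 0 < a) (hγ : 0 < γ) (hb : 0 < b t) {W : ℝ} (hW : W ≠ 0) :
    IsHamiltonianMax M (utility γ) (guess a γ α b) t W
      (hamiltonianOf M (utility γ) (guess a γ α b) t W ((caraRule M a γ α b).cons t W)
        ((caraRule M a γ α b).share t W)) := by
  rw [isHamiltonianMax_guess_iff M ha hγ hb hW, hamiltonianOf_guess_eq_iff M ha hγ hb hW]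
  refine ⟨rfl, ?_⟩
  rw [FeedbackRule.share, caraRule, smul_smul]
  congr 1
  field_simp

end Hamiltonian

/-! ### Regularity of the exponential guess -/

section Guess

variable {a γ t0 T : ℝ} {α b : ℝ → ℝ}

lemma hasDerivWithinAt_guess {α' b' t : ℝ} {s : Set ℝ} (hα : HasDerivWithinAt α α' s t)
    (hb : HasDerivWithinAt b b' s t) (W : ℝ) :
    HasDerivWithinAt (fun t => guess a γ α b t W)
      (a * γ * (α' + b' * W) * Real.exp (-γ * (α t + b t * W))) s t :=
  ((((hα.add (hb.mul_const W)).const_mul (-γ)).exp.const_mul (-a))).congr_deriv (by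
    simp only [Pi.add_apply]
    ring)

lemma timeDeriv_guess (h : t0 < T) {t : ℝ} (ht : t ∈ Icc t0 T)
    (hα : DifferentiableWithinAt ℝ α (Icc t0 T) t) (hb : DifferentiableWithinAt ℝ b (Icc t0 T) t)
    (W : ℝ) :
    timeDeriv t0 T (guess a γ α b) t W = a * γ * (derivWithin α (Icc t0 T) t
      + derivWithin b (Icc t0 T) t * W) * Real.exp (-γ * (α t + b t * W)) :=
  (hasDerivWithinAt_guess hα.hasDerivWithinAt hb.hasDerivWithinAt W).derivWithin
    (uniqueDiffOn_Icc h t ht)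

lemma neg_guess_div (ha : 0 < a) (t W : ℝ) :
    -guess a γ α b t W / a = Real.exp (-γ * (α t + b t * W)) := by
  rw [guess]
  field_simp

/-- Taking logarithms recovers the exponent, so regularity of the value function passes to `α` (at
`W = 0`) and to `b` (difference of `W = 1` and `W = 0`). -/
lemma log_guess (ha : 0 < a) (hγ : 0 < γ) (t W : ℝ) :
    -(Real.log (-guess a γ α b t W / a) / γ) = α t + b t * W := by
  rw [neg_guess_div ha, Real.log_exp]
  field_simp

lemma IsC12.differentiableOn_exponent (ha : 0 < a) (hγ : 0 < γ)
    (h : IsC12 t0 T (guess a γ α b)) (W : ℝ) :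
    DifferentiableOn ℝ (fun t => α t + b t * W) (Icc t0 T) := by
  have h1 : DifferentiableOn ℝ (fun t => -(Real.log (-guess a γ α b t W / a) / γ)) (Icc t0 T) := by
    refine (DifferentiableOn.div_const (DifferentiableOn.log ?_ fun t _ => ?_) _).neg
    · exact (h.diff_time W).neg.div_const _
    · rw [neg_guess_div ha]
      exact (Real.exp_pos _).ne'
  exact h1.congr fun t _ => (log_guess ha hγ t W).symm

lemma IsC12.differentiableOn_left (ha : 0 < a) (hγ : 0 < γ)
    (h : IsC12 t0 T (guess a γ α b)) : DifferentiableOn ℝ α (Icc t0 T) := by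
  simpa using h.differentiableOn_exponent ha hγ 0

lemma IsC12.differentiableOn_right (ha : 0 < a) (hγ : 0 < γ)
    (h : IsC12 t0 T (guess a γ α b)) : DifferentiableOn ℝ b (Icc t0 T) := by
  refine ((h.differentiableOn_exponent ha hγ 1).sub (h.differentiableOn_left ha hγ)).congr
    fun t _ => by simp

lemma IsC12.continuousOn_derivWithin_left (ha : 0 < a) (hγ : 0 < γ) (h0 : t0 < T)
    (h : IsC12 t0 T (guess a γ α b)) : ContinuousOn (derivWithin α (Icc t0 T)) (Icc t0 T) := by
  have hα := h.differentiableOn_left ha hγ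
  have hb := h.differentiableOn_right ha hγ
  -- At `W = 0` the time derivative is `a γ α' e^{-γ α}`, so `α'` is a quotient of continuous
  -- functions.
  have h1 : ContinuousOn (fun t => timeDeriv t0 T (guess a γ α b) t 0) (Icc t0 T) :=
    h.cont_time.comp (f := fun t : ℝ => (t, (0 : ℝ))) (by fun_prop) fun t ht => ⟨ht, mem_univ _⟩
  have h2 : ContinuousOn (fun t => timeDeriv t0 T (guess a γ α b) t 0
      / (a * γ * Real.exp (-γ * α t))) (Icc t0 T) := by
    refine h1.div ?_ fun t _ => by positivity
    exact continuousOn_const.mul (continuousOn_const.mul hα.continuousOn).rexp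
  refine h2.congr fun t ht => ?_
  dsimp only
  rw [timeDeriv_guess h0 ht (hα t ht) (hb t ht)]
  simp only [mul_zero, add_zero]
  field_simp

lemma isC12_guess (h0 : t0 < T) (hα : DifferentiableOn ℝ α (Icc t0 T))
    (hb : DifferentiableOn ℝ b (Icc t0 T))
    (hα' : ContinuousOn (derivWithin α (Icc t0 T)) (Icc t0 T))
    (hb' : ContinuousOn (derivWithin b (Icc t0 T)) (Icc t0 T)) : IsC12 t0 T (guess a γ α b) := by
  have hfst : MapsTo (Prod.fst : ℝ × ℝ → ℝ) (Icc t0 T ×ˢ univ) (Icc t0 T) := fun x hx => hx.1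
  have e1 : ContinuousOn (fun x : ℝ × ℝ => α x.1) (Icc t0 T ×ˢ univ) :=
    hα.continuousOn.comp continuousOn_fst hfst
  have e2 : ContinuousOn (fun x : ℝ × ℝ => b x.1) (Icc t0 T ×ˢ univ) :=
    hb.continuousOn.comp continuousOn_fst hfst
  have e3 : ContinuousOn (fun x : ℝ × ℝ => derivWithin α (Icc t0 T) x.1) (Icc t0 T ×ˢ univ) :=
    hα'.comp continuousOn_fst hfst
  have e4 : ContinuousOn (fun x : ℝ × ℝ => derivWithin b (Icc t0 T) x.1) (Icc t0 T ×ˢ univ) :=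
    hb'.comp continuousOn_fst hfst
  have e5 : ContinuousOn (fun x : ℝ × ℝ => Real.exp (-γ * (α x.1 + b x.1 * x.2)))
      (Icc t0 T ×ˢ univ) :=
    (continuousOn_const.mul (e1.add (e2.mul continuousOn_snd))).rexp
  refine ⟨fun W t ht => ?_, fun t _ => ?_, continuousOn_const.mul e5, ?_, ?_, ?_⟩
  · exact (hasDerivWithinAt_guess (hα t ht).hasDerivWithinAt (hb t ht).hasDerivWithinAt
      W).differentiableWithinAt
  · unfold guess
    fun_prop
  · have h : ContinuousOn (fun x : ℝ × ℝ => a * γ * (derivWithin α (Icc t0 T) x.1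
        + derivWithin b (Icc t0 T) x.1 * x.2) * Real.exp (-γ * (α x.1 + b x.1 * x.2)))
        (Icc t0 T ×ˢ univ) :=
      (continuousOn_const.mul (e3.add (e4.mul continuousOn_snd))).mul e5
    exact h.congr fun x hx => timeDeriv_guess h0 hx.1 (hα _ hx.1) (hb _ hx.1) _
  · simp only [deriv_guess]
    exact (continuousOn_const.mul e2).mul e5
  · simp only [deriv_deriv_guess]
    exact (continuousOn_const.mul (e2.pow 2)).mul e5

lemma guess_eq_bequest_iff (ha : 0 < a) (hγ : 0 < γ) (t : ℝ) :
    (∀ W, guess a γ α b t W = bequest a γ W) ↔ α t = 0 ∧ b t = 1 := by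
  constructor
  · intro h
    have key : ∀ W, α t + b t * W = W := fun W => by
      have h1 := h W
      rw [guess, bequest, mul_right_inj' (neg_ne_zero.2 ha.ne'), Real.exp_eq_exp,
        mul_right_inj' (neg_ne_zero.2 hγ.ne')] at h1
      exact h1
    have h0 := key 0
    have h1 := key 1
    constructor <;> linarith
  · rintro ⟨h1, h2⟩ W
    simp [guess, bequest, h1, h2]

end Guess

/-! ### The standard HJB equation -/

section Standard

variable {m L : ℕ} (M : Market m L) {a γ t0 T : ℝ} {α b : ℝ → ℝ}

/-- After division by `a` times the common exponential, the equation is affine in `W`. The parameter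
`k` is the coefficient of a non-local term of the same exponential form; `k = 0` is the standard
equation. -/
lemma isHamiltonianMax_time_iff (ha : 0 < a) (hγ : 0 < γ) (h0 : t0 < T) {t : ℝ}
    (ht : t ∈ Icc t0 T) (hb : 0 < b t) (hα' : DifferentiableWithinAt ℝ α (Icc t0 T) t)
    (hb' : DifferentiableWithinAt ℝ b (Icc t0 T) t) {W : ℝ} (hW : W ≠ 0) (q k : ℝ) :
    IsHamiltonianMax M (utility γ) (guess a γ α b) t W
        (q * guess a γ α b t W + a * k * Real.exp (-γ * (α t + b t * W))
          - timeDeriv t0 T (guess a γ α b) t W) ↔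
      -q + k - γ * derivWithin α (Icc t0 T) t + b t - 1 / 2 * M.kappa + γ * α t * b t
          - b t * Real.log (a * γ * b t)
        = γ * (derivWithin b (Icc t0 T) t - (b t ^ 2 - M.mu0 * b t)) * W := by
  rw [isHamiltonianMax_guess_iff M ha hγ hb hW, timeDeriv_guess h0 ht hα' hb', guess,
    hamiltonianMax]
  have hE := Real.exp_pos (-γ * (α t + b t * W))
  generalize Real.exp (-γ * (α t + b t * W)) = E at hE ⊢
  have key : q * (-a * E) + a * k * E
        - a * γ * (derivWithin α (Icc t0 T) t + derivWithin b (Icc t0 T) t * W) * E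
      - (-a * b t * E + a / 2 * M.kappa * E
        + (M.mu0 * W - α t - b t * W + Real.log (a * γ * b t) / γ) * (a * γ * b t * E))
      = a * E * ((-q + k - γ * derivWithin α (Icc t0 T) t + b t - 1 / 2 * M.kappa + γ * α t * b t
          - b t * Real.log (a * γ * b t))
        - γ * (derivWithin b (Icc t0 T) t - (b t ^ 2 - M.mu0 * b t)) * W) := by
    field_simp
    ring
  rw [← sub_eq_zero, key, mul_eq_zero_iff_left (by positivity), sub_eq_zero]

/-- The coefficient of the guess solving the Riccati equation is `β`. -/
lemma eqOn_beta_of_riccati (h0 : t0 ≤ T) (hb : ∀ t ∈ Icc t0 T, 0 < b t)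
    (hb' : ∀ t ∈ Icc t0 T, HasDerivWithinAt b (b t ^ 2 - M.mu0 * b t) (Icc t0 T) t)
    (hT : b T = 1) : EqOn b (beta M.mu0 T) (Icc t0 T) := by
  intro t ht
  -- The Riccati equation is of Bernoulli type: reciprocals satisfy `y' = μ₀ y - 1`, and their
  -- difference solves `y' = μ₀ y`.
  have h := eq_zero_of_linear_ode (f := fun t => (b t)⁻¹ - (beta M.mu0 T t)⁻¹)
    (k := fun _ => M.mu0) (a := t0) (b := T) (c := T) continuousOn_const (fun t ht => by
      have p1 := hb t ht
      have p2 := beta_pos M.mu0_pos ht.2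
      refine (((hb' t ht).inv p1.ne').sub ((hasDerivAt_beta M.mu0_pos
        ht.2).hasDerivWithinAt.inv p2.ne')).congr_deriv ?_
      field_simp
      ring) (right_mem_Icc.2 h0) (by simp [hT, beta_terminal M.mu0_pos]) ht
  exact inv_injective (sub_eq_zero.1 h)

lemma continuousOn_delta (ha : 0 < a) (hγ : 0 < γ) :
    ContinuousOn (delta M a γ T) (Icc t0 T) := by
  have h := continuousOn_beta M.mu0_pos t0 T
  refine (h.sub continuousOn_const).sub (h.mul ((continuousOn_const.mul h).log fun t ht => ?_))
  exact (mul_pos (mul_pos ha hγ) (beta_pos M.mu0_pos ht.2)).ne'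

/-- The formula for `alphaStd` is variation of constants. -/
lemma hasDerivWithinAt_alphaStd (ha : 0 < a) (hγ : 0 < γ) {q : ℝ → ℝ}
    (hq : ContinuousOn q (Icc t0 T)) {t : ℝ} (ht : t ∈ Icc t0 T) :
    HasDerivWithinAt (alphaStd M a γ T q)
      (beta M.mu0 T t * alphaStd M a γ T q t + (delta M a γ T t - q t) / γ) (Icc t0 T) t := by
  have hT : T ∈ Icc t0 T := ⟨ht.1.trans ht.2, le_rfl⟩
  have hβ := continuousOn_beta M.mu0_pos t0 T
  have h1 : ∀ s ∈ Icc t0 T, HasDerivWithinAt (fun s => ∫ τ in s..T, beta M.mu0 T τ)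
      (-beta M.mu0 T s) (Icc t0 T) s := fun s hs => hasDerivWithinAt_integral_left hβ hT hs
  have h2 : ContinuousOn (fun s => ∫ τ in s..T, beta M.mu0 T τ) (Icc t0 T) := fun s hs =>
    (h1 s hs).continuousWithinAt
  have h3 := hasDerivWithinAt_integral_left
    (((continuousOn_delta M (t0 := t0) (T := T) ha hγ).sub hq).mul h2.rexp) hT ht
  refine (((h1 t ht).neg.exp.const_mul (-(1 / γ))).mul h3).congr_deriv ?_
  simp only [Pi.neg_apply, Pi.mul_apply, alphaStd, Pi.sub_apply]
  have e : Real.exp (-∫ τ in t..T, beta M.mu0 T τ) * Real.exp (∫ τ in t..T, beta M.mu0 T τ) = 1 := by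
    rw [← Real.exp_add]
    simp
  generalize Real.exp (-∫ τ in t..T, beta M.mu0 T τ) = x at e ⊢
  generalize Real.exp (∫ τ in t..T, beta M.mu0 T τ) = y at e ⊢
  linear_combination (delta M a γ T t - q t) / γ * e

lemma alphaStd_terminal (q : ℝ → ℝ) : alphaStd M a γ T q T = 0 := by
  simp [alphaStd]

lemma solvesHJB_guess_iff (ha : 0 < a) (hγ : 0 < γ) (h0 : t0 < T) {q : ℝ → ℝ}
    (hq : ContinuousOn q (Icc t0 T)) (hb : ∀ t ∈ Icc t0 T, 0 < b t) :
    SolvesHJB M (utility γ) (bequest a γ) q t0 T (guess a γ α b) (caraRule M a γ α b) ↔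
      EqOn b (beta M.mu0 T) (Icc t0 T) ∧ EqOn α (alphaStd M a γ T q) (Icc t0 T) := by
  have hT : T ∈ Icc t0 T := right_mem_Icc.2 h0.le
  have eq_iff := fun t (ht : t ∈ Icc t0 T) hα' hb' W hW =>
    isHamiltonianMax_time_iff M (α := α) ha hγ h0 ht (hb t ht) hα' hb' (W := W) hW (q t) 0
  simp only [mul_zero, zero_mul, add_zero] at eq_iff
  constructor
  · intro h
    have dα := h.smooth.differentiableOn_left ha hγ
    have db := h.smooth.differentiableOn_right ha hγ
    obtain ⟨hαT, hbT⟩ := (guess_eq_bequest_iff ha hγ T).1 h.terminal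
    have key : ∀ t ∈ Icc t0 T, derivWithin b (Icc t0 T) t = b t ^ 2 - M.mu0 * b t ∧
        γ * derivWithin α (Icc t0 T) t = -q t + b t - 1 / 2 * M.kappa + γ * α t * b t
          - b t * Real.log (a * γ * b t) := fun t ht => by
      -- Two admissible wealth values suffice to separate the slope and the constant part of the
      -- affine identity.
      have h1 := (eq_iff t ht (dα t ht) (db t ht) 1 one_ne_zero).1 (h.hjb t ht 1 one_ne_zero).1
      have h2 := (eq_iff t ht (dα t ht) (db t ht) 2 two_ne_zero).1 (h.hjb t ht 2 two_ne_zero).1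
      have h3 : γ * (derivWithin b (Icc t0 T) t - (b t ^ 2 - M.mu0 * b t)) = 0 := by linarith
      have h4 := (mul_eq_zero.1 h3).resolve_left hγ.ne'
      exact ⟨by linarith, by rw [h3] at h1; linarith⟩
    have hbβ : EqOn b (beta M.mu0 T) (Icc t0 T) := eqOn_beta_of_riccati M h0.le hb
      (fun t ht => (key t ht).1 ▸ (db t ht).hasDerivWithinAt) hbT
    refine ⟨hbβ, fun t ht => ?_⟩
    -- Both functions solve the same inhomogeneous equation and vanish at `T`.
    have h5 := eq_zero_of_linear_ode (f := fun t => α t - alphaStd M a γ T q t)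
      (continuousOn_beta M.mu0_pos t0 T) (fun t ht => by
        refine ((dα t ht).hasDerivWithinAt.sub
          (hasDerivWithinAt_alphaStd M ha hγ hq ht)).congr_deriv ?_
        have h6 := (key t ht).2
        rw [hbβ ht] at h6
        rw [← mul_right_inj' hγ.ne', mul_sub, h6, delta]
        field_simp
        ring) hT (by simp [hαT, alphaStd_terminal]) ht
    exact sub_eq_zero.1 h5
  · rintro ⟨hbβ, hα⟩
    have db : ∀ t ∈ Icc t0 T, HasDerivWithinAt b
        (beta M.mu0 T t ^ 2 - M.mu0 * beta M.mu0 T t) (Icc t0 T) t := fun t ht =>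
      (hasDerivAt_beta M.mu0_pos ht.2).hasDerivWithinAt.congr hbβ (hbβ ht)
    have dα : ∀ t ∈ Icc t0 T, HasDerivWithinAt α
        (beta M.mu0 T t * alphaStd M a γ T q t + (delta M a γ T t - q t) / γ) (Icc t0 T) t :=
      fun t ht => (hasDerivWithinAt_alphaStd M ha hγ hq ht).congr hα (hα ht)
    have ub := fun t ht => (db t ht).derivWithin (uniqueDiffOn_Icc h0 t ht)
    have uα := fun t ht => (dα t ht).derivWithin (uniqueDiffOn_Icc h0 t ht)
    have cβ := continuousOn_beta M.mu0_pos t0 T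
    have cα : ContinuousOn (alphaStd M a γ T q) (Icc t0 T) := fun t ht =>
      (hasDerivWithinAt_alphaStd M ha hγ hq ht).continuousWithinAt
    refine ⟨isC12_guess h0 (fun t ht => (dα t ht).differentiableWithinAt)
      (fun t ht => (db t ht).differentiableWithinAt) ?_ ?_, ?_, fun t ht W hW => ⟨?_, ?_⟩⟩
    · exact ((cβ.mul cα).add (((continuousOn_delta M ha hγ).sub hq).div_const γ)).congr uα
    · exact ((cβ.pow 2).sub (continuousOn_const.mul cβ)).congr ub
    · rw [guess_eq_bequest_iff ha hγ, hα hT, hbβ hT]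
      exact ⟨alphaStd_terminal M q, beta_terminal M.mu0_pos T⟩
    · rw [eq_iff t ht (dα t ht).differentiableWithinAt (db t ht).differentiableWithinAt W hW,
        ub t ht, uα t ht, hbβ ht, hα ht, delta]
      field_simp
      ring
    · exact isHamiltonianMax_caraRule M ha hγ (hb t ht) hW

end Standard

/-! ### The discount factor and Volterra integrals -/

lemma discount_pos (r : ℝ → ℝ) (τ : ℝ) : 0 < discount r τ := Real.exp_pos _

lemma discount_zero (r : ℝ → ℝ) : discount r 0 = 1 := by simp [discount]

lemma hasDerivAt_discount {r : ℝ → ℝ} (hr : Continuous r) (τ : ℝ) :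
    HasDerivAt (discount r) (-(r τ * discount r τ)) τ := by
  have h := (hr.integral_hasStrictDerivAt 0 τ).hasDerivAt.neg.exp
  exact h.congr_deriv (by simp [discount, mul_comm])

lemma continuous_discount {r : ℝ → ℝ} (hr : Continuous r) : Continuous (discount r) :=
  continuous_iff_continuousAt.2 fun τ => (hasDerivAt_discount hr τ).continuousAt

lemma discount_congr {r r' : ℝ → ℝ} {T τ : ℝ} (h : EqOn r r' (Icc 0 T)) (hτ : τ ∈ Icc 0 T) :
    discount r τ = discount r' τ := by
  rw [discount, discount, integral_congr_Icc h ⟨le_rfl, hτ.1.trans hτ.2⟩ hτ]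

/-- Differentiation of a convolution integral. -/
lemma hasDerivAt_convolution {f f' k : ℝ → ℝ} (hf : ∀ x, HasDerivAt f (f' x) x)
    (hf' : Continuous f') (hk : Continuous k) (T t : ℝ) :
    HasDerivAt (fun t => ∫ s in t..T, f (s - t) * k s)
      (-(f 0 * k t) - ∫ s in t..T, f' (s - t) * k s) t := by
  have hfc : Continuous f := continuous_iff_continuousAt.2 fun x => (hf x).continuousAt
  -- The time `t` occurs in the kernel and as lower limit. The occurrences become independent
  -- variables `x` and `y`; jointly continuous partial derivatives give differentiability in the
  -- plane, which is then restricted to the diagonal.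
  have d1 : ∀ x y : ℝ, HasDerivAt (fun x => ∫ s in y..T, f (s - x) * k s)
      (∫ s in y..T, -f' (s - x) * k s) x := fun x y => by
    have hc : Continuous (fun p : ℝ × ℝ => -f' (p.2 - p.1) * k p.2) := by fun_prop
    obtain ⟨C, hC⟩ := ((isCompact_closedBall x 1).prod isCompact_uIcc
      (t := uIcc y T)).exists_bound_of_continuousOn hc.continuousOn
    refine (intervalIntegral.hasDerivAt_integral_of_dominated_loc_of_deriv_le
      (F := fun x s => f (s - x) * k s) (F' := fun x s => -f' (s - x) * k s)
      (bound := fun _ => C) (Metric.closedBall_mem_nhds x one_pos)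
      (.of_forall fun x => ?_) ?_ ?_ (.of_forall fun s hs x' hx' => ?_) ?_
      (.of_forall fun s _ x' _ => ?_)).2
    · exact Continuous.aestronglyMeasurable (by fun_prop)
    · exact Continuous.intervalIntegrable (by fun_prop) _ _
    · exact Continuous.aestronglyMeasurable (by fun_prop)
    · exact hC (x', s) ⟨hx', uIoc_subset_uIcc hs⟩
    · exact intervalIntegrable_const
    · have := ((hf (s - x')).comp x' ((hasDerivAt_id x').const_sub s)).mul_const (k s)
      exact this.congr_deriv (by ring)
  have d2 : ∀ x y : ℝ, HasDerivAt (fun y => ∫ s in y..T, f (s - x) * k s)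
      (-(f (y - x) * k y)) y := fun x y => by
    have hc : Continuous (fun s => f (s - x) * k s) := by fun_prop
    exact intervalIntegral.integral_hasDerivAt_left (hc.intervalIntegrable _ _)
      (hc.stronglyMeasurableAtFilter _ _) hc.continuousAt
  have c1 : Continuous (fun p : ℝ × ℝ => ∫ s in p.2..T, -f' (s - p.1) * k s) := by
    have e : (fun p : ℝ × ℝ => ∫ s in p.2..T, -f' (s - p.1) * k s)
        = fun p => -∫ s in T..p.2, -f' (s - p.1) * k s :=
      funext fun p => intervalIntegral.integral_symm _ _
    rw [e]
    refine (intervalIntegral.continuous_parametric_intervalIntegral_of_continuous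
      (f := fun (p : ℝ × ℝ) s => -f' (s - p.1) * k s) ?_ continuous_snd).neg
    fun_prop
  have key := hasStrictFDerivAt_uncurry_coprod (𝕜 := ℝ) (u := (t, t))
    (f := fun x y => ∫ s in y..T, f (s - x) * k s)
    (f₁ := fun x y => ContinuousLinearMap.toSpanSingleton ℝ (∫ s in y..T, -f' (s - x) * k s))
    (f₂ := fun x y => ContinuousLinearMap.toSpanSingleton ℝ (-(f (y - x) * k y)))
    (.of_forall fun v => (d1 v.1 v.2).hasFDerivAt) (.of_forall fun v => (d2 v.1 v.2).hasFDerivAt)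
    (by
      have : Continuous (fun v : ℝ × ℝ => ContinuousLinearMap.toSpanSingleton ℝ
          (∫ s in v.2..T, -f' (s - v.1) * k s)) :=
        (ContinuousLinearMap.toSpanSingletonCLE (𝕜 := ℝ)).continuous.comp c1
      exact this.continuousAt)
    (by
      have : Continuous (fun v : ℝ × ℝ => ContinuousLinearMap.toSpanSingleton ℝ
          (-(f (v.2 - v.1) * k v.2))) :=
        (ContinuousLinearMap.toSpanSingletonCLE (𝕜 := ℝ)).continuous.comp (by fun_prop)
      exact this.continuousAt)
  have hp : HasDerivAt (fun x : ℝ => (x, x)) ((1 : ℝ), (1 : ℝ)) t :=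
    (hasDerivAt_id t).prodMk (hasDerivAt_id t)
  have h := HasFDerivAt.comp_hasDerivAt (f := fun x : ℝ => (x, x)) t key.hasFDerivAt hp
  refine h.congr_deriv ?_
  simp [Function.HasUncurry.uncurry, neg_mul, intervalIntegral.integral_neg]
  ring

lemma sub_mem_Icc {s t T : ℝ} (ht : t ∈ Icc 0 T) (hs : s ∈ Icc t T) : s - t ∈ Icc 0 T :=
  ⟨sub_nonneg.2 hs.1, by linarith [ht.1, hs.2]⟩

lemma mem_Icc_of_uIcc {s t T : ℝ} (ht : t ∈ Icc 0 T) (hs : s ∈ uIcc t T) : s ∈ Icc t T := by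
  rwa [uIcc_of_le ht.2] at hs

/-- Derivative of the right-hand side of the Volterra equation. The lower limit contributes `-k t`
because `θ(0) = 1`; the other terms come from `θ' = -r θ`. -/
lemma hasDerivWithinAt_discount_convolution {r k : ℝ → ℝ} {T t : ℝ}
    (hr : ContinuousOn r (Icc 0 T)) (hk : ContinuousOn k (Icc 0 T)) (ht : t ∈ Icc 0 T) :
    HasDerivWithinAt (fun t => (∫ s in t..T, discount r (s - t) * k s) + discount r (T - t))
      (-k t + (∫ s in t..T, r (s - t) * discount r (s - t) * k s)
        + r (T - t) * discount r (T - t)) (Icc 0 T) t := by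
  have hT : 0 ≤ T := ht.1.trans ht.2
  obtain ⟨r', hr', er⟩ := exists_continuous_eqOn_Icc hT hr
  obtain ⟨k', hk', ek⟩ := exists_continuous_eqOn_Icc hT hk
  have e1 : ∀ t ∈ Icc 0 T, ∀ s ∈ uIcc t T, discount r (s - t) * k s
      = discount r' (s - t) * k' s := fun t ht s hs => by
    have hs' := mem_Icc_of_uIcc ht hs
    rw [discount_congr er (sub_mem_Icc ht hs'), ek ⟨ht.1.trans hs'.1, hs'.2⟩]
  have hTt : ∀ t ∈ Icc 0 T, T - t ∈ Icc 0 T := fun t ht => sub_mem_Icc ht ⟨ht.2, le_rfl⟩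
  have h1 := hasDerivAt_convolution (hasDerivAt_discount hr')
    (hr'.mul (continuous_discount hr')).neg hk' T t
  have h2 := (hasDerivAt_discount hr' (T - t)).comp t ((hasDerivAt_id t).const_sub T)
  refine ((h1.add h2).hasDerivWithinAt.congr_of_mem (fun t ht => ?_) ht).congr_deriv ?_
  · simp only [Pi.add_apply, Function.comp_apply]
    rw [discount_congr er (hTt t ht), intervalIntegral.integral_congr (e1 t ht)]
  · rw [discount_congr er (hTt t ht), er (hTt t ht), ek ht, discount_zero]
    have e2 : ∫ s in t..T, r (s - t) * discount r (s - t) * k s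
        = ∫ s in t..T, r' (s - t) * discount r' (s - t) * k' s :=
      intervalIntegral.integral_congr fun s hs => by
        have := e1 t ht s hs
        have hs' := mem_Icc_of_uIcc ht hs
        rw [mul_assoc, this, er (sub_mem_Icc ht hs'), mul_assoc]
    rw [e2]
    simp only [neg_mul, intervalIntegral.integral_neg]
    ring

/-- A backward integral inequality of Grönwall type. -/
lemma eq_zero_of_abs_le_integral {d : ℝ → ℝ} {T C : ℝ} (hd : ContinuousOn d (Icc 0 T))
    (h : ∀ t ∈ Icc 0 T, |d t| ≤ C * ∫ s in t..T, |d s|) : ∀ t ∈ Icc 0 T, d t = 0 := by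
  intro t ht
  have hT : T ∈ Icc 0 T := ⟨ht.1.trans ht.2, le_rfl⟩
  -- With `G(t) = ∫_t^T |d|`, the hypothesis reads `G' ≥ -C G`. So `G e^{C t}` is nondecreasing,
  -- nonnegative and zero at `T`, hence zero.
  have hder : ∀ t ∈ Icc 0 T, HasDerivWithinAt
      (fun t => (∫ s in t..T, |d s|) * Real.exp (C * t))
      ((-|d t| + C * ∫ s in t..T, |d s|) * Real.exp (C * t)) (Icc 0 T) t := fun t ht => by
    have h1 := hasDerivWithinAt_integral_left hd.abs hT ht
    have h2 : HasDerivWithinAt (fun t => C * t) C (Icc 0 T) t := by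
      simpa using (hasDerivWithinAt_id t (Icc 0 T)).const_mul C
    exact (h1.mul h2.exp).congr_deriv (by ring)
  have hmono : MonotoneOn (fun t => (∫ s in t..T, |d s|) * Real.exp (C * t)) (Icc 0 T) := by
    refine monotoneOn_of_hasDerivWithinAt_nonneg (convex_Icc 0 T)
      (fun t ht => (hder t ht).continuousWithinAt)
      (fun t ht => (hder t (interior_subset ht)).mono interior_subset) fun t ht => ?_
    exact mul_nonneg (by linarith [h t (interior_subset ht)]) (Real.exp_pos _).le
  have h3 := hmono ht hT ht.2
  simp only [intervalIntegral.integral_same, zero_mul] at h3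
  have h4 : 0 ≤ ∫ s in t..T, |d s| :=
    intervalIntegral.integral_nonneg ht.2 fun s _ => abs_nonneg _
  have h5 : ∫ s in t..T, |d s| = 0 :=
    le_antisymm (nonpos_of_mul_nonpos_left h3 (Real.exp_pos _)) h4
  have h6 := h t ht
  rw [h5, mul_zero] at h6
  exact abs_nonpos_iff.1 h6

/-- The linear Volterra equation satisfied by the discounted marginal utility of wealth. -/
def SolvesVolterra (mu0 T : ℝ) (r h : ℝ → ℝ) : Prop :=
  ∀ t ∈ Icc 0 T, h t = (∫ s in t..T, discount r (s - t) * (beta mu0 T s * h s))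
    + discount r (T - t)

lemma exists_discount_bound {r : ℝ → ℝ} {T : ℝ} (hr : ContinuousOn r (Icc 0 T)) :
    ∃ C, 0 < C ∧ ∀ τ ∈ Icc 0 T, |discount r τ| ≤ C := by
  rcases lt_or_ge T 0 with hT | hT
  · exact ⟨1, one_pos, fun τ hτ => absurd (hτ.1.trans hτ.2) (not_le.2 hT)⟩
  obtain ⟨r', hr', er⟩ := exists_continuous_eqOn_Icc hT hr
  obtain ⟨C, hC⟩ := isCompact_Icc.exists_bound_of_continuousOn
    (continuous_discount hr').continuousOn (s := Icc 0 T)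
  refine ⟨|C| + 1, by positivity, fun τ hτ => ?_⟩
  rw [discount_congr er hτ]
  exact (hC τ hτ).trans (by linarith [le_abs_self C])

lemma continuousOn_discount {r : ℝ → ℝ} {T : ℝ} (hT : 0 ≤ T) (hr : ContinuousOn r (Icc 0 T)) :
    ContinuousOn (discount r) (Icc 0 T) := by
  obtain ⟨r', hr', er⟩ := exists_continuous_eqOn_Icc hT hr
  exact (continuous_discount hr').continuousOn.congr fun τ hτ => discount_congr er hτ

lemma continuousOn_comp_sub {f : ℝ → ℝ} {T t : ℝ} (hf : ContinuousOn f (Icc 0 T))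
    (ht : t ∈ Icc 0 T) : ContinuousOn (fun s => f (s - t)) (Icc t T) :=
  hf.comp (by fun_prop) fun _ hs => sub_mem_Icc ht hs

lemma Icc_subset_Icc_zero {t T : ℝ} (ht : t ∈ Icc 0 T) : Icc t T ⊆ Icc 0 T :=
  Icc_subset_Icc_left ht.1

/-- The forcing terms cancel in the difference, and the kernel is bounded by `C * D`, so the
Grönwall inequality applies. -/
lemma SolvesVolterra.eqOn {mu0 T : ℝ} (h0 : 0 < mu0) {r h h' : ℝ → ℝ}
    (hr : ContinuousOn r (Icc 0 T)) (hc : ContinuousOn h (Icc 0 T))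
    (hc' : ContinuousOn h' (Icc 0 T)) (hh : SolvesVolterra mu0 T r h)
    (hh' : SolvesVolterra mu0 T r h') : EqOn h h' (Icc 0 T) := by
  rcases lt_or_ge T 0 with hT | hT
  · exact fun t ht => absurd (ht.1.trans ht.2) (not_le.2 hT)
  obtain ⟨C, hC0, hC⟩ := exists_discount_bound hr
  have hβ := continuousOn_beta h0 0 T
  obtain ⟨D, hD⟩ := isCompact_Icc.exists_bound_of_continuousOn hβ
  have hd := continuousOn_discount hT hr
  have key := eq_zero_of_abs_le_integral (d := fun t => h t - h' t) (C := C * D) (hc.sub hc')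
    fun t ht => by
      have hTm : T ∈ Icc t T := ⟨ht.2, le_rfl⟩
      have htm : t ∈ Icc t T := ⟨le_rfl, ht.2⟩
      have ci : ∀ h : ℝ → ℝ, ContinuousOn h (Icc 0 T) →
          ContinuousOn (fun s => discount r (s - t) * (beta mu0 T s * h s)) (Icc t T) :=
        fun h hc => (continuousOn_comp_sub hd ht).mul
          ((hβ.mul hc).mono (Icc_subset_Icc_zero ht))
      rw [hh t ht, hh' t ht, add_sub_add_right_eq_sub, ← intervalIntegral.integral_sub
        (intervalIntegrable_of_continuousOn_Icc (ci h hc) htm hTm)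
        (intervalIntegrable_of_continuousOn_Icc (ci h' hc') htm hTm),
        ← intervalIntegral.integral_const_mul]
      change ‖(_ : ℝ)‖ ≤ _
      refine intervalIntegral.norm_integral_le_of_norm_le ht.2 (.of_forall fun s hs => ?_)
        (intervalIntegrable_of_continuousOn_Icc (continuousOn_const.mul
          ((hc.sub hc').mono (Icc_subset_Icc_zero ht)).abs) htm hTm)
      have hs' : s ∈ Icc t T := ⟨hs.1.le, hs.2⟩
      rw [← mul_sub, ← mul_sub, ← mul_assoc, norm_mul, norm_mul]
      exact mul_le_mul_of_nonneg_right (mul_le_mul (hC _ (sub_mem_Icc ht hs'))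
        (hD s (Icc_subset_Icc_zero ht hs')) (norm_nonneg _) hC0.le) (abs_nonneg _)
  exact fun t ht => sub_eq_zero.1 (key t ht)

lemma SolvesVolterra.terminal {mu0 T : ℝ} {r h : ℝ → ℝ} (hT : 0 ≤ T)
    (hh : SolvesVolterra mu0 T r h) : h T = 1 := by
  simpa [discount_zero] using hh T ⟨hT, le_rfl⟩

/-- At the last time with `h ≤ 0` the integral over later times is nonnegative and the forcing term
is positive, a contradiction. Positivity allows division by `h` when `α` is recovered. -/
lemma SolvesVolterra.pos {mu0 T : ℝ} (h0 : 0 < mu0) {r h : ℝ → ℝ}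
    (hc : ContinuousOn h (Icc 0 T)) (hh : SolvesVolterra mu0 T r h) : ∀ t ∈ Icc 0 T, 0 < h t := by
  by_contra! hne
  obtain ⟨t0, ht0, hneg⟩ := hne
  have hcomp : IsCompact (Icc 0 T ∩ h ⁻¹' Iic 0) :=
    isCompact_Icc.of_isClosed_subset (hc.preimage_isClosed_of_isClosed isClosed_Icc isClosed_Iic)
      inter_subset_left
  obtain ⟨t, ⟨ht, hle⟩, hmax⟩ := hcomp.exists_isGreatest ⟨t0, ht0, hneg⟩
  have h1 : 0 ≤ ∫ s in t..T, discount r (s - t) * (beta mu0 T s * h s) := by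
    rw [intervalIntegral.integral_of_le ht.2]
    refine setIntegral_nonneg measurableSet_Ioc fun s hs => ?_
    have hs' : 0 < h s := by
      by_contra! hs0
      exact absurd (hmax ⟨⟨ht.1.trans hs.1.le, hs.2⟩, hs0⟩) (not_le.2 hs.1)
    exact (mul_pos (discount_pos _ _) (mul_pos (beta_pos h0 hs.2) hs')).le
  have h2 := hh t ht
  have h3 := discount_pos r (T - t)
  have h4 : h t ≤ 0 := hle
  linarith

/-- Existence for the linear Volterra equation, by contraction in an exponentially weighted
norm. -/
lemma exists_solvesVolterra {mu0 T : ℝ} (h0 : 0 < mu0) (hT : 0 ≤ T) {r : ℝ → ℝ}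
    (hr : ContinuousOn r (Icc 0 T)) :
    ∃ h : ℝ → ℝ, ContinuousOn h (Icc 0 T) ∧ SolvesVolterra mu0 T r h := by
  obtain ⟨r', hr', er⟩ := exists_continuous_eqOn_Icc hT hr
  obtain ⟨β, hβ, eβ⟩ := exists_continuous_eqOn_Icc hT (continuousOn_beta h0 0 T)
  have hd := continuous_discount hr'
  have hc : Continuous (fun p : ℝ × ℝ => discount r' (p.2 - p.1) * β p.2) := by fun_prop
  obtain ⟨C₀, hC₀⟩ := (isCompact_Icc.prod isCompact_Icc
    (s := Icc 0 T) (t := Icc 0 T)).exists_bound_of_continuousOn hc.continuousOn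
  set C := |C₀| + 1 with hCdef
  have hC0 : 0 < C := by positivity
  have hC : ∀ t ∈ Icc 0 T, ∀ s ∈ Icc 0 T, |discount r' (s - t) * β s| ≤ C := fun t ht s hs =>
    (hC₀ (t, s) ⟨ht, hs⟩).trans (by linarith [le_abs_self C₀])
  let ext : C(Icc 0 T, ℝ) → ℝ → ℝ := fun k => IccExtend hT k
  have ext_cont : ∀ k, Continuous (ext k) := fun k => k.continuous.Icc_extend'
  -- The equation for `k(t) = e^{-2C(T-t)} h(t)`. As `C` bounds the kernel, the rate `2 * C` gives
  -- the Lipschitz constant `C ∫ e^{-2C(s-t)} ds ≤ 1/2`.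
  let F : C(Icc 0 T, ℝ) → ℝ → ℝ := fun k t =>
    (∫ s in t..T, discount r' (s - t) * β s * Real.exp (-(2 * C) * (s - t)) * ext k s)
      + discount r' (T - t) * Real.exp (-(2 * C) * (T - t))
  have F_cont : ∀ k, Continuous (F k) := fun k => by
    have hk := ext_cont k
    refine Continuous.add ?_ (by fun_prop)
    have e : (fun t => ∫ s in t..T, discount r' (s - t) * β s * Real.exp (-(2 * C) * (s - t))
        * ext k s) = fun t => -∫ s in T..t, discount r' (s - t) * β s
          * Real.exp (-(2 * C) * (s - t)) * ext k s :=
      funext fun t => intervalIntegral.integral_symm _ _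
    rw [e]
    refine (intervalIntegral.continuous_parametric_intervalIntegral_of_continuous
      (f := fun t s => discount r' (s - t) * β s * Real.exp (-(2 * C) * (s - t)) * ext k s)
      ?_ continuous_id).neg
    fun_prop
  let Φ : C(Icc 0 T, ℝ) → C(Icc 0 T, ℝ) := fun k =>
    ⟨fun t => F k t, (F_cont k).comp continuous_subtype_val⟩
  have hΦ : ContractingWith (1 / 2) Φ := by
    refine ⟨by norm_num, LipschitzWith.of_dist_le_mul fun k k' => ?_⟩
    refine (ContinuousMap.dist_le (by positivity)).2 fun t => ?_
    have ht := t.2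
    have ii : ∀ k, IntervalIntegrable (fun s => discount r' (s - t) * β s
        * Real.exp (-(2 * C) * (s - t)) * ext k s) volume t T := fun k => by
      have hk := ext_cont k
      exact Continuous.intervalIntegrable (by fun_prop) _ _
    have hexp : ∫ s in (t : ℝ)..T, C * Real.exp (-(2 * C) * (s - t)) * dist k k'
        = (1 - Real.exp (-(2 * C) * (T - t))) / 2 * dist k k' := by
      rw [intervalIntegral.integral_mul_const, intervalIntegral.integral_const_mul]
      have hder : ∀ s ∈ uIcc (t : ℝ) T, HasDerivAt
          (fun s => -(1 / (2 * C)) * Real.exp (-(2 * C) * (s - t)))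
          (Real.exp (-(2 * C) * (s - t))) s := fun s _ => by
        have h1 : HasDerivAt (fun s : ℝ => -(2 * C) * (s - t)) (-(2 * C)) s := by
          simpa using ((hasDerivAt_id s).sub_const (t : ℝ)).const_mul (-(2 * C))
        refine (h1.exp.const_mul (-(1 / (2 * C)))).congr_deriv ?_
        field_simp
      rw [intervalIntegral.integral_eq_sub_of_hasDerivAt hder
        (Continuous.intervalIntegrable (by fun_prop) _ _)]
      simp only [sub_self, mul_zero, Real.exp_zero]
      field_simp
      ring
    have hle : dist (Φ k t) (Φ k' t)
        ≤ ∫ s in (t : ℝ)..T, C * Real.exp (-(2 * C) * (s - t)) * dist k k' := by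
      change ‖F k t - F k' t‖ ≤ _
      simp only [F]
      rw [add_sub_add_right_eq_sub, ← intervalIntegral.integral_sub (ii k) (ii k')]
      refine intervalIntegral.norm_integral_le_of_norm_le ht.2 (.of_forall fun s hs => ?_)
        (Continuous.intervalIntegrable (μ := volume) (u := fun s =>
          C * Real.exp (-(2 * C) * (s - t)) * dist k k') (by fun_prop) _ _)
      have hs' : s ∈ Icc 0 T := ⟨ht.1.trans hs.1.le, hs.2⟩
      rw [← mul_sub, norm_mul, norm_mul, Real.norm_of_nonneg (Real.exp_pos _).le]
      gcongr
      · exact hC t ht s hs'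
      · simp only [ext]
        rw [IccExtend_of_mem hT _ hs', IccExtend_of_mem hT _ hs', ← dist_eq_norm]
        exact ContinuousMap.dist_apply_le_dist (f := k) (g := k') _
    refine hle.trans ?_
    rw [hexp]
    have h1 := Real.exp_pos (-(2 * C) * (T - t))
    have h2 := dist_nonneg (x := k) (y := k')
    have h3 : (((1 / 2 : ℝ≥0)) : ℝ) = 1 / 2 := by norm_num
    rw [h3]
    gcongr
    linarith
  obtain ⟨k, hk⟩ : ∃ k, Φ k = k := ⟨_, hΦ.fixedPoint_isFixedPt⟩
  refine ⟨fun t => Real.exp (2 * C * (T - t)) * ext k t, ?_, fun t ht => ?_⟩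
  · have := ext_cont k
    exact Continuous.continuousOn (by fun_prop)
  · have hkt : ext k t = F k t := by
      simp only [ext]
      rw [IccExtend_of_mem hT _ ht]
      conv_lhs => rw [← hk]
      rfl
    dsimp only
    rw [hkt]
    simp only [F]
    rw [mul_add, ← intervalIntegral.integral_const_mul]
    congr 1
    · refine intervalIntegral.integral_congr fun s hs => ?_
      have hs' := mem_Icc_of_uIcc ht hs
      rw [discount_congr er (sub_mem_Icc ht hs'), eβ (Icc_subset_Icc_zero ht hs')]
      have : Real.exp (2 * C * (T - s))
          = Real.exp (2 * C * (T - t)) * Real.exp (-(2 * C) * (s - t)) := by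
        rw [← Real.exp_add]
        ring_nf
      rw [this]
      ring
    · rw [discount_congr er (sub_mem_Icc ht ⟨ht.2, le_rfl⟩)]
      have : Real.exp (2 * C * (T - t)) * Real.exp (-(2 * C) * (T - t)) = 1 := by
        rw [← Real.exp_add]
        simp
      linear_combination discount r' (T - t) * this

/-- The discount rates of two Volterra equations with a common positive solution yield the same
discount factor. -/
lemma discount_eq_of_solvesVolterra {mu0 T : ℝ} (h0 : 0 < mu0) (hT : 0 ≤ T) {r₁ r₂ h : ℝ → ℝ}
    (hr₁ : ContinuousOn r₁ (Icc 0 T)) (hr₂ : ContinuousOn r₂ (Icc 0 T))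
    (hc : ContinuousOn h (Icc 0 T)) (hh₁ : SolvesVolterra mu0 T r₁ h)
    (hh₂ : SolvesVolterra mu0 T r₂ h) : EqOn (discount r₁) (discount r₂) (Icc 0 T) := by
  have hβ := continuousOn_beta h0 0 T
  have hd₁ := continuousOn_discount hT hr₁
  have hd₂ := continuousOn_discount hT hr₂
  obtain ⟨D, hD⟩ := isCompact_Icc.exists_bound_of_continuousOn (hβ.mul hc)
  have hdc : ContinuousOn (fun t => discount r₁ (T - t) - discount r₂ (T - t)) (Icc 0 T) :=
    (hd₁.sub hd₂).comp (by fun_prop) fun t ht => sub_mem_Icc ht ⟨ht.2, le_rfl⟩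
  -- The roles are exchanged: the unknown is `θ₁ - θ₂` and the fixed factor `β h`, bounded by `D`,
  -- acts as the kernel. Subtracting the equations expresses `(θ₁ - θ₂)(T - t)` by an integral of
  -- the unknown.
  have key := eq_zero_of_abs_le_integral (C := D) hdc
    fun t ht => by
      have hTm : T ∈ Icc t T := ⟨ht.2, le_rfl⟩
      have htm : t ∈ Icc t T := ⟨le_rfl, ht.2⟩
      have ci : ∀ d : ℝ → ℝ, ContinuousOn d (Icc 0 T) →
          ContinuousOn (fun s => d (s - t) * (beta mu0 T s * h s)) (Icc t T) :=
        fun d hd => (continuousOn_comp_sub hd ht).mul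
          ((hβ.mul hc).mono (Icc_subset_Icc_zero ht))
      have e1 : discount r₁ (T - t) - discount r₂ (T - t)
          = (∫ s in t..T, discount r₂ (s - t) * (beta mu0 T s * h s))
            - ∫ s in t..T, discount r₁ (s - t) * (beta mu0 T s * h s) := by
        linarith [hh₁ t ht, hh₂ t ht]
      -- Reflection and translation both turn the integral into one over `[0, T - t]`.
      have e2 : ∫ s in t..T, |discount r₁ (T - s) - discount r₂ (T - s)|
          = ∫ s in t..T, |discount r₁ (s - t) - discount r₂ (s - t)| := by
        rw [intervalIntegral.integral_comp_sub_left
          (fun x => |discount r₁ x - discount r₂ x|) T, intervalIntegral.integral_comp_sub_right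
          (fun x => |discount r₁ x - discount r₂ x|) t]
        simp
      rw [e2, e1, ← intervalIntegral.integral_sub
        (intervalIntegrable_of_continuousOn_Icc (ci _ hd₂) htm hTm)
        (intervalIntegrable_of_continuousOn_Icc (ci _ hd₁) htm hTm),
        ← intervalIntegral.integral_const_mul]
      change ‖(_ : ℝ)‖ ≤ _
      refine intervalIntegral.norm_integral_le_of_norm_le ht.2 (.of_forall fun s hs => ?_)
        (intervalIntegrable_of_continuousOn_Icc (continuousOn_const.mul
          (continuousOn_comp_sub (hd₁.sub hd₂) ht).abs) htm hTm)
      have hs' : s ∈ Icc t T := ⟨hs.1.le, hs.2⟩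
      rw [← sub_mul, norm_mul, mul_comm, norm_sub_rev]
      exact mul_le_mul_of_nonneg_right (hD s (Icc_subset_Icc_zero ht hs')) (abs_nonneg _)
  intro τ hτ
  have := key (T - τ) ⟨by linarith [hτ.2], by linarith [hτ.1]⟩
  rw [sub_sub_cancel] at this
  exact sub_eq_zero.1 this

/-! ### The integro-differential equation -/

section AlphaEq

variable {m L : ℕ} (M : Market m L) {a γ T : ℝ} {r α : ℝ → ℝ}

/-- The weight `h` with `β(s) h(s) / h(t)` the kernel of the non-local coefficient. -/
noncomputable def expWeight (a γ T : ℝ) (α : ℝ → ℝ) (t : ℝ) : ℝ :=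
  Real.exp (-γ * α t + γ * (∫ s in t..T, beta M.mu0 T s * driftB M a γ T α s)
    + M.kappa / 2 * (t - T))

lemma continuousOn_log_beta (ha : 0 < a) (hγ : 0 < γ) (t0 : ℝ) :
    ContinuousOn (fun t => Real.log (a * γ * beta M.mu0 T t)) (Icc t0 T) :=
  (continuousOn_const.mul (continuousOn_beta M.mu0_pos t0 T)).log fun _ ht =>
    (mul_pos (mul_pos ha hγ) (beta_pos M.mu0_pos ht.2)).ne'

lemma continuousOn_driftB (ha : 0 < a) (hγ : 0 < γ) {t0 : ℝ} (hα : ContinuousOn α (Icc t0 T)) :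
    ContinuousOn (driftB M a γ T α) (Icc t0 T) := by
  have hβ := continuousOn_beta M.mu0_pos t0 T
  refine (((continuousOn_const.div (continuousOn_const.mul hβ) fun t ht =>
    (mul_pos hγ (beta_pos M.mu0_pos ht.2)).ne').mul continuousOn_const).sub hα).add
    ((continuousOn_log_beta M ha hγ t0).div_const γ)

lemma beta_mul_driftB (hγ : 0 < γ) {t : ℝ} (ht : t ≤ T) :
    γ * (beta M.mu0 T t * driftB M a γ T α t) = M.kappa - γ * α t * beta M.mu0 T t
      + beta M.mu0 T t * Real.log (a * γ * beta M.mu0 T t) := by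
  have := beta_pos M.mu0_pos ht
  rw [driftB]
  field_simp

lemma continuousOn_expWeight (ha : 0 < a) (hγ : 0 < γ) (hα : ContinuousOn α (Icc 0 T)) :
    ContinuousOn (expWeight M a γ T α) (Icc 0 T) := by
  intro t ht
  have hT : T ∈ Icc 0 T := ⟨ht.1.trans ht.2, le_rfl⟩
  have hc := (continuousOn_beta M.mu0_pos 0 T).mul (continuousOn_driftB M ha hγ hα)
  have h1 := (hasDerivWithinAt_integral_left hc hT ht).continuousWithinAt
  exact (((continuousWithinAt_const.mul (hα t ht)).add (continuousWithinAt_const.mul h1)).add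
    (continuousWithinAt_const.mul (continuousWithinAt_id.sub continuousWithinAt_const))).rexp

/-- The logarithmic derivative collects the local terms of the equation of `α`, which thereby
becomes `h' / h = r(T-t) - A(α, t) - β(t)`. -/
lemma hasDerivWithinAt_expWeight (ha : 0 < a) (hγ : 0 < γ) (hα : ContinuousOn α (Icc 0 T))
    {t α' : ℝ} (ht : t ∈ Icc 0 T) (hα' : HasDerivWithinAt α α' (Icc 0 T) t) :
    HasDerivWithinAt (expWeight M a γ T α)
      ((-γ * α' - M.kappa / 2 + γ * α t * beta M.mu0 T t
        - beta M.mu0 T t * Real.log (a * γ * beta M.mu0 T t)) * expWeight M a γ T α t)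
      (Icc 0 T) t := by
  have hT : T ∈ Icc 0 T := ⟨ht.1.trans ht.2, le_rfl⟩
  have hc := (continuousOn_beta M.mu0_pos 0 T).mul (continuousOn_driftB M ha hγ hα)
  have h1 := hasDerivWithinAt_integral_left hc hT ht
  have h2 := ((hα'.const_mul (-γ)).add (h1.const_mul γ)).add
    (((hasDerivWithinAt_id t _).sub_const T).const_mul (M.kappa / 2))
  refine h2.exp.congr_deriv ?_
  have h3 := beta_mul_driftB M (a := a) (α := α) hγ ht.2
  rw [mul_comm]
  congr 1
  simp only [Pi.mul_apply]
  linear_combination -h3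

lemma expWeight_terminal (h : α T = 0) : expWeight M a γ T α T = 1 := by
  simp [expWeight, h]

/-- The non-local coefficient in terms of the weight. -/
lemma expWeight_mul_nonlocalCoeff (ha : 0 < a) (hγ : 0 < γ) (hr : ContinuousOn r (Icc 0 T))
    (hα : ContinuousOn α (Icc 0 T)) {t : ℝ} (ht : t ∈ Icc 0 T) :
    expWeight M a γ T α t * nonlocalCoeff M a γ T r α t
      = r (T - t) * (∫ s in t..T, discount r (s - t) * (beta M.mu0 T s * expWeight M a γ T α s))
        - ∫ s in t..T, r (s - t) * discount r (s - t)
          * (beta M.mu0 T s * expWeight M a γ T α s) := by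
  have hT : 0 ≤ T := ht.1.trans ht.2
  have hTm : T ∈ Icc 0 T := ⟨hT, le_rfl⟩
  have hc := (continuousOn_beta M.mu0_pos 0 T).mul (continuousOn_driftB M ha hγ hα)
  have hk := (continuousOn_beta M.mu0_pos 0 T).mul (continuousOn_expWeight M ha hγ hα)
  have hd := (continuousOn_comp_sub (continuousOn_discount hT hr) ht).mul
    (hk.mono (Icc_subset_Icc_zero ht))
  have hrd := ((continuousOn_comp_sub hr ht).mul
    (continuousOn_comp_sub (continuousOn_discount hT hr) ht)).mul
    (hk.mono (Icc_subset_Icc_zero ht))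
  have tm : t ∈ Icc t T := ⟨le_rfl, ht.2⟩
  have Tm : T ∈ Icc t T := ⟨ht.2, le_rfl⟩
  have h1 : IntervalIntegrable (fun s => discount r (s - t) * (beta M.mu0 T s
      * expWeight M a γ T α s)) volume t T := intervalIntegrable_of_continuousOn_Icc hd tm Tm
  have h2 : IntervalIntegrable (fun s => r (s - t) * discount r (s - t) * (beta M.mu0 T s
      * expWeight M a γ T α s)) volume t T := intervalIntegrable_of_continuousOn_Icc hrd tm Tm
  rw [← intervalIntegral.integral_const_mul, ← intervalIntegral.integral_sub
    (h1.const_mul _) h2, nonlocalCoeff, mul_neg, ← intervalIntegral.integral_const_mul,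
    ← intervalIntegral.integral_neg]
  refine intervalIntegral.integral_congr fun s hs => ?_
  have hs' := Icc_subset_Icc_zero ht (mem_Icc_of_uIcc ht hs)
  -- The two exponentials in the kernel of `nonlocalCoeff` are the ratio `h(s) / h(t)`, by
  -- additivity of the integral of `β B`.
  have e : expWeight M a γ T α t * (Real.exp (-γ * (α s - α t
      + ∫ τ in t..s, beta M.mu0 T τ * driftB M a γ T α τ)) * Real.exp (M.kappa / 2 * (s - t)))
      = expWeight M a γ T α s := by
    have h3 := intervalIntegral.integral_add_adjacent_intervals
      (intervalIntegrable_of_continuousOn_Icc hc ht hs')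
      (intervalIntegrable_of_continuousOn_Icc hc hs' hTm)
    simp only [Pi.mul_apply] at h3
    rw [expWeight, expWeight, ← Real.exp_add, ← Real.exp_add, ← h3]
    congr 1
    ring
  rw [← e]
  ring

/-- The integro-differential equation amounts to a linear Volterra equation for the weight. -/
lemma SolvesAlphaEq.solvesVolterra (ha : 0 < a) (hγ : 0 < γ) (hT : 0 < T)
    (hr : ContinuousOn r (Icc 0 T)) (h : SolvesAlphaEq M a γ T r α) :
    SolvesVolterra M.mu0 T r (expWeight M a γ T α) := by
  have hα := h.smooth.continuousOn
  have hrT : ContinuousOn (fun t => r (T - t)) (Icc 0 T) :=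
    hr.comp (by fun_prop) fun t ht => sub_mem_Icc ht ⟨ht.2, le_rfl⟩
  have hw := continuousOn_expWeight M ha hγ hα
  intro t ht
  -- The residual of the Volterra equation solves `y' = r(T-t) y` and vanishes at `T`.
  have key := eq_zero_of_linear_ode (a := 0) (b := T) (c := T)
    (f := fun t => expWeight M a γ T α t
      - ((∫ s in t..T, discount r (s - t) * (beta M.mu0 T s * expWeight M a γ T α s))
        + discount r (T - t))) hrT (fun t ht => by
      have d1 := hasDerivWithinAt_expWeight M ha hγ hα ht
        ((h.smooth.differentiableOn one_ne_zero) t ht).hasDerivWithinAt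
      have d2 := hasDerivWithinAt_discount_convolution hr
        ((continuousOn_beta M.mu0_pos 0 T).mul hw) ht
      have e1 := h.eqn t ht
      have e2 := expWeight_mul_nonlocalCoeff M ha hγ hr hα ht
      refine (d1.sub d2).congr_deriv ?_
      simp only [Pi.mul_apply]
      linear_combination expWeight M a γ T α t * e1 - e2)
    ⟨hT.le, le_rfl⟩ (by simp [expWeight_terminal M h.terminal, discount_zero]) ht
  exact sub_eq_zero.1 key

/-- Both weights solve the same Volterra equation, so they agree. Comparing their logarithmic
derivatives shows that the difference of the two solutions satisfies `y' = β y`, with `y(T) = 0`. -/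
lemma SolvesAlphaEq.eqOn (ha : 0 < a) (hγ : 0 < γ) (hT : 0 < T) {α' : ℝ → ℝ}
    (hr : ContinuousOn r (Icc 0 T)) (h : SolvesAlphaEq M a γ T r α)
    (h' : SolvesAlphaEq M a γ T r α') : EqOn α' α (Icc 0 T) := by
  have hα := h.smooth.continuousOn
  have hα' := h'.smooth.continuousOn
  have hw := SolvesVolterra.eqOn M.mu0_pos hr (continuousOn_expWeight M ha hγ hα')
    (continuousOn_expWeight M ha hγ hα) (h'.solvesVolterra M ha hγ hT hr)
    (h.solvesVolterra M ha hγ hT hr)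
  intro t ht
  have key := eq_zero_of_linear_ode (f := fun t => α' t - α t) (k := beta M.mu0 T)
    (continuousOn_beta M.mu0_pos 0 T) (fun t ht => by
      have d := ((h.smooth.differentiableOn one_ne_zero) t ht).hasDerivWithinAt
      have d' := ((h'.smooth.differentiableOn one_ne_zero) t ht).hasDerivWithinAt
      have w := hasDerivWithinAt_expWeight M ha hγ hα ht d
      have w' := (hasDerivWithinAt_expWeight M ha hγ hα' ht d').congr_of_mem
        (fun s hs => (hw hs).symm) ht
      have e := (uniqueDiffOn_Icc hT t ht).eq_deriv _ w w'
      rw [hw ht] at e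
      have e' := mul_right_cancel₀ (Real.exp_pos _).ne' e
      refine (d'.sub d).congr_deriv ?_
      rw [← mul_right_inj' hγ.ne']
      linear_combination e') ⟨hT.le, le_rfl⟩ (by simp [h.terminal, h'.terminal]) ht
  exact sub_eq_zero.1 key

/-- Inverts the substitution. From the Volterra solution `h` one forms the effective rate `q = β +
h' / h`; the standard coefficient with rate `q` has weight `h`, and its non-local coefficient is
`r(T-t) - q(t)`. The sophisticated agent thus acts like a standard one with rate `q`. -/
lemma exists_solvesAlphaEq (ha : 0 < a) (hγ : 0 < γ) (hT : 0 < T)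
    (hr : ContinuousOn r (Icc 0 T)) : ∃ α, SolvesAlphaEq M a γ T r α := by
  obtain ⟨h, hc, hh⟩ := exists_solvesVolterra M.mu0_pos hT.le hr
  have hpos := hh.pos M.mu0_pos hc
  have hβ := continuousOn_beta M.mu0_pos 0 T
  have hTm : T ∈ Icc 0 T := ⟨hT.le, le_rfl⟩
  have dh : ∀ t ∈ Icc 0 T, HasDerivWithinAt h _ (Icc 0 T) t := fun t ht =>
    (hasDerivWithinAt_discount_convolution hr (hβ.mul hc) ht).congr_of_mem hh ht
  have hsub : ∀ t ∈ Icc 0 T, T - t ∈ Icc 0 T := fun t ht => sub_mem_Icc ht ⟨ht.2, le_rfl⟩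
  -- The Volterra equation makes `h` continuously differentiable, which is what continuity of `q`
  -- requires.
  have hdh : ContinuousOn (derivWithin h (Icc 0 T)) (Icc 0 T) := by
    obtain ⟨r', hr', er⟩ := exists_continuous_eqOn_Icc hT.le hr
    obtain ⟨k, hk, ek⟩ := exists_continuous_eqOn_Icc hT.le (hβ.mul hc)
    have hd' := continuous_discount hr'
    have hcont : Continuous (fun t => -k t - (∫ s in T..t, r' (s - t) * discount r' (s - t) * k s)
        + r' (T - t) * discount r' (T - t)) := by
      refine (hk.neg.add (Continuous.neg ?_)).add (by fun_prop)
      refine intervalIntegral.continuous_parametric_intervalIntegral_of_continuous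
        (f := fun t s => r' (s - t) * discount r' (s - t) * k s) ?_ continuous_id
      fun_prop
    refine hcont.continuousOn.congr fun t ht => ?_
    rw [(dh t ht).derivWithin (uniqueDiffOn_Icc hT t ht), ek ht, er (hsub t ht),
      discount_congr er (hsub t ht), intervalIntegral.integral_symm T t]
    congr 3
    refine intervalIntegral.integral_congr fun s hs => ?_
    rw [uIcc_comm] at hs
    have hs' := mem_Icc_of_uIcc ht hs
    rw [er (sub_mem_Icc ht hs'), discount_congr er (sub_mem_Icc ht hs'),
      ek (Icc_subset_Icc_zero ht hs')]
  set q : ℝ → ℝ := fun t => beta M.mu0 T t + derivWithin h (Icc 0 T) t / h t with hq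
  have hqc : ContinuousOn q (Icc 0 T) := hβ.add (hdh.div hc fun t ht => (hpos t ht).ne')
  have dα : ∀ t ∈ Icc 0 T, HasDerivWithinAt (alphaStd M a γ T q) _ (Icc 0 T) t := fun t ht =>
    hasDerivWithinAt_alphaStd M ha hγ hqc ht
  have hα : ContinuousOn (alphaStd M a γ T q) (Icc 0 T) := fun t ht =>
    (dα t ht).continuousWithinAt
  have dα' := fun t ht => (dα t ht).derivWithin (uniqueDiffOn_Icc hT t ht)
  have hw : EqOn (expWeight M a γ T (alphaStd M a γ T q)) h (Icc 0 T) := fun t ht => by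
    -- By the choice of `q`, the weight and `h` have the same logarithmic derivative, so their
    -- quotient is constant; both equal `1` at `T`.
    have key := eq_of_hasDerivWithinAt_zero (a := 0) (b := T)
      (f := fun t => expWeight M a γ T (alphaStd M a γ T q) t / h t) (fun t ht => by
        have hp := hpos t ht
        have d1 := hasDerivWithinAt_expWeight M ha hγ hα ht (dα t ht)
        refine (d1.div (dh t ht).differentiableWithinAt.hasDerivWithinAt hp.ne').congr_deriv ?_
        simp only [hq, delta]
        field_simp
        ring) ht hTm
    simp only [expWeight_terminal M (alphaStd_terminal M q), hh.terminal hT.le, div_one] at key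
    exact (div_eq_one_iff_eq (hpos t ht).ne').1 key
  refine ⟨alphaStd M a γ T q, ?_, alphaStd_terminal M q, fun t ht => ?_⟩
  · rw [show (1 : WithTop ℕ∞) = 0 + 1 from rfl,
      contDiffOn_succ_iff_derivWithin (uniqueDiffOn_Icc hT)]
    refine ⟨fun t ht => (dα t ht).differentiableWithinAt, by simp, contDiffOn_zero.2 ?_⟩
    exact ((hβ.mul hα).add (((continuousOn_delta M ha hγ).sub hqc).div_const γ)).congr dα'
  · have hp := hpos t ht
    have e := expWeight_mul_nonlocalCoeff M ha hγ hr hα ht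
    have c1 : ∫ s in t..T, discount r (s - t) * (beta M.mu0 T s
        * expWeight M a γ T (alphaStd M a γ T q) s)
        = ∫ s in t..T, discount r (s - t) * (beta M.mu0 T s * h s) :=
      intervalIntegral.integral_congr fun s hs => by
        rw [hw (Icc_subset_Icc_zero ht (mem_Icc_of_uIcc ht hs))]
    have c2 : ∫ s in t..T, r (s - t) * discount r (s - t) * (beta M.mu0 T s
        * expWeight M a γ T (alphaStd M a γ T q) s)
        = ∫ s in t..T, r (s - t) * discount r (s - t) * (beta M.mu0 T s * h s) :=
      intervalIntegral.integral_congr fun s hs => by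
        rw [hw (Icc_subset_Icc_zero ht (mem_Icc_of_uIcc ht hs))]
    have e1 := (dh t ht).derivWithin (uniqueDiffOn_Icc hT t ht)
    have e2 := hh t ht
    simp only [Pi.mul_apply] at e1
    rw [c1, c2, hw ht] at e
    have e3 : nonlocalCoeff M a γ T r (alphaStd M a γ T q) t = r (T - t) - q t := by
      rw [← mul_right_inj' hp.ne', e]
      have : h t * q t = beta M.mu0 T t * h t + derivWithin h (Icc 0 T) t := by
        simp only [hq]
        field_simp
      rw [mul_sub, this, e1]
      linear_combination -r (T - t) * e2
    rw [dα' t ht, e3, delta]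
    field_simp
    ring

/-- Distinct discount factors cannot have the same equilibrium coefficient `α`. -/
lemma SolvesAlphaEq.discount_eqOn (ha : 0 < a) (hγ : 0 < γ) (hT : 0 < T) {r₁ r₂ α₁ α₂ : ℝ → ℝ}
    (hr₁ : ContinuousOn r₁ (Icc 0 T)) (hr₂ : ContinuousOn r₂ (Icc 0 T))
    (h₁ : SolvesAlphaEq M a γ T r₁ α₁) (h₂ : SolvesAlphaEq M a γ T r₂ α₂)
    (h : EqOn α₁ α₂ (Icc 0 T)) : EqOn (discount r₁) (discount r₂) (Icc 0 T) := by
  have hw : EqOn (expWeight M a γ T α₂) (expWeight M a γ T α₁) (Icc 0 T) := fun t ht => by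
    have hTm : T ∈ Icc 0 T := ⟨hT.le, le_rfl⟩
    rw [expWeight, expWeight, h ht, integral_congr_Icc (fun s hs => ?_) ht hTm]
    simp only [driftB, h hs]
  have hv : SolvesVolterra M.mu0 T r₂ (expWeight M a γ T α₁) := fun t ht => by
    rw [← hw ht, h₂.solvesVolterra M ha hγ hT hr₂ t ht]
    congr 1
    refine intervalIntegral.integral_congr fun s hs => ?_
    rw [hw (Icc_subset_Icc_zero ht (mem_Icc_of_uIcc ht hs))]
  exact discount_eq_of_solvesVolterra M.mu0_pos hT.le hr₁ hr₂
    (continuousOn_expWeight M ha hγ h₁.smooth.continuousOn)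
    (h₁.solvesVolterra M ha hγ hT hr₁) hv

end AlphaEq

/-! ### The Itô isometry for simple processes -/

lemma eLpNorm_two_eq {α : Type*} [MeasurableSpace α] {μ : Measure α} {f : α → ℝ}
    (hf : MemLp f 2 μ) : eLpNorm f 2 μ = ENNReal.ofReal (√(∫ x, f x * f x ∂μ)) := by
  rw [hf.eLpNorm_eq_integral_rpow_norm two_ne_zero ENNReal.ofNat_ne_top, Real.sqrt_eq_rpow]
  simp [sq]

section Increment

variable {Ω : Type*}

/-- The increment of a process over `[a, b]`. -/
noncomputable def increment (w : ℝ≥0 → Ω → ℝ) (a b : ℝ) (ω : Ω) : ℝ := w b.toNNReal ω - w a.toNNReal ω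

lemma increment_self (w : ℝ≥0 → Ω → ℝ) (a : ℝ) : increment w a a = 0 := by
  funext ω
  simp [increment]

lemma increment_add (w : ℝ≥0 → Ω → ℝ) (a b c : ℝ) (ω : Ω) :
    increment w a b ω + increment w b c ω = increment w a c ω := by
  simp only [increment]
  ring

end Increment

section Isometry

variable {Ω : Type*} [mΩ : MeasurableSpace Ω] {P : Measure Ω} {ℱ : Filtration ℝ≥0 mΩ}
  {w : ℝ≥0 → Ω → ℝ}

/-- A one-dimensional Brownian motion with respect to a filtration. -/
structure IsBrownianMotion (ℱ : Filtration ℝ≥0 mΩ) (w : ℝ≥0 → Ω → ℝ) (P : Measure Ω) : Prop where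
  brownian : IsBrownianReal w P
  adapted : ∀ t, Measurable[ℱ t] (w t)
  indep_past : ∀ s t, s ≤ t →
    Indep (MeasurableSpace.comap (fun ω => w t ω - w s ω) inferInstance) (ℱ s) P

lemma IsBrownianBasis.component {L : ℕ} {z : Fin L → ℝ≥0 → Ω → ℝ} (hz : IsBrownianBasis ℱ z P)
    (k : Fin L) : IsBrownianMotion ℱ (z k) P where
  brownian := hz.brownian k
  adapted := hz.adapted k
  indep_past s t hst := by
    refine indep_of_indep_of_le_left (hz.indep_past s t hst) ?_
    have h := MeasurableSpace.comap_mono (g := fun ω k => z k t ω - z k s ω)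
      (measurable_pi_apply (X := fun _ : Fin L => ℝ) k).comap_le
    rwa [MeasurableSpace.comap_comp] at h

namespace IsBrownianMotion

variable (hw : IsBrownianMotion ℱ w P)
include hw

lemma isProbabilityMeasure : IsProbabilityMeasure P :=
  hw.brownian.isGaussianProcess.isProbabilityMeasure

lemma measurable (t : ℝ≥0) : Measurable (w t) := (hw.adapted t).mono (ℱ.le t) le_rfl

lemma measurable_increment {a b : ℝ} (hab : a ≤ b) :
    Measurable[ℱ b.toNNReal] (increment w a b) :=
  (hw.adapted _).sub ((hw.adapted _).mono (ℱ.mono (Real.toNNReal_le_toNNReal hab)) le_rfl)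

lemma measurable_increment' (a b : ℝ) : Measurable (increment w a b) :=
  (hw.measurable _).sub (hw.measurable _)

lemma memLp_increment (a b : ℝ) : MemLp (increment w a b) 2 P :=
  (hw.brownian.isGaussianProcess.hasGaussianLaw_sub (s := b.toNNReal)
    (t := a.toNNReal)).memLp_two

lemma integral_increment (a b : ℝ) : ∫ ω, increment w a b ω ∂P = 0 := by
  simp only [increment]
  rw [integral_sub (hw.brownian.integrable_eval _) (hw.brownian.integrable_eval _),
    hw.brownian.integral_eval, hw.brownian.integral_eval, sub_zero]

lemma integral_increment_sq {a b : ℝ} (ha : 0 ≤ a) (hab : a ≤ b) :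
    ∫ ω, increment w a b ω * increment w a b ω ∂P = b - a := by
  have h := (hw.brownian.hasLaw_sub b.toNNReal a.toNNReal).variance_eq
  rw [variance_id_gaussianReal, variance_of_integral_eq_zero] at h
  · simp only [Pi.sub_apply, ← sq] at h ⊢
    have e : ((nndist (b.toNNReal : ℝ) (a.toNNReal : ℝ) : ℝ≥0) : ℝ) = b - a := by
      rw [coe_nndist, Real.dist_eq, Real.coe_toNNReal _ ha, Real.coe_toNNReal _ (ha.trans hab),
        abs_of_nonneg (by linarith)]
    exact h.trans e
  · exact (hw.brownian.aemeasurable _).sub (hw.brownian.aemeasurable _)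
  · exact hw.integral_increment a b

lemma indepFun_increment {a b : ℝ} (hab : a ≤ b) {ξ : Ω → ℝ}
    (hξ : Measurable[ℱ a.toNNReal] ξ) : IndepFun ξ (increment w a b) P := by
  refine (IndepFun_iff_Indep _ _ _).2 (Indep.symm ?_)
  exact indep_of_indep_of_le_right (hw.indep_past _ _ (Real.toNNReal_le_toNNReal hab))
    hξ.comap_le

lemma integral_mul_increment {a b : ℝ} (hab : a ≤ b) {ξ : Ω → ℝ}
    (hξ : Measurable[ℱ a.toNNReal] ξ) : ∫ ω, ξ ω * increment w a b ω ∂P = 0 := by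
  have h := (hw.indepFun_increment hab hξ).integral_fun_mul_eq_mul_integral
    (hξ.mono (ℱ.le _) le_rfl).aestronglyMeasurable
    (hw.measurable_increment' a b).aestronglyMeasurable
  rw [h, hw.integral_increment, mul_zero]

lemma integrable_mul_increment {a b : ℝ} {ξ : Ω → ℝ} (hξ : Measurable ξ)
    (hb : ∃ C, ∀ ω, |ξ ω| ≤ C) {η : Ω → ℝ} (hη : MemLp η 2 P) :
    Integrable (fun ω => ξ ω * (η ω * increment w a b ω)) P := by
  obtain ⟨C, hC⟩ := hb
  exact ((hη.integrable_mul (hw.memLp_increment a b))).bdd_mul hξ.aestronglyMeasurable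
    (.of_forall hC)

/-- The covariance of two elementary stochastic integrals. -/
lemma integral_increment_mul_increment {a b c d : ℝ} {ξ η : Ω → ℝ} (ha : 0 ≤ a) (hc : 0 ≤ c)
    (hab : a ≤ b) (hcd : c ≤ d) (hξ : a < b → Measurable[ℱ a.toNNReal] ξ)
    (hη : c < d → Measurable[ℱ c.toNNReal] η)
    (bξ : ∃ C, ∀ ω, |ξ ω| ≤ C) (bη : ∃ C, ∀ ω, |η ω| ≤ C) :
    ∫ ω, ξ ω * increment w a b ω * (η ω * increment w c d ω) ∂P
      = volume.real (Ioc a b ∩ Ioc c d) * ∫ ω, ξ ω * η ω ∂P := by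
  rcases hab.eq_or_lt with rfl | hab'
  · simp [increment_self]
  rcases hcd.eq_or_lt with rfl | hcd'
  · simp [increment_self]
  wlog hac : a ≤ c generalizing a b c d ξ η
  · have h := this hc ha hcd hab hη hξ bη bξ hcd' hab' (le_of_not_ge hac)
    rw [inter_comm]
    simp only [mul_comm (η _)] at h
    rw [← h]
    exact integral_congr_ae (.of_forall fun ω => by ring)
  have mξ := hξ hab'
  have mη := hη hcd'
  have mξ' : Measurable[ℱ c.toNNReal] ξ :=
    mξ.mono (ℱ.mono (Real.toNNReal_le_toNNReal hac)) le_rfl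
  have mξη : Measurable[ℱ c.toNNReal] (fun ω => ξ ω * η ω) := mξ'.mul mη
  have bξη : ∃ C, ∀ ω, |ξ ω * η ω| ≤ C := by
    obtain ⟨C, hC⟩ := bξ
    obtain ⟨D, hD⟩ := bη
    exact ⟨C * D, fun ω => by
      rw [abs_mul]
      exact mul_le_mul (hC ω) (hD ω) (abs_nonneg _) ((abs_nonneg _).trans (hC ω))⟩
  have mξη' : Measurable (fun ω => ξ ω * η ω) := mξη.mono (ℱ.le _) le_rfl
  -- Since `a ≤ c`, the intervals overlap in `(c, e]`, which is empty when `b ≤ c`. In the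
  -- decomposition below only the squared increment over `(c, e]` survives; every other product has
  -- a last factor independent of the past and of mean zero.
  set e := min (max b c) d with he
  have hce : c ≤ e := le_min (le_max_right _ _) hcd
  have hed : e ≤ d := min_le_right _ _
  have heb : e ≤ max b c := min_le_left _ _
  have split : ∀ ω, ξ ω * increment w a b ω * (η ω * increment w c d ω)
      = ξ ω * η ω * increment w a (min b c) ω * increment w c d ω
        + ξ ω * η ω * (increment w c e ω * increment w c e ω)
        + (ξ ω * η ω * increment w c e ω * increment w e d ω
          + ξ ω * η ω * increment w c e ω * increment w e (max b c) ω) := fun ω => by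
    have h1 : increment w a b ω = increment w a (min b c) ω + increment w c (max b c) ω := by
      rcases le_total b c with h | h <;>
        simp [h, increment_self, increment_add]
    rcases le_total (max b c) d with h | h
    · have h2 : e = max b c := min_eq_left h
      rw [h1, ← increment_add w c e d, h2, increment_self]
      simp only [Pi.zero_apply]
      ring
    · have h2 : e = d := min_eq_right h
      rw [h1, ← increment_add w c e (max b c), h2, increment_self]
      simp only [Pi.zero_apply]
      ring
  have mce : Measurable[ℱ e.toNNReal] (fun ω => ξ ω * η ω * increment w c e ω) :=
    (mξη.mono (ℱ.mono (Real.toNNReal_le_toNNReal hce)) le_rfl).mul (hw.measurable_increment hce)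
  have i1 : Integrable (fun ω => ξ ω * η ω * increment w a (min b c) ω * increment w c d ω) P := by
    simpa only [mul_assoc] using hw.integrable_mul_increment mξη' bξη
      (hw.memLp_increment a (min b c)) (a := c) (b := d)
  have i2 : Integrable (fun ω => ξ ω * η ω * (increment w c e ω * increment w c e ω)) P :=
    hw.integrable_mul_increment mξη' bξη (hw.memLp_increment c e)
  have i3 : Integrable (fun ω => ξ ω * η ω * increment w c e ω * increment w e d ω) P := by
    simpa only [mul_assoc] using hw.integrable_mul_increment mξη' bξη
      (hw.memLp_increment c e) (a := e) (b := d)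
  have i4 : Integrable (fun ω => ξ ω * η ω * increment w c e ω * increment w e (max b c) ω) P := by
    simpa only [mul_assoc] using hw.integrable_mul_increment mξη' bξη
      (hw.memLp_increment c e) (a := e) (b := max b c)
  have v1 : ∫ ω, ξ ω * η ω * increment w a (min b c) ω * increment w c d ω ∂P = 0 :=
    hw.integral_mul_increment hcd (mξη.mul ((hw.measurable_increment (le_min hab hac)).mono
      (ℱ.mono (Real.toNNReal_le_toNNReal (min_le_right _ _))) le_rfl))
  have v2 : ∫ ω, ξ ω * η ω * (increment w c e ω * increment w c e ω) ∂P
      = (∫ ω, ξ ω * η ω ∂P) * (e - c) := by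
    have h := ((hw.indepFun_increment hce mξη).comp measurable_id
      (measurable_id.mul measurable_id)).integral_fun_mul_eq_mul_integral
      mξη'.aestronglyMeasurable
      ((hw.measurable_increment' c e).mul (hw.measurable_increment' c e)).aestronglyMeasurable
    simp only [Function.comp_apply, id, Pi.mul_apply] at h
    rw [h, hw.integral_increment_sq hc hce]
  have s1 := integral_add (i1.add i2) (i3.add i4)
  simp only [Pi.add_apply] at s1
  rw [integral_congr_ae (.of_forall split), s1,
    integral_add i1 i2, integral_add i3 i4, v1, v2, hw.integral_mul_increment hed mce,
    hw.integral_mul_increment heb mce, Ioc_inter_Ioc, Real.volume_real_Ioc, sup_eq_right.2 hac]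
  have : max (b ⊓ d - c) 0 = e - c := by
    rw [he]
    rcases le_total b c with h | h
    · rw [max_eq_right h, min_eq_left hcd, sub_self,
        max_eq_right (by linarith [min_le_left b d])]
    · rw [max_eq_left h, max_eq_left (by linarith [le_min h hcd])]
  rw [this]
  ring

/-- The Itô isometry for a finite sum of elementary integrals. -/
lemma eLpNorm_sum_increment {ι : Type*} (s : Finset ι) {a b : ι → ℝ} {ξ : ι → Ω → ℝ}
    (ha : ∀ i, 0 ≤ a i) (hab : ∀ i, a i ≤ b i)
    (hξ : ∀ i, a i < b i → Measurable[ℱ (a i).toNNReal] (ξ i)) (mξ : ∀ i, Measurable (ξ i))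
    (bξ : ∀ i, ∃ C, ∀ ω, |ξ i ω| ≤ C) :
    eLpNorm (fun ω => ∑ i ∈ s, ξ i ω * increment w (a i) (b i) ω) 2 P
      = eLpNorm (fun p : ℝ × Ω => ∑ i ∈ s, (Ioc (a i) (b i)).indicator (fun _ => ξ i p.2) p.1) 2
        (volume.prod P) := by
  have := hw.isProbabilityMeasure
  have m1 : ∀ i, MemLp (fun ω => ξ i ω * increment w (a i) (b i) ω) 2 P := fun i => by
    obtain ⟨C, hC⟩ := bξ i
    exact (hw.memLp_increment _ _).of_le_mul (c := C)
      ((mξ i).mul (hw.measurable_increment' _ _)).aestronglyMeasurable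
      (.of_forall fun ω => by
        rw [norm_mul]
        exact mul_le_mul_of_nonneg_right (hC ω) (norm_nonneg _))
  have ind : ∀ i (p : ℝ × Ω), (Ioc (a i) (b i)).indicator (fun _ => ξ i p.2) p.1
      = (Ioc (a i) (b i)).indicator 1 p.1 * ξ i p.2 := fun i p => by
    by_cases h : p.1 ∈ Ioc (a i) (b i) <;> simp [h]
  have m2 : ∀ i, MemLp (fun p : ℝ × Ω => (Ioc (a i) (b i)).indicator (fun _ => ξ i p.2) p.1) 2
      (volume.prod P) := fun i => by
    obtain ⟨C, hC⟩ := bξ i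
    have h1 : MemLp ((Ioc (a i) (b i) ×ˢ (univ : Set Ω)).indicator fun _ => C) 2
        (volume.prod P) :=
      memLp_indicator_const 2 (measurableSet_Ioc.prod .univ) C (Or.inr (by
        rw [Measure.prod_prod]
        simp))
    refine h1.of_le ?_ (.of_forall fun p => ?_)
    · simp only [ind]
      exact (((measurable_one.indicator measurableSet_Ioc).comp measurable_fst).mul
        ((mξ i).comp measurable_snd)).aestronglyMeasurable
    · by_cases h : p.1 ∈ Ioc (a i) (b i)
      · simp only [h, indicator_of_mem, mem_prod, mem_univ, and_self]
        exact (hC p.2).trans (le_abs_self C)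
      · simp [h]
  -- Both squared norms expand into double sums, which agree term by term by the covariance formula.
  rw [eLpNorm_two_eq (memLp_finsetSum _ fun i _ => m1 i),
    eLpNorm_two_eq (memLp_finsetSum _ fun i _ => m2 i)]
  congr 2
  have q1 : ∀ i j, Integrable (fun ω => ξ i ω * increment w (a i) (b i) ω
      * (ξ j ω * increment w (a j) (b j) ω)) P := fun i j => (m1 i).integrable_mul (m1 j)
  have q2 : ∀ i j, Integrable (fun p : ℝ × Ω => (Ioc (a i) (b i)).indicator (fun _ => ξ i p.2) p.1
      * (Ioc (a j) (b j)).indicator (fun _ => ξ j p.2) p.1) (volume.prod P) := fun i j =>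
    (m2 i).integrable_mul (m2 j)
  simp only [Finset.sum_mul_sum]
  rw [integral_finsetSum _ fun i _ => integrable_finsetSum _ fun j _ =>
      q1 i j,
    integral_finsetSum _ fun i _ => integrable_finsetSum _ fun j _ =>
      q2 i j]
  refine Finset.sum_congr rfl fun i _ => ?_
  rw [integral_finsetSum _ fun j _ => q1 i j,
    integral_finsetSum _ fun j _ => q2 i j]
  refine Finset.sum_congr rfl fun j _ => ?_
  rw [hw.integral_increment_mul_increment (ha i) (ha j) (hab i) (hab j) (hξ i) (hξ j) (bξ i) (bξ j)]
  have e : ∀ p : ℝ × Ω, (Ioc (a i) (b i)).indicator (fun _ => ξ i p.2) p.1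
      * (Ioc (a j) (b j)).indicator (fun _ => ξ j p.2) p.1
      = (Ioc (a i) (b i) ∩ Ioc (a j) (b j)).indicator 1 p.1 * (ξ i p.2 * ξ j p.2) := fun p => by
    rw [ind, ind, inter_indicator_one, Pi.mul_apply]
    ring
  simp only [e]
  rw [integral_prod_mul ((Ioc (a i) (b i) ∩ Ioc (a j) (b j)).indicator (1 : ℝ → ℝ))
    (fun ω => ξ i ω * ξ j ω),
    integral_indicator_one (measurableSet_Ioc.inter measurableSet_Ioc)]

end IsBrownianMotion

end Isometry

/-! ### Itô integrals as limits of elementary integrals: uniqueness and construction -/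

section Ito

variable {Ω : Type*} [mΩ : MeasurableSpace Ω] {P : Measure Ω} {ℱ : Filtration ℝ≥0 mΩ}
  {w : ℝ≥0 → Ω → ℝ} {t T : ℝ}

namespace SimpleProc

lemma measurable_ξ (S : SimpleProc ℱ t T) (i : ℕ) : Measurable (S.ξ i) :=
  (S.meas i).mono (ℱ.le _) le_rfl

lemma measurable_val (S : SimpleProc ℱ t T) : Measurable (fun p : ℝ × Ω => S.val p.1 p.2) := by
  refine Finset.measurable_sum _ fun i _ => ?_
  have e : (fun p : ℝ × Ω => (Ioc (S.time i) (S.time (i + 1))).indicator (fun _ => S.ξ i p.2) p.1)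
      = fun p => (Ioc (S.time i) (S.time (i + 1))).indicator 1 p.1 * S.ξ i p.2 := by
    funext p
    by_cases h : p.1 ∈ Ioc (S.time i) (S.time (i + 1)) <;> simp [h]
  rw [e]
  exact ((measurable_one.indicator measurableSet_Ioc).comp measurable_fst).mul
    ((S.measurable_ξ i).comp measurable_snd)

lemma measurable_integral (hw : ∀ t, Measurable (w t)) (S : SimpleProc ℱ t T) (s : ℝ) :
    Measurable (S.integral w s) :=
  Finset.measurable_fun_sum _ fun i _ => (S.measurable_ξ i).mul ((hw _).sub (hw _))

lemma val_eq_zero (S : SimpleProc ℱ t T) {s : ℝ} (hs : s ∉ Ioc t T) (ω : Ω) : S.val s ω = 0 :=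
  Finset.sum_eq_zero fun i _ => indicator_of_notMem (fun h => hs
    ⟨(S.mem i).1.trans_lt h.1, h.2.trans (S.mem (i + 1)).2⟩) _

end SimpleProc

lemma indicator_Ioc_min (a b s x c : ℝ) :
    (Ioc (min a s) (min b s)).indicator (fun _ => c) x
      = (Iic s).indicator (fun x => (Ioc a b).indicator (fun _ => c) x) x := by
  simp only [indicator_apply, mem_Ioc, mem_Iic, min_lt_iff, le_min_iff]
  grind

/-- Stopping the grid at `s` amounts to cutting off the integrand after `s`. -/
lemma sum_indicator_Ioc_min (S : SimpleProc ℱ t T) (s x : ℝ) (ω : Ω) :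
    ∑ i ∈ Finset.range S.n, (Ioc (min (S.time i) s) (min (S.time (i + 1)) s)).indicator
      (fun _ => S.ξ i ω) x = (Iic s).indicator (fun x => S.val x ω) x := by
  simp only [indicator_Ioc_min]
  by_cases hx : x ∈ Iic s
  · simp [hx, SimpleProc.val]
  · simp [hx]

lemma indicator_const_neg (A : Set ℝ) (c x : ℝ) :
    A.indicator (fun _ => -c) x = -A.indicator (fun _ => c) x := by
  by_cases hx : x ∈ A <;> simp [hx]

/-- The Itô isometry for the difference of two simple processes. -/
lemma IsBrownianMotion.eLpNorm_integral_sub_le (hw : IsBrownianMotion ℱ w P) (ht : 0 ≤ t)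
    (S S' : SimpleProc ℱ t T) {s : ℝ} (hs : s ∈ Icc t T) :
    eLpNorm (fun ω => S.integral w s ω - S'.integral w s ω) 2 P
      ≤ eLpNorm (fun p : ℝ × Ω => S.val p.1 p.2 - S'.val p.1 p.2) 2
        ((volume.restrict (Ioc t T)).prod P) := by
  have := hw.isProbabilityMeasure
  -- Intervals after `s` collapse, and their values need not be measurable at time `s`; this is why
  -- the isometry asks for measurability on nondegenerate intervals only.
  have meas : ∀ (S : SimpleProc ℱ t T) i, min (S.time i) s < min (S.time (i + 1)) s →
      Measurable[ℱ (min (S.time i) s).toNNReal] (S.ξ i) := fun S i h => by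
    have h' : S.time i ≤ s := by
      by_contra! hlt
      rw [min_eq_right hlt.le, min_eq_right (hlt.le.trans (S.mono (Nat.le_succ i)))] at h
      exact lt_irrefl _ h
    rw [min_eq_left h']
    exact S.meas i
  -- The disjoint sum of the two index sets, with negated second values, represents the difference
  -- without a common refinement of the grids.
  have h := hw.eLpNorm_sum_increment (ι := ℕ ⊕ ℕ)
    ((Finset.range S.n).disjSum (Finset.range S'.n))
    (a := Sum.elim (fun i => min (S.time i) s) fun i => min (S'.time i) s)
    (b := Sum.elim (fun i => min (S.time (i + 1)) s) fun i => min (S'.time (i + 1)) s)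
    (ξ := Sum.elim S.ξ fun i => -S'.ξ i)
    (by
      rintro (i | i)
      · exact le_min (ht.trans (S.mem i).1) (ht.trans hs.1)
      · exact le_min (ht.trans (S'.mem i).1) (ht.trans hs.1))
    (by
      rintro (i | i)
      · exact min_le_min_right _ (S.mono (Nat.le_succ i))
      · exact min_le_min_right _ (S'.mono (Nat.le_succ i)))
    (by
      rintro (i | i) h
      · exact meas S i h
      · exact (meas S' i h).neg)
    (by
      rintro (i | i)
      · exact S.measurable_ξ i
      · exact (S'.measurable_ξ i).neg)
    (by
      rintro (i | i)
      · exact (S.bdd).imp fun C hC => hC i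
      · exact (S'.bdd).imp fun C hC ω => by
          simpa using hC i ω)
  simp only [Finset.sum_disjSum, Sum.elim_inl, Sum.elim_inr, Pi.neg_apply, neg_mul,
    indicator_const_neg, sum_indicator_Ioc_min, Finset.sum_neg_distrib, ← sub_eq_add_neg] at h
  have e1 : (fun ω => S.integral w s ω - S'.integral w s ω) = fun ω =>
      ∑ i ∈ Finset.range S.n, S.ξ i ω * increment w (min (S.time i) s) (min (S.time (i + 1)) s) ω
      - ∑ i ∈ Finset.range S'.n, S'.ξ i ω
        * increment w (min (S'.time i) s) (min (S'.time (i + 1)) s) ω := rfl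
  rw [e1, h]
  have e2 : ((volume.restrict (Ioc t T)).prod P)
      = ((volume : Measure ℝ).prod P).restrict (Ioc t T ×ˢ univ) := by
    rw [← Measure.prod_restrict, Measure.restrict_univ]
  rw [e2, ← eLpNorm_indicator_eq_eLpNorm_restrict (measurableSet_Ioc.prod .univ)]
  refine eLpNorm_mono fun p => ?_
  have e3 : (Ioc t T ×ˢ (univ : Set Ω)).indicator
      (fun p : ℝ × Ω => S.val p.1 p.2 - S'.val p.1 p.2) p = S.val p.1 p.2 - S'.val p.1 p.2 := by
    by_cases hp : p.1 ∈ Ioc t T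
    · exact indicator_of_mem (mk_mem_prod hp (mem_univ _)) _
    · rw [S.val_eq_zero hp, S'.val_eq_zero hp, sub_zero, indicator_of_notMem]
      exact fun h => hp h.1
  rw [e3]
  by_cases hp : p.1 ∈ Iic s <;> simp [hp]

/-- The isometry in the form of a triangle inequality through a common limit. -/
lemma IsBrownianMotion.eLpNorm_integral_sub_le_add (hw : IsBrownianMotion ℱ w P) (ht : 0 ≤ t)
    {H : ℝ → Ω → ℝ}
    (h : MemLp (fun p : ℝ × Ω => H p.1 p.2) 2 ((volume.restrict (Ioc t T)).prod P))
    (S S' : SimpleProc ℱ t T) {s : ℝ} (hs : s ∈ Icc t T) :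
    eLpNorm (fun ω => S.integral w s ω - S'.integral w s ω) 2 P
      ≤ eLpNorm (fun p : ℝ × Ω => S.val p.1 p.2 - H p.1 p.2) 2
          ((volume.restrict (Ioc t T)).prod P)
        + eLpNorm (fun p : ℝ × Ω => S'.val p.1 p.2 - H p.1 p.2) 2
          ((volume.restrict (Ioc t T)).prod P) := by
  refine (hw.eLpNorm_integral_sub_le ht S S' hs).trans ?_
  refine le_trans (le_of_eq ?_) (eLpNorm_sub_le
    (S.measurable_val.aestronglyMeasurable.sub h.1)
    (S'.measurable_val.aestronglyMeasurable.sub h.1) one_le_two)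
  congr 1
  funext p
  simp

/-- Itô integrals are determined by their integrands. -/
lemma IsItoIntegral.ae_eq (hw : IsBrownianMotion ℱ w P) (ht : 0 ≤ t) {H I I' : ℝ → Ω → ℝ}
    (h : IsItoIntegral ℱ w P t T H I) (h' : IsItoIntegral ℱ w P t T H I') {s : ℝ}
    (hs : s ∈ Icc t T) : I s =ᵐ[P] I' s := by
  obtain ⟨hH, hI, S, hS, hSI⟩ := h
  obtain ⟨-, hI', S', hS', hSI'⟩ := h'
  have mS := fun n => ((S n).measurable_integral hw.measurable s).aestronglyMeasurable (μ := P)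
  have mS' := fun n => ((S' n).measurable_integral hw.measurable s).aestronglyMeasurable (μ := P)
  -- The approximating sequences may differ; they are compared through the isometry and their common
  -- limit `H`.
  have key : ∀ n, eLpNorm (I s - I' s) 2 P
      ≤ eLpNorm (fun ω => (S n).integral w s ω - I s ω) 2 P
        + (eLpNorm (fun p : ℝ × Ω => (S n).val p.1 p.2 - H p.1 p.2) 2
            ((volume.restrict (Ioc t T)).prod P)
          + eLpNorm (fun p : ℝ × Ω => (S' n).val p.1 p.2 - H p.1 p.2) 2
            ((volume.restrict (Ioc t T)).prod P))
        + eLpNorm (fun ω => (S' n).integral w s ω - I' s ω) 2 P := fun n => by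
    have e : I s - I' s = ((S n).integral w s - (S' n).integral w s
        - ((S n).integral w s - I s)) + ((S' n).integral w s - I' s) := by
      funext ω
      simp
    rw [e]
    refine (eLpNorm_add_le (((mS n).sub (mS' n)).sub ((mS n).sub (hI s hs).1))
      ((mS' n).sub (hI' s hs).1) one_le_two).trans ?_
    refine add_le_add_left ((eLpNorm_sub_le ((mS n).sub (mS' n)) ((mS n).sub (hI s hs).1)
      one_le_two).trans ?_) _
    rw [add_comm]
    exact add_le_add_right (hw.eLpNorm_integral_sub_le_add ht hH (S n) (S' n) hs) _
  have lim := ((hSI s hs).add (hS.add hS')).add (hSI' s hs)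
  simp only [add_zero] at lim
  have h0 : eLpNorm (I s - I' s) 2 P = 0 :=
    le_antisymm (ge_of_tendsto' lim key) zero_le
  rw [eLpNorm_eq_zero_iff ((hI s hs).1.sub (hI' s hs).1) two_ne_zero] at h0
  filter_upwards [h0] with ω hω
  exact sub_eq_zero.1 hω

lemma IsBrownianMotion.memLp_integral (hw : IsBrownianMotion ℱ w P) (S : SimpleProc ℱ t T)
    (s : ℝ) : MemLp (S.integral w s) 2 P := by
  obtain ⟨C, hC⟩ := S.bdd
  refine memLp_finsetSum _ fun i _ => ?_
  exact (hw.memLp_increment (min (S.time i) s) (min (S.time (i + 1)) s)).of_le_mul (c := C)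
    ((S.measurable_ξ i).mul (hw.measurable_increment' _ _)).aestronglyMeasurable
    (.of_forall fun ω => by
      rw [norm_mul]
      exact mul_le_mul_of_nonneg_right (hC i ω) (norm_nonneg _))

/-- A process that is the pathwise limit of elementary integrals is the Itô integral. -/
lemma isItoIntegral_of_tendsto (hw : IsBrownianMotion ℱ w P) (ht : 0 ≤ t) {H I : ℝ → Ω → ℝ}
    (hH : MemLp (fun p : ℝ × Ω => H p.1 p.2) 2 ((volume.restrict (Ioc t T)).prod P))
    (S : ℕ → SimpleProc ℱ t T)
    (hS : Tendsto (fun n => eLpNorm (fun p : ℝ × Ω => (S n).val p.1 p.2 - H p.1 p.2) 2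
      ((volume.restrict (Ioc t T)).prod P)) atTop (𝓝 0))
    (hI : ∀ s ∈ Icc t T, ∀ᵐ ω ∂P, Tendsto (fun n => (S n).integral w s ω) atTop (𝓝 (I s ω))) :
    IsItoIntegral ℱ w P t T H I := by
  have mS := fun n s =>
    ((S n).measurable_integral hw.measurable s).aestronglyMeasurable (μ := P)
  have mI : ∀ s ∈ Icc t T, AEStronglyMeasurable (I s) P := fun s hs =>
    aestronglyMeasurable_of_tendsto_ae atTop (fun n => mS n s) (hI s hs)
  -- Fatou's lemma for `L²` norms: `m → ∞` in the isometry bound for the integrals of `S n` and `S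
  -- m`, which converge pathwise in `m`.
  have key : ∀ s ∈ Icc t T, ∀ n, eLpNorm (fun ω => (S n).integral w s ω - I s ω) 2 P
      ≤ eLpNorm (fun p : ℝ × Ω => (S n).val p.1 p.2 - H p.1 p.2) 2
        ((volume.restrict (Ioc t T)).prod P) := fun s hs n => by
    refine (Lp.eLpNorm_lim_le_liminf_eLpNorm
      (f := fun m ω => (S n).integral w s ω - (S m).integral w s ω)
      (fun m => (mS n s).sub (mS m s)) _ ?_).trans ?_
    · filter_upwards [hI s hs] with ω hω
      exact hω.const_sub _
    · refine (liminf_le_liminf (.of_forall fun m =>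
        hw.eLpNorm_integral_sub_le_add ht hH (S n) (S m) hs)).trans ?_
      have lim := (tendsto_const_nhds (x := eLpNorm
        (fun p : ℝ × Ω => (S n).val p.1 p.2 - H p.1 p.2) 2
        ((volume.restrict (Ioc t T)).prod P)) (f := atTop)).add hS
      rw [lim.liminf_eq, add_zero]
  have lim : ∀ s ∈ Icc t T,
      Tendsto (fun n => eLpNorm (fun ω => (S n).integral w s ω - I s ω) 2 P) atTop (𝓝 0) :=
    fun s hs => tendsto_of_tendsto_of_tendsto_of_le_of_le tendsto_const_nhds hS
      (fun _ => zero_le) (key s hs)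
  refine ⟨hH, fun s hs => ?_, S, hS, lim⟩
  obtain ⟨n, hn⟩ := ((lim s hs).eventually (gt_mem_nhds ENNReal.zero_lt_top)).exists
  have h1 : MemLp (fun ω => (S n).integral w s ω - I s ω) 2 P :=
    ⟨(mS n s).sub (mI s hs), hn⟩
  have h2 := (hw.memLp_integral (S n) s).sub h1
  refine h2.ae_eq (.of_forall fun ω => ?_)
  simp

end Ito

/-! ### The Itô integral of a deterministic function, by parts -/

section Partition

variable {t T : ℝ}

/-- The uniform partition of `[t, T]` into `n + 1` intervals. -/
noncomputable def partitionTime (t T : ℝ) (n i : ℕ) : ℝ :=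
  t + (T - t) * min ((i : ℝ) / (n + 1)) 1

lemma partitionTime_mono (h : t ≤ T) (n : ℕ) : Monotone (partitionTime t T n) := by
  intro i j hij
  have hij' : (i : ℝ) ≤ j := by exact_mod_cast hij
  have : 0 ≤ T - t := sub_nonneg.2 h
  rw [partitionTime, partitionTime]
  gcongr

lemma partitionTime_zero (n : ℕ) : partitionTime t T n 0 = t := by simp [partitionTime]

lemma partitionTime_last (n : ℕ) : partitionTime t T n (n + 1) = T := by
  have : ((n : ℝ) + 1) / (n + 1) = 1 := div_self (by positivity)
  simp [partitionTime, this]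

/-- Valid for every index, because `min` freezes the nodes at `T` from index `n + 1` on; the grid of
a `SimpleProc` is indexed by all of `ℕ`. -/
lemma partitionTime_mem (h : t ≤ T) (n i : ℕ) : partitionTime t T n i ∈ Icc t T := by
  have h1 : 0 ≤ T - t := sub_nonneg.2 h
  have h2 : (0 : ℝ) ≤ min ((i : ℝ) / (n + 1)) 1 := le_min (by positivity) zero_le_one
  have h3 : min ((i : ℝ) / (n + 1)) 1 ≤ 1 := min_le_right _ _
  constructor <;> rw [partitionTime] <;> nlinarith

lemma partitionTime_succ_sub_le (h : t ≤ T) (n i : ℕ) :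
    partitionTime t T n (i + 1) - partitionTime t T n i ≤ (T - t) / (n + 1) := by
  have h1 : 0 ≤ T - t := sub_nonneg.2 h
  have h2 : min (((i + 1 : ℕ) : ℝ) / (n + 1)) 1 - min ((i : ℝ) / (n + 1)) 1 ≤ 1 / ((n : ℝ) + 1) := by
    have h3 : ((i + 1 : ℕ) : ℝ) / (n + 1) = (i : ℝ) / (n + 1) + 1 / ((n : ℝ) + 1) := by
      push_cast
      ring
    have h4 : (0 : ℝ) < 1 / ((n : ℝ) + 1) := by positivity
    rw [h3]
    rcases le_total ((i : ℝ) / (n + 1)) 1 with h5 | h5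
    · rw [min_eq_left h5]
      linarith [min_le_left ((i : ℝ) / (n + 1) + 1 / (n + 1)) 1]
    · rw [min_eq_right h5]
      linarith [min_le_right ((i : ℝ) / (n + 1) + 1 / (n + 1)) 1]
  calc partitionTime t T n (i + 1) - partitionTime t T n i
      = (T - t) * (min (((i + 1 : ℕ) : ℝ) / (n + 1)) 1 - min ((i : ℝ) / (n + 1)) 1) := by
        rw [partitionTime, partitionTime]
        ring
    _ ≤ (T - t) * (1 / ((n : ℝ) + 1)) := by gcongr
    _ = _ := by ring

lemma sum_indicator_Ioc {u : ℕ → ℝ} (hu : Monotone u) (n : ℕ) (x : ℝ) :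
    ∑ i ∈ Finset.range n, (Ioc (u i) (u (i + 1))).indicator (1 : ℝ → ℝ) x
      = (Ioc (u 0) (u n)).indicator 1 x := by
  induction n with
  | zero => simp
  | succ n ih =>
    have h := hu (Nat.zero_le n)
    have h' := hu (Nat.le_succ n)
    rw [Finset.sum_range_succ, ih, ← Ioc_union_Ioc_eq_Ioc h h', indicator_union_of_disjoint]
    exact Ioc_disjoint_Ioc_of_le le_rfl

/-- The error of a Riemann–Stieltjes sum. -/
lemma abs_stieltjes_sub_sum_le {f f' N : ℝ → ℝ} (hf : ∀ x, HasDerivAt f (f' x) x)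
    (hf' : Continuous f') (hN : Continuous N) {u : ℕ → ℝ} (hu : Monotone u) {C ε : ℝ} (hC : 0 ≤ C)
    (n : ℕ) (hb : ∀ x ∈ Icc (u 0) (u n), |f' x| ≤ C)
    (ho : ∀ i < n, ∀ x ∈ Icc (u i) (u (i + 1)), |N (u (i + 1)) - N x| ≤ ε) :
    |f (u n) * N (u n) - f (u 0) * N (u 0) - (∫ x in u 0..u n, N x * f' x)
      - ∑ i ∈ Finset.range n, f (u i) * (N (u (i + 1)) - N (u i))| ≤ C * ε * (u n - u 0) := by
  induction n with
  | zero => simp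
  | succ n ih =>
    have h0 := hu (Nat.zero_le n)
    have h' := hu (Nat.le_succ n)
    have ih' := ih (fun x hx => hb x ⟨hx.1, hx.2.trans h'⟩) fun i hi => ho i (hi.trans n.lt_succ_self)
    have i1 : ∀ a b, IntervalIntegrable (fun x => N x * f' x) volume a b := fun a b =>
      (hN.mul hf').intervalIntegrable _ _
    have e1 : f (u (n + 1)) - f (u n) = ∫ x in u n..u (n + 1), f' x :=
      (intervalIntegral.integral_eq_sub_of_hasDerivAt (fun x _ => hf x)
        (hf'.intervalIntegrable _ _)).symm
    -- Summation by parts on one cell: the error is the oscillation of `N` against `f'`.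
    have e2 : (f (u (n + 1)) - f (u n)) * N (u (n + 1)) - ∫ x in u n..u (n + 1), N x * f' x
        = ∫ x in u n..u (n + 1), f' x * (N (u (n + 1)) - N x) := by
      rw [e1, ← intervalIntegral.integral_mul_const, ← intervalIntegral.integral_sub
        (Continuous.intervalIntegrable (by fun_prop) _ _) (i1 _ _)]
      exact intervalIntegral.integral_congr fun x _ => by ring
    have b2 : |∫ x in u n..u (n + 1), f' x * (N (u (n + 1)) - N x)|
        ≤ C * ε * (u (n + 1) - u n) := by
      have := intervalIntegral.norm_integral_le_of_norm_le_const (a := u n) (b := u (n + 1))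
        (f := fun x => f' x * (N (u (n + 1)) - N x)) (C := C * ε) fun x hx => by
          rw [uIoc_of_le h'] at hx
          rw [norm_mul]
          exact mul_le_mul (hb x ⟨h0.trans hx.1.le, hx.2⟩)
            (ho n n.lt_succ_self x ⟨hx.1.le, hx.2⟩) (norm_nonneg _) hC
      rwa [abs_of_nonneg (sub_nonneg.2 h')] at this
    rw [Finset.sum_range_succ, ← intervalIntegral.integral_add_adjacent_intervals
      (i1 (u 0) (u n)) (i1 (u n) (u (n + 1)))]
    calc _ = |(f (u n) * N (u n) - f (u 0) * N (u 0) - (∫ x in u 0..u n, N x * f' x)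
          - ∑ i ∈ Finset.range n, f (u i) * (N (u (i + 1)) - N (u i)))
          + ∫ x in u n..u (n + 1), f' x * (N (u (n + 1)) - N x)| := by
          rw [← e2]
          congr 1
          ring
      _ ≤ _ := (abs_add_le _ _).trans (add_le_add ih' b2)
      _ = _ := by ring

/-- Convergence of Riemann–Stieltjes sums along the uniform partitions, stopped at `s`. -/
lemma tendsto_stieltjes_sum {f f' N : ℝ → ℝ} (hf : ∀ x, HasDerivAt f (f' x) x)
    (hf' : Continuous f') (hN : Continuous N) {s : ℝ} (hs : s ∈ Icc t T) :
    Tendsto (fun n => ∑ i ∈ Finset.range (n + 1), f (partitionTime t T n i)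
        * (N (min (partitionTime t T n (i + 1)) s) - N (min (partitionTime t T n i) s))) atTop
      (𝓝 (f s * N s - f t * N t - ∫ x in t..s, N x * f' x)) := by
  have hT : t ≤ T := hs.1.trans hs.2
  obtain ⟨C, hC⟩ := isCompact_Icc.exists_bound_of_continuousOn (hf'.continuousOn (s := Icc t T))
  have hC' : ∀ x ∈ Icc t T, |f' x| ≤ |C| := fun x hx => (hC x hx).trans (le_abs_self C)
  rw [Metric.tendsto_atTop]
  intro ε hε
  -- The summand `1` keeps `K` positive and makes the final estimate strict.
  set K := |C| * (T - t) + 1 with hK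
  have hK0 : 0 < K := by
    have := mul_nonneg (abs_nonneg C) (sub_nonneg.2 hT)
    linarith
  have hη : 0 < ε / K := div_pos hε hK0
  obtain ⟨δ, hδ, huc⟩ := Metric.uniformContinuousOn_iff.1
    (isCompact_Icc.uniformContinuousOn_of_continuous (hN.continuousOn (s := Icc t T))) _ hη
  obtain ⟨n₀, hn₀⟩ := exists_nat_gt ((T - t) / δ)
  refine ⟨n₀, fun n hn => ?_⟩
  have hmesh : (T - t) / (n + 1) < δ := by
    have : (n₀ : ℝ) ≤ n := by exact_mod_cast hn
    rw [div_lt_iff₀ (by positivity)]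
    rw [div_lt_iff₀ hδ] at hn₀
    nlinarith
  have hu : Monotone fun i => min (partitionTime t T n i) s := fun i j hij =>
    min_le_min_right _ (partitionTime_mono hT n hij)
  have hu0 : min (partitionTime t T n 0) s = t := by
    rw [partitionTime_zero, min_eq_left hs.1]
  have hun : min (partitionTime t T n (n + 1)) s = s := by
    rw [partitionTime_last, min_eq_right hs.2]
  have hmem : ∀ i, min (partitionTime t T n i) s ∈ Icc t T := fun i =>
    ⟨le_min (partitionTime_mem hT n i).1 hs.1, (min_le_right _ _).trans hs.2⟩
  have hstep : ∀ i, min (partitionTime t T n (i + 1)) s - min (partitionTime t T n i) s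
      ≤ (T - t) / (n + 1) := fun i => by
    refine le_trans ?_ (partitionTime_succ_sub_le hT n i)
    have := partitionTime_mono hT n (Nat.le_succ i)
    rcases le_total (partitionTime t T n i) s with h | h
    · rw [min_eq_left h]
      linarith [min_le_left (partitionTime t T n (i + 1)) s]
    · rw [min_eq_right h, min_eq_right (h.trans this)]
      linarith
  have key := abs_stieltjes_sub_sum_le hf hf' hN hu (C := |C|) (ε := ε / K) (abs_nonneg C) (n + 1)
    (fun x hx => by
      simp only [hu0, hun] at hx
      exact hC' x ⟨hx.1, hx.2.trans hs.2⟩)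
    (fun i _ x hx => by
      have hx' : x ∈ Icc t T := ⟨(hmem i).1.trans hx.1, hx.2.trans (hmem (i + 1)).2⟩
      refine (huc _ (hmem (i + 1)) _ hx' ?_).le
      rw [Real.dist_eq, abs_of_nonneg (sub_nonneg.2 hx.2)]
      linarith [hstep i, hx.1])
  simp only [hu0, hun] at key
  -- At nodes beyond `s` the increment of `N` vanishes, so stopping the argument of `f` changes
  -- nothing.
  have hsum : ∑ i ∈ Finset.range (n + 1), f (partitionTime t T n i)
        * (N (min (partitionTime t T n (i + 1)) s) - N (min (partitionTime t T n i) s))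
      = ∑ i ∈ Finset.range (n + 1), f (min (partitionTime t T n i) s)
        * (N (min (partitionTime t T n (i + 1)) s) - N (min (partitionTime t T n i) s)) := by
    refine Finset.sum_congr rfl fun i _ => ?_
    rcases le_total (partitionTime t T n i) s with h | h
    · rw [min_eq_left h]
    · rw [min_eq_right h, min_eq_right (h.trans (partitionTime_mono hT n (Nat.le_succ i)))]
      simp
  rw [hsum, dist_comm, Real.dist_eq]
  refine key.trans_lt ?_
  have h1 : |C| * (s - t) ≤ |C| * (T - t) := by
    have := hs.2
    gcongr
  calc |C| * (ε / K) * (s - t) = |C| * (s - t) * (ε / K) := by ring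
    _ ≤ |C| * (T - t) * (ε / K) := by gcongr
    _ < K * (ε / K) := by
        gcongr
        linarith
    _ = ε := by field_simp

end Partition

section Deterministic

variable {Ω : Type*} [mΩ : MeasurableSpace Ω] {P : Measure Ω} {ℱ : Filtration ℝ≥0 mΩ}
  {w : ℝ≥0 → Ω → ℝ} {t T : ℝ}

/-- The left-point step function of a deterministic function as a simple process. -/
noncomputable def stepProc (ℱ : Filtration ℝ≥0 mΩ) (f : ℝ → ℝ) (h : t ≤ T)
    {C : ℝ} (hC : ∀ x ∈ Icc t T, |f x| ≤ C) (n : ℕ) : SimpleProc ℱ t T where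
  n := n + 1
  time := partitionTime t T n
  ξ i _ := f (partitionTime t T n i)
  mono := partitionTime_mono h n
  mem := partitionTime_mem h n
  meas _ := measurable_const
  bdd := ⟨C, fun i _ => hC _ (partitionTime_mem h n i)⟩

/-- The indicators of the cells sum to one on `(t, T]`, so the error is an average of differences `f
y - f x` with `y` within one mesh of `x`. -/
lemma abs_stepProc_val_sub_le {f : ℝ → ℝ} (h : t ≤ T) {C : ℝ} (hC : ∀ x ∈ Icc t T, |f x| ≤ C)
    (n : ℕ) {ε x : ℝ} (hx : x ∈ Ioc t T)
    (hf : ∀ y ∈ Icc t T, |y - x| ≤ (T - t) / (n + 1) → |f y - f x| ≤ ε) (ω : Ω) :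
    |(stepProc ℱ f h hC n).val x ω - f x| ≤ ε := by
  have hsum := sum_indicator_Ioc (partitionTime_mono h n) (n + 1) x
  rw [partitionTime_zero, partitionTime_last, indicator_of_mem hx, Pi.one_apply] at hsum
  have e1 : (stepProc ℱ f h hC n).val x ω - f x = ∑ i ∈ Finset.range (n + 1),
      (Ioc (partitionTime t T n i) (partitionTime t T n (i + 1))).indicator (1 : ℝ → ℝ) x
        * (f (partitionTime t T n i) - f x) := by
    simp only [mul_sub, Finset.sum_sub_distrib, ← Finset.sum_mul, hsum, one_mul]
    congr 1
    refine Finset.sum_congr rfl fun i _ => ?_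
    change (Ioc (partitionTime t T n i) (partitionTime t T n (i + 1))).indicator
      (fun _ => f (partitionTime t T n i)) x = _
    by_cases hi : x ∈ Ioc (partitionTime t T n i) (partitionTime t T n (i + 1)) <;> simp [hi]
  rw [e1]
  calc _ ≤ ∑ i ∈ Finset.range (n + 1),
        |(Ioc (partitionTime t T n i) (partitionTime t T n (i + 1))).indicator (1 : ℝ → ℝ) x
          * (f (partitionTime t T n i) - f x)| := Finset.abs_sum_le_sum_abs _ _
    _ ≤ ∑ i ∈ Finset.range (n + 1),
        (Ioc (partitionTime t T n i) (partitionTime t T n (i + 1))).indicator (1 : ℝ → ℝ) x * ε := by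
        refine Finset.sum_le_sum fun i _ => ?_
        by_cases hi : x ∈ Ioc (partitionTime t T n i) (partitionTime t T n (i + 1))
        · simp only [hi, indicator_of_mem, Pi.one_apply, one_mul]
          refine hf _ (partitionTime_mem h n i) ?_
          rw [abs_sub_comm, abs_of_nonneg (sub_nonneg.2 hi.1.le)]
          linarith [partitionTime_succ_sub_le h n i, hi.2]
        · simp [hi]
    _ = ε := by rw [← Finset.sum_mul, hsum, one_mul]

/-- The Itô integral of a continuously differentiable deterministic function. -/
lemma isItoIntegral_deterministic (hw : IsBrownianMotion ℱ w P) (ht : 0 ≤ t) (hT : t ≤ T)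
    {f f' : ℝ → ℝ} (hf : ∀ x, HasDerivAt f (f' x) x) (hf' : Continuous f') :
    IsItoIntegral ℱ w P t T (fun s _ => f s) (fun s ω => f s * increment w t s ω
      - ∫ x in t..s, increment w t x ω * f' x) := by
  have := hw.isProbabilityMeasure
  have hfc : Continuous f := continuous_iff_continuousAt.2 fun x => (hf x).continuousAt
  obtain ⟨C, hC⟩ := isCompact_Icc.exists_bound_of_continuousOn (hfc.continuousOn (s := Icc t T))
  have hae : ∀ᵐ p : ℝ × Ω ∂((volume.restrict (Ioc t T)).prod P), p.1 ∈ Ioc t T :=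
    (Measure.quasiMeasurePreserving_fst (μ := volume.restrict (Ioc t T)) (ν := P)).ae
      (ae_restrict_mem measurableSet_Ioc)
  refine isItoIntegral_of_tendsto hw ht ?_ (fun n => stepProc ℱ f hT hC n) ?_ fun s hs => ?_
  · refine MemLp.of_bound (hfc.measurable.comp measurable_fst).aestronglyMeasurable C ?_
    filter_upwards [hae] with p hp
    exact hC _ (Ioc_subset_Icc_self hp)
  -- Uniform continuity of `f` makes the error uniformly small, and the product measure is finite.
  · rw [ENNReal.tendsto_nhds_zero]
    intro ε hε
    set μ := (volume.restrict (Ioc t T)).prod P with hμ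
    have hlim : Tendsto (fun δ : ℝ => μ univ ^ ((2 : ℝ≥0∞).toReal)⁻¹ * ENNReal.ofReal δ) (𝓝 0)
        (𝓝 0) := by
      have h1 := ENNReal.Tendsto.const_mul (a := μ univ ^ ((2 : ℝ≥0∞).toReal)⁻¹)
        (ENNReal.tendsto_ofReal (tendsto_id (x := 𝓝 (0 : ℝ))))
        (Or.inr (ENNReal.rpow_ne_top_of_nonneg (by positivity) (measure_ne_top _ _)))
      simpa using h1
    obtain ⟨δ, hδε, hδ0⟩ := ((hlim.mono_left nhdsWithin_le_nhds).eventually_le_const hε |>.and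
      (self_mem_nhdsWithin (s := Ioi (0 : ℝ)))).exists
    obtain ⟨d, hd, huc⟩ := Metric.uniformContinuousOn_iff.1
      (isCompact_Icc.uniformContinuousOn_of_continuous (hfc.continuousOn (s := Icc t T))) δ hδ0
    obtain ⟨n₀, hn₀⟩ := exists_nat_gt ((T - t) / d)
    filter_upwards [eventually_ge_atTop n₀] with n hn
    have hmesh : (T - t) / (n + 1) < d := by
      have : (n₀ : ℝ) ≤ n := by exact_mod_cast hn
      rw [div_lt_iff₀ (by positivity)]
      rw [div_lt_iff₀ hd] at hn₀
      nlinarith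
    refine (eLpNorm_le_of_ae_bound (C := δ) ?_).trans hδε
    filter_upwards [hae] with p hp
    exact abs_stepProc_val_sub_le hT hC n hp (fun y hy hyx =>
      (huc y hy _ (Ioc_subset_Icc_self hp) (hyx.trans_lt hmesh)).le) p.2
  -- Along a continuous path the elementary integrals are Riemann–Stieltjes sums, whose limit is
  -- given by parts.
  · filter_upwards [hw.brownian.cont] with ω hω
    have hN : Continuous fun x : ℝ => increment w t x ω :=
      (hω.comp continuous_real_toNNReal).sub continuous_const
    have h := tendsto_stieltjes_sum hf hf' hN hs
    simp only [increment_self, Pi.zero_apply, mul_zero, sub_zero] at h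
    refine h.congr fun n => Finset.sum_congr rfl fun i _ => ?_
    simp only [increment, sub_sub_sub_cancel_right]
    rfl

end Deterministic

/-! ### The wealth process of a rule linear in wealth -/

section Coefficients

variable {m L : ℕ} (M : Market m L) {a γ T : ℝ} {α : ℝ → ℝ}

/-- The vector `σ' Σ⁻¹ (μ - μ₀ 1)`. -/
noncomputable def loading (k : Fin L) : ℝ := ∑ i, (M.cov⁻¹ *ᵥ M.excess) i * M.sigma i k

/-- As `Σ = σ σ'`, the squared length of `σ' Σ⁻¹ (μ - μ₀ 1)` collapses to `κ`: the variance of the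
driving noise per unit of time. -/
lemma sum_loading_sq : ∑ k, loading M k ^ 2 = M.kappa := by
  have h1 : loading M = M.sigmaᵀ *ᵥ (M.cov⁻¹ *ᵥ M.excess) := by
    funext k
    simp only [loading, Matrix.mulVec, dotProduct, Matrix.transpose_apply]
    exact Finset.sum_congr rfl fun _ _ => mul_comm _ _
  have h2 : ∑ k, loading M k ^ 2 = loading M ⬝ᵥ loading M := by
    simp [dotProduct, sq]
  rw [h2]
  nth_rewrite 2 [h1]
  rw [Matrix.dotProduct_mulVec, Matrix.vecMul_transpose, h1, Matrix.mulVec_mulVec]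
  change (M.cov *ᵥ (M.cov⁻¹ *ᵥ M.excess)) ⬝ᵥ _ = _
  rw [cov_mulVec_inv, Market.kappa]

/-- The amounts do not depend on wealth, so the Itô integrands are deterministic. -/
lemma caraRule_diffusion (s x : ℝ) (k : Fin L) :
    ∑ i, (caraRule M a γ α (beta M.mu0 T)).amount s x i * M.sigma i k
      = (beta M.mu0 T s)⁻¹ * (loading M k / γ) := by
  simp only [caraRule, loading, Pi.smul_apply, smul_eq_mul, mul_assoc]
  rw [← Finset.mul_sum, one_div, mul_inv]
  ring

lemma caraRule_drift (s x : ℝ) :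
    (∑ i, (caraRule M a γ α (beta M.mu0 T)).amount s x i * (M.mu i - M.mu0))
      + (M.mu0 * x - (caraRule M a γ α (beta M.mu0 T)).cons s x)
      = (M.mu0 - beta M.mu0 T s) * x + driftB M a γ T α s := by
  have h : M.kappa = ∑ i, (M.cov⁻¹ *ᵥ M.excess) i * (M.mu i - M.mu0) :=
    dotProduct_comm _ _
  simp only [caraRule, Pi.smul_apply, smul_eq_mul, driftB, h, mul_assoc]
  rw [← Finset.mul_sum]
  ring

/-- The derivative of `1 / β`. -/
noncomputable def betaInvDeriv (mu0 T s : ℝ) : ℝ := (mu0 - 1) * Real.exp (-mu0 * (T - s))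

/-- Unlike `β`, whose denominator is controlled for `s ≤ T`, the reciprocal is smooth on all of `ℝ`,
as the by-parts formula for the Itô integral demands. -/
lemma hasDerivAt_beta_inv {mu0 : ℝ} (h0 : 0 < mu0) (T s : ℝ) :
    HasDerivAt (fun s => (beta mu0 T s)⁻¹) (betaInvDeriv mu0 T s) s := by
  simp only [beta, inv_div]
  refine ((hasDerivAt_beta_den mu0 T s).div_const mu0).congr_deriv ?_
  rw [betaInvDeriv]
  field_simp

lemma continuous_beta_inv {mu0 : ℝ} (h0 : 0 < mu0) (T : ℝ) :
    Continuous fun s => (beta mu0 T s)⁻¹ :=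
  continuous_iff_continuousAt.2 fun s => (hasDerivAt_beta_inv h0 T s).continuousAt

lemma continuous_betaInvDeriv (mu0 T : ℝ) : Continuous (betaInvDeriv mu0 T) := by
  unfold betaInvDeriv
  fun_prop

/-- Thus `1 / β` solves the homogeneous equation `y' = (μ₀ - β) y` of the wealth drift. -/
lemma betaInvDeriv_eq {mu0 T s : ℝ} (h0 : 0 < mu0) (hs : s ≤ T) :
    betaInvDeriv mu0 T s = (mu0 - beta mu0 T s) * (beta mu0 T s)⁻¹ := by
  have h := beta_den_pos h0 hs
  rw [betaInvDeriv, beta]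
  generalize hD : 1 + (mu0 - 1) * Real.exp (-mu0 * (T - s)) = D at h ⊢
  rw [show (mu0 - 1) * Real.exp (-mu0 * (T - s)) = D - 1 by linarith]
  field_simp

/-- The deterministic part of wealth times `β`. -/
noncomputable def wealthMean (a γ T : ℝ) (α : ℝ → ℝ) (t W s : ℝ) : ℝ :=
  beta M.mu0 T t * W + ∫ τ in t..s, beta M.mu0 T τ * driftB M a γ T α τ

lemma hasDerivWithinAt_wealthMean (ha : 0 < a) (hγ : 0 < γ) {t : ℝ}
    (hα : ContinuousOn α (Icc t T)) (W : ℝ) {s : ℝ} (hs : s ∈ Icc t T) :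
    HasDerivWithinAt (wealthMean M a γ T α t W) (beta M.mu0 T s * driftB M a γ T α s)
      (Icc t T) s :=
  (hasDerivWithinAt_integral_right ((continuousOn_beta M.mu0_pos t T).mul
    (continuousOn_driftB M ha hγ hα)) ⟨le_rfl, hs.1.trans hs.2⟩ hs).const_add _

lemma continuousOn_wealthMean (ha : 0 < a) (hγ : 0 < γ) {t : ℝ}
    (hα : ContinuousOn α (Icc t T)) (W : ℝ) :
    ContinuousOn (wealthMean M a γ T α t W) (Icc t T) := fun _ hs =>
  (hasDerivWithinAt_wealthMean M ha hγ hα W hs).continuousWithinAt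

/-- The budget equation along a path of the driving noise. -/
lemma wealth_path_eq (ha : 0 < a) (hγ : 0 < γ) {t : ℝ} (hα : ContinuousOn α (Icc t T)) (W : ℝ)
    {Q : ℝ → ℝ} (hQ : Continuous Q) {s : ℝ} (hs : s ∈ Icc t T) :
    (beta M.mu0 T s)⁻¹ * (wealthMean M a γ T α t W s + Q s)
      = W + (∫ τ in t..s, ((M.mu0 - beta M.mu0 T τ)
          * ((beta M.mu0 T τ)⁻¹ * (wealthMean M a γ T α t W τ + Q τ)) + driftB M a γ T α τ))
        + ((beta M.mu0 T s)⁻¹ * Q s - ∫ τ in t..s, Q τ * betaInvDeriv M.mu0 T τ) := by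
  have htT : t ≤ T := hs.1.trans hs.2
  have htm : t ∈ Icc t T := ⟨le_rfl, htT⟩
  have hβ := continuousOn_beta M.mu0_pos t T
  have hg := (continuous_beta_inv M.mu0_pos T).continuousOn (s := Icc t T)
  have hm := continuousOn_wealthMean M ha hγ hα W
  have hB := continuousOn_driftB M ha hγ hα
  have c1 : ContinuousOn (fun τ => (M.mu0 - beta M.mu0 T τ)
      * ((beta M.mu0 T τ)⁻¹ * (wealthMean M a γ T α t W τ + Q τ)) + driftB M a γ T α τ)
      (Icc t T) :=
    ((continuousOn_const.sub hβ).mul (hg.mul (hm.add hQ.continuousOn))).add hB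
  have c2 : ContinuousOn (fun τ => Q τ * betaInvDeriv M.mu0 T τ) (Icc t T) :=
    (hQ.mul (continuous_betaInvDeriv M.mu0 T)).continuousOn
  -- The term `Q / β` occurs on both sides and is left out, so only differentiable functions remain
  -- although `Q` is merely continuous.
  have key := eq_of_hasDerivWithinAt_zero (a := t) (b := T)
    (f := fun s => (beta M.mu0 T s)⁻¹ * wealthMean M a γ T α t W s
      - ((∫ τ in t..s, ((M.mu0 - beta M.mu0 T τ)
          * ((beta M.mu0 T τ)⁻¹ * (wealthMean M a γ T α t W τ + Q τ)) + driftB M a γ T α τ))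
        - ∫ τ in t..s, Q τ * betaInvDeriv M.mu0 T τ)) (fun s hs => by
      refine (((hasDerivAt_beta_inv M.mu0_pos T s).hasDerivWithinAt.mul
        (hasDerivWithinAt_wealthMean M ha hγ hα W hs)).sub
        ((hasDerivWithinAt_integral_right c1 htm hs).sub
          (hasDerivWithinAt_integral_right c2 htm hs))).congr_deriv ?_
      have hp := (beta_pos M.mu0_pos hs.2).ne'
      rw [betaInvDeriv_eq M.mu0_pos hs.2]
      field_simp
      ring) hs htm
  have hp := (beta_pos M.mu0_pos htT).ne'
  have hW : (beta M.mu0 T t)⁻¹ * wealthMean M a γ T α t W t = W := by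
    simp [wealthMean, hp]
  simp only [hW, intervalIntegral.integral_same, sub_zero] at key
  rw [mul_add]
  linear_combination key

end Coefficients

/-! ### The explicit wealth process and its pathwise uniqueness -/

section Wealth

variable {m L : ℕ} {Ω : Type*} [mΩ : MeasurableSpace Ω] {P : Measure Ω}
  {ℱ : Filtration ℝ≥0 mΩ} {z : Fin L → ℝ≥0 → Ω → ℝ} {M : Market m L} {a γ T : ℝ} {α : ℝ → ℝ}

/-- The driving noise of the wealth process. -/
noncomputable def noise (M : Market m L) (z : Fin L → ℝ≥0 → Ω → ℝ) (t s : ℝ) (ω : Ω) : ℝ :=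
  ∑ k, loading M k * increment (z k) t s ω

/-- The explicit solution of the budget equation. -/
noncomputable def explicitWealth (M : Market m L) (z : Fin L → ℝ≥0 → Ω → ℝ) (a γ T : ℝ)
    (α : ℝ → ℝ) (t W s : ℝ) (ω : Ω) : ℝ :=
  (beta M.mu0 T s)⁻¹ * (wealthMean M a γ T α t W s + noise M z t s ω / γ)

lemma IsBrownianBasis.ae_continuous_noise (hz : IsBrownianBasis ℱ z P) (t : ℝ) :
    ∀ᵐ ω ∂P, Continuous fun s => noise M z t s ω := by
  filter_upwards [ae_all_iff.2 fun k => (hz.brownian k).cont] with ω hω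
  refine continuous_finsetSum _ fun k _ => continuous_const.mul ?_
  exact ((hω k).comp continuous_real_toNNReal).sub continuous_const

lemma IsBrownianBasis.isItoIntegral_loading (hz : IsBrownianBasis ℱ z P) {t : ℝ} (ht : 0 ≤ t)
    (hT : t ≤ T) (k : Fin L) :
    IsItoIntegral ℱ (z k) P t T (fun s _ => (beta M.mu0 T s)⁻¹ * (loading M k / γ))
      (fun s ω => (beta M.mu0 T s)⁻¹ * (loading M k / γ) * increment (z k) t s ω
        - ∫ x in t..s, increment (z k) t x ω * (betaInvDeriv M.mu0 T x * (loading M k / γ))) :=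
  isItoIntegral_deterministic (hz.component k) ht hT
    (fun x => (hasDerivAt_beta_inv M.mu0_pos T x).mul_const _)
    ((continuous_betaInvDeriv M.mu0 T).mul continuous_const)

/-- The stochastic integral of the budget equation, along almost every path. -/
lemma IsBrownianBasis.ae_sum_ito_eq (hz : IsBrownianBasis ℱ z P) (t : ℝ) :
    ∀ᵐ ω ∂P, ∀ s, ∑ k, ((beta M.mu0 T s)⁻¹ * (loading M k / γ) * increment (z k) t s ω
        - ∫ x in t..s, increment (z k) t x ω * (betaInvDeriv M.mu0 T x * (loading M k / γ)))
      = (beta M.mu0 T s)⁻¹ * (noise M z t s ω / γ)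
        - ∫ x in t..s, noise M z t x ω / γ * betaInvDeriv M.mu0 T x := by
  filter_upwards [ae_all_iff.2 fun k => (hz.brownian k).cont] with ω hω s
  rw [Finset.sum_sub_distrib, ← intervalIntegral.integral_finsetSum fun k _ => by
    have hN : Continuous fun x : ℝ => increment (z k) t x ω :=
      ((hω k).comp continuous_real_toNNReal).sub continuous_const
    have := continuous_betaInvDeriv M.mu0 T
    exact Continuous.intervalIntegrable (by fun_prop) _ _]
  simp only [noise, Finset.sum_div, Finset.mul_sum, Finset.sum_mul]
  congr 1
  · exact Finset.sum_congr rfl fun k _ => by ring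
  · exact intervalIntegral.integral_congr fun x _ => Finset.sum_congr rfl fun k _ => by ring

lemma IsBrownianBasis.isWealthProcess_explicit (hz : IsBrownianBasis ℱ z P) (ha : 0 < a)
    (hγ : 0 < γ) {t : ℝ} (ht : 0 ≤ t) (hT : t ≤ T) (hα : ContinuousOn α (Icc t T)) (W : ℝ) :
    IsWealthProcess M ℱ z P T (caraRule M a γ α (beta M.mu0 T)) t W
      (explicitWealth M z a γ T α t W) := by
  have hg := (continuous_beta_inv M.mu0_pos T).continuousOn (s := Icc t T)
  have hm := continuousOn_wealthMean M ha hγ hα W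
  have hβ := continuousOn_beta M.mu0_pos t T
  have hB := continuousOn_driftB M ha hγ hα
  have hc : ∀ᵐ ω ∂P, ContinuousOn (fun s => explicitWealth M z a γ T α t W s ω) (Icc t T) := by
    filter_upwards [hz.ae_continuous_noise (M := M) t] with ω hω
    exact hg.mul (hm.add (hω.continuousOn.div_const γ))
  refine ⟨fun s hs => ?_, hc, ?_, fun k s ω =>
      (beta M.mu0 T s)⁻¹ * (loading M k / γ) * increment (z k) t s ω
        - ∫ x in t..s, increment (z k) t x ω * (betaInvDeriv M.mu0 T x * (loading M k / γ)),
    fun k => ?_, fun s hs => ?_⟩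
  · refine Measurable.const_mul (Measurable.const_add (Measurable.div_const ?_ _) _) _
    exact Finset.measurable_fun_sum _ fun k _ =>
      ((hz.component k).measurable_increment hs.1).const_mul _
  · filter_upwards [hc] with ω hω
    simp only [caraRule_drift]
    exact intervalIntegrable_of_continuousOn_Icc (((continuousOn_const.sub hβ).mul hω).add hB)
      ⟨le_rfl, hT⟩ ⟨hT, le_rfl⟩
  · simp only [caraRule_diffusion]
    exact hz.isItoIntegral_loading ht hT k
  · filter_upwards [hz.ae_continuous_noise (M := M) t, hz.ae_sum_ito_eq (M := M) (γ := γ) (T := T) t]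
      with ω h1 h2
    rw [h2 s]
    simp only [caraRule_drift]
    exact wealth_path_eq M ha hγ hα W (h1.div_const γ) hs

/-- A countable dense set of times costs one null set, and continuity of the paths extends the
equality to all times. -/
lemma ae_forall_eq_of_continuousOn {f g : ℝ → Ω → ℝ} {t T : ℝ}
    (hf : ∀ᵐ ω ∂P, ContinuousOn (fun s => f s ω) (Icc t T))
    (hg : ∀ᵐ ω ∂P, ContinuousOn (fun s => g s ω) (Icc t T))
    (h : ∀ s ∈ Icc t T, f s =ᵐ[P] g s) : ∀ᵐ ω ∂P, ∀ s ∈ Icc t T, f s ω = g s ω := by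
  obtain ⟨D, hD, hdense⟩ := TopologicalSpace.exists_countable_dense (Icc t T)
  have h' : ∀ᵐ ω ∂P, ∀ s ∈ D, f s ω = g s ω := (ae_ball_iff hD).2 fun s _ => h s s.2
  filter_upwards [hf, hg, h'] with ω h1 h2 h3 s hs
  have := Continuous.ext_on hdense (continuousOn_iff_continuous_domRestrict.1 h1)
    (continuousOn_iff_continuous_domRestrict.1 h2) (fun s hs => h3 s hs)
  exact congrFun this ⟨s, hs⟩

/-- The wealth process is unique up to indistinguishability. -/
lemma IsWealthProcess.ae_eq_explicit (hz : IsBrownianBasis ℱ z P) (ha : 0 < a)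
    (hγ : 0 < γ) {t : ℝ} (ht : 0 ≤ t) (hT : t ≤ T) (hα : ContinuousOn α (Icc t T)) {W : ℝ}
    {X : ℝ → Ω → ℝ}
    (hX : IsWealthProcess M ℱ z P T (caraRule M a γ α (beta M.mu0 T)) t W X) :
    ∀ᵐ ω ∂P, ∀ s ∈ Icc t T, X s ω = explicitWealth M z a γ T α t W s ω := by
  have hY := hz.isWealthProcess_explicit (M := M) ha hγ ht hT hα W
  have hβ := continuousOn_beta M.mu0_pos t T
  have hB := continuousOn_driftB M ha hγ hα
  have htm : t ∈ Icc t T := ⟨le_rfl, hT⟩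
  obtain ⟨I, hI, eX⟩ := hX.sde
  obtain ⟨J, hJ, eY⟩ := hY.sde
  simp only [caraRule_diffusion] at hI hJ
  simp only [caraRule_drift] at eX eY
  have hdrift : ∀ x : ℝ → ℝ, ContinuousOn x (Icc t T) → ContinuousOn
      (fun τ => (M.mu0 - beta M.mu0 T τ) * x τ + driftB M a γ T α τ) (Icc t T) := fun x hx =>
    ((continuousOn_const.sub hβ).mul hx).add hB
  have hcont : ∀ Z : ℝ → Ω → ℝ, (∀ᵐ ω ∂P, ContinuousOn (fun s => Z s ω) (Icc t T)) →
      ∀ᵐ ω ∂P, ContinuousOn (fun s => Z s ω - ∫ τ in t..s, ((M.mu0 - beta M.mu0 T τ) * Z τ ω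
        + driftB M a γ T α τ)) (Icc t T) := fun Z hZ => by
    filter_upwards [hZ] with ω hω
    exact hω.sub fun s hs =>
      (hasDerivWithinAt_integral_right (hdrift _ hω) htm hs).continuousWithinAt
  -- Both processes have the same deterministic Itô integrands, so subtracting the drift integrals
  -- leaves the same process.
  have key := ae_forall_eq_of_continuousOn (hcont X hX.cont) (hcont _ hY.cont) fun s hs => by
    filter_upwards [eX s hs, eY s hs,
      ae_all_iff.2 fun k => IsItoIntegral.ae_eq (hz.component k) ht (hI k) (hJ k) hs]
      with ω h1 h2 h3
    rw [h1, h2, Finset.sum_congr rfl fun k _ => h3 k]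
    ring
  filter_upwards [key, hX.cont, hY.cont] with ω h1 h2 h3 s hs
  have e : ∀ s ∈ Icc t T, X s ω - explicitWealth M z a γ T α t W s ω
      = (∫ τ in t..s, ((M.mu0 - beta M.mu0 T τ) * X τ ω + driftB M a γ T α τ))
        - ∫ τ in t..s, ((M.mu0 - beta M.mu0 T τ) * explicitWealth M z a γ T α t W τ ω
          + driftB M a γ T α τ) := fun s hs => by
    linarith [h1 s hs]
  -- Path by path, the difference solves `y' = (μ₀ - β) y` with `y(t) = 0`.
  have h := eq_zero_of_linear_ode (f := fun s => X s ω - explicitWealth M z a γ T α t W s ω)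
    (k := fun s => M.mu0 - beta M.mu0 T s) (c := t) (continuousOn_const.sub hβ) (fun s hs => by
      refine (((hasDerivWithinAt_integral_right (hdrift _ h2) htm hs).sub
        (hasDerivWithinAt_integral_right (hdrift _ h3) htm hs)).congr_of_mem e hs).congr_deriv ?_
      ring) htm (by
      have := e t htm
      simpa using this) hs
  exact sub_eq_zero.1 h

end Wealth

/-! ### The non-local term -/

section Utility

variable {m L : ℕ} {Ω : Type*} {z : Fin L → ℝ≥0 → Ω → ℝ} {M : Market m L} {a γ T : ℝ}
  {α : ℝ → ℝ}

/-- Multiplication of wealth by `β` leaves `wealthMean + N / γ`, so the utility splits into a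
deterministic factor and `e^{-N}`. -/
lemma utility_cons_explicit (ha : 0 < a) (hγ : 0 < γ) {s : ℝ} (hs : s ≤ T) (t W : ℝ) (ω : Ω) :
    utility γ ((caraRule M a γ α (beta M.mu0 T)).cons s (explicitWealth M z a γ T α t W s ω))
      = -(a * beta M.mu0 T s * Real.exp (-γ * (α s + wealthMean M a γ T α t W s)))
        * Real.exp (-noise M z t s ω) := by
  have hp := beta_pos M.mu0_pos hs
  have h := utility_caraRule_cons (α := α) (b := beta M.mu0 T) hγ
    (by positivity : 0 < a * γ * beta M.mu0 T s) (explicitWealth M z a γ T α t W s ω)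
  have e : Real.exp (-γ * (α s + beta M.mu0 T s * explicitWealth M z a γ T α t W s ω))
      = Real.exp (-γ * (α s + wealthMean M a γ T α t W s)) * Real.exp (-noise M z t s ω) := by
    rw [← Real.exp_add, explicitWealth]
    congr 1
    field_simp
    ring
  rw [utility]
  change -Real.exp (-γ * (α s + beta M.mu0 T s * _ - Real.log (a * γ * beta M.mu0 T s) / γ)) / γ = _
  rw [h, e]
  field_simp

end Utility

section Nonlocal

variable {m L : ℕ} {Ω : Type*} [mΩ : MeasurableSpace Ω] {P : Measure Ω}
  {ℱ : Filtration ℝ≥0 mΩ} {z : Fin L → ℝ≥0 → Ω → ℝ} {M : Market m L} {a γ T : ℝ}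
  {r α : ℝ → ℝ}

/-- Paths are continuous only almost surely; setting the process to zero on a measurable null set
gives a jointly measurable version. -/
lemma aemeasurable_uncurry_of_ae_continuous {w : ℝ≥0 → Ω → ℝ} (hw : ∀ t, Measurable (w t))
    (hc : ∀ᵐ ω ∂P, Continuous fun t => w t ω) (ν : Measure ℝ) [SFinite P] [SFinite ν] :
    AEMeasurable (fun p : ℝ × Ω => w p.1.toNNReal p.2) (ν.prod P) := by
  obtain ⟨A, hsub, hA, hnull⟩ := exists_measurable_superset_of_null hc
  have h1 : ∀ ω, Continuous fun t => Aᶜ.indicator (w t) ω := fun ω => by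
    by_cases h : ω ∈ A
    · simpa [h] using continuous_const
    · have : Continuous fun t => w t ω := by
        by_contra hne
        exact h (hsub hne)
      simpa [h] using this
  have h2 := measurable_uncurry_of_continuous_of_measurable (u := fun t => Aᶜ.indicator (w t)) h1
    fun t => (hw t).indicator hA.compl
  refine ⟨fun p => Function.uncurry (fun t => Aᶜ.indicator (w t)) (p.1.toNNReal, p.2),
    h2.comp ((measurable_real_toNNReal.comp measurable_fst).prodMk measurable_snd), ?_⟩
  have h3 : ∀ᵐ p : ℝ × Ω ∂(ν.prod P), p.2 ∈ Aᶜ :=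
    (Measure.quasiMeasurePreserving_snd (μ := ν) (ν := P)).ae (compl_mem_ae_iff.2 hnull)
  filter_upwards [h3] with p hp
  simp [Function.uncurry, hp]

lemma IsBrownianBasis.aemeasurable_noise [SFinite P] (hz : IsBrownianBasis ℱ z P) (t : ℝ)
    (ν : Measure ℝ) [SFinite ν] :
    AEMeasurable (fun p : ℝ × Ω => noise M z t p.1 p.2) (ν.prod P) := by
  refine Finset.aemeasurable_fun_sum _ fun k _ => AEMeasurable.const_mul ?_ _
  exact (aemeasurable_uncurry_of_ae_continuous (hz.component k).measurable (hz.brownian k).cont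
    ν).sub (((hz.component k).measurable _).comp measurable_snd).aemeasurable

lemma IsBrownianBasis.iIndepFun_increment (hz : IsBrownianBasis ℱ z P) (s t : ℝ) :
    iIndepFun (fun k ω => -loading M k * increment (z k) t s ω) P :=
  hz.indep.comp (fun k (x : ℝ≥0 → ℝ) => -loading M k * (x s.toNNReal - x t.toNNReal)) fun k => by
    fun_prop

lemma IsBrownianMotion.map_increment {w : ℝ≥0 → Ω → ℝ} (hw : IsBrownianMotion ℱ w P) {s t : ℝ}
    (ht : 0 ≤ t) (hs : t ≤ s) :
    P.map (increment w t s) = gaussianReal 0 (s - t).toNNReal := by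
  have h := (hw.brownian.hasLaw_sub s.toNNReal t.toNNReal).map_eq
  have e : nndist (s.toNNReal : ℝ) (t.toNNReal : ℝ) = (s - t).toNNReal := by
    ext
    rw [coe_nndist, Real.dist_eq, Real.coe_toNNReal _ ht, Real.coe_toNNReal _ (ht.trans hs),
      abs_of_nonneg (sub_nonneg.2 hs), Real.coe_toNNReal _ (sub_nonneg.2 hs)]
  exact h.trans (congrArg _ e)

lemma IsBrownianMotion.integrable_exp {w : ℝ≥0 → Ω → ℝ} (hw : IsBrownianMotion ℱ w P) {s t : ℝ}
    (ht : 0 ≤ t) (hs : t ≤ s) (c : ℝ) :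
    Integrable (fun ω => Real.exp (c * increment w t s ω)) P := by
  have h := integrable_exp_mul_gaussianReal (μ := 0) (v := (s - t).toNNReal) c
  rw [← hw.map_increment ht hs] at h
  exact h.comp_measurable (hw.measurable_increment' t s)

lemma IsBrownianBasis.integrable_exp_noise [IsProbabilityMeasure P] (hz : IsBrownianBasis ℱ z P)
    {s t : ℝ} (ht : 0 ≤ t) (hs : t ≤ s) :
    Integrable (fun ω => Real.exp (-noise M z t s ω)) P := by
  have h := (hz.iIndepFun_increment (M := M) s t).integrable_exp_mul_sum (t := 1)
    (s := Finset.univ) (fun k => ((hz.component k).measurable_increment' t s).const_mul _)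
    fun k _ => by simpa only [one_mul] using (hz.component k).integrable_exp ht hs _
  refine h.congr (.of_forall fun ω => ?_)
  simp [noise, Finset.sum_apply]

/-- The Laplace transform of the driving noise. -/
lemma IsBrownianBasis.integral_exp_noise (hz : IsBrownianBasis ℱ z P)
    {s t : ℝ} (ht : 0 ≤ t) (hs : t ≤ s) :
    ∫ ω, Real.exp (-noise M z t s ω) ∂P = Real.exp (M.kappa / 2 * (s - t)) := by
  have h := (hz.iIndepFun_increment (M := M) s t).mgf_sum (t := 1)
    (fun k => ((hz.component k).measurable_increment' t s).const_mul _) Finset.univ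
  simp only [mgf_const_mul, mgf_gaussianReal ((hz.component _).map_increment ht hs),
    ← Real.exp_sum, Real.coe_toNNReal _ (sub_nonneg.2 hs)] at h
  rw [mgf] at h
  have e1 : ∫ ω, Real.exp (-noise M z t s ω) ∂P
      = ∫ ω, Real.exp (1 * (∑ k, fun ω => -loading M k * increment (z k) t s ω) ω) ∂P := by
    refine integral_congr_ae (.of_forall fun ω => ?_)
    simp [noise, Finset.sum_apply]
  rw [e1, h, ← sum_loading_sq M, Finset.sum_div, Finset.sum_mul]
  congr 1
  exact Finset.sum_congr rfl fun k _ => by ring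

/-- Every wealth process is indistinguishable from the explicit one, so Fubini's theorem and the
Laplace transform of the noise evaluate the expectation. Initial wealth occurs only in `wealthMean`,
additively, and leaves the integral as an exponential factor. -/
theorem IsBrownianBasis.isNonlocalTerm [IsProbabilityMeasure P] (hz : IsBrownianBasis ℱ z P)
    (ha : 0 < a) (hγ : 0 < γ) (hr : ContinuousOn r (Icc 0 T)) (hα : ContinuousOn α (Icc 0 T))
    {t : ℝ} (ht : t ∈ Icc 0 T) (W : ℝ) :
    IsNonlocalTerm M ℱ z P T r (utility γ) (caraRule M a γ α (beta M.mu0 T)) t W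
      (a * nonlocalCoeff M a γ T r α t * Real.exp (-γ * (α t + beta M.mu0 T t * W))) := by
  have hT : 0 ≤ T := ht.1.trans ht.2
  have hα' := hα.mono (Icc_subset_Icc_zero ht)
  refine ⟨⟨_, hz.isWealthProcess_explicit ha hγ ht.1 ht.2 hα' W⟩, fun X hX => ?_⟩
  have hXY := hX.ae_eq_explicit hz ha hγ ht.1 ht.2 hα'
  set d : ℝ → ℝ := fun s => discount r (s - t) * (r (s - t) - r (T - t)) with hd
  set g : ℝ → ℝ := fun s => -(a * beta M.mu0 T s
    * Real.exp (-γ * (α s + wealthMean M a γ T α t W s))) with hg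
  have eu : ∀ s ≤ T, ∀ ω, utility γ ((caraRule M a γ α (beta M.mu0 T)).cons s
      (explicitWealth M z a γ T α t W s ω)) = g s * Real.exp (-noise M z t s ω) :=
    fun s hs ω => utility_cons_explicit ha hγ hs t W ω
  have cd : ContinuousOn d (Icc t T) :=
    (continuousOn_comp_sub (continuousOn_discount hT hr) ht).mul
      ((continuousOn_comp_sub hr ht).sub continuousOn_const)
  have cg : ContinuousOn g (Icc t T) :=
    ((continuousOn_const.mul (continuousOn_beta M.mu0_pos t T)).mul (continuousOn_const.mul
      (hα'.add (continuousOn_wealthMean M ha hγ hα' W))).rexp).neg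
  have cdg := cd.mul cg
  obtain ⟨C, hC⟩ := isCompact_Icc.exists_bound_of_continuousOn cdg
  set ν := (volume : Measure ℝ).restrict (Ioc t T) with hν
  have fst_mem : ∀ᵐ p : ℝ × Ω ∂(ν.prod P), p.1 ∈ Ioc t T :=
    (Measure.quasiMeasurePreserving_fst (μ := ν) (ν := P)).ae (ae_restrict_mem measurableSet_Ioc)
  have intE : Integrable (fun p : ℝ × Ω => Real.exp (-noise M z t p.1 p.2)) (ν.prod P) := by
    refine (integrable_prod_iff (f := fun p : ℝ × Ω => Real.exp (-noise M z t p.1 p.2))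
      (Real.measurable_exp.comp_aemeasurable (hz.aemeasurable_noise t ν).neg).aestronglyMeasurable).2
      ⟨?_, ?_⟩
    · filter_upwards [ae_restrict_mem measurableSet_Ioc] with s hs
      exact hz.integrable_exp_noise ht.1 hs.1.le
    · have h1 : Integrable (fun s => Real.exp (M.kappa / 2 * (s - t))) ν :=
        (Continuous.integrableOn_Icc (by fun_prop)).mono_set Ioc_subset_Icc_self
      refine h1.congr ?_
      filter_upwards [ae_restrict_mem measurableSet_Ioc] with s hs
      simp only [Real.norm_eq_abs, Real.abs_exp]
      exact (hz.integral_exp_noise ht.1 hs.1.le).symm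
  have intY : Integrable (fun p : ℝ × Ω => d p.1 * g p.1 * Real.exp (-noise M z t p.1 p.2))
      (ν.prod P) := by
    refine intE.bdd_mul (c := C) (f := fun p : ℝ × Ω => d p.1 * g p.1) ?_ ?_
    · exact AEStronglyMeasurable.comp_fst (f := fun s => d s * g s)
        ((cdg.mono Ioc_subset_Icc_self).aestronglyMeasurable measurableSet_Ioc)
    · filter_upwards [fst_mem] with p hp
      exact hC _ (Ioc_subset_Icc_self hp)
  have snd_mem : ∀ᵐ p : ℝ × Ω ∂(ν.prod P), ∀ s ∈ Icc t T,
      X s p.2 = explicitWealth M z a γ T α t W s p.2 :=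
    (Measure.quasiMeasurePreserving_snd (μ := ν) (ν := P)).ae hXY
  refine ⟨intY.congr ?_, ?_⟩
  · filter_upwards [fst_mem, snd_mem] with p h1 h2
    rw [h2 _ (Ioc_subset_Icc_self h1), eu _ h1.2]
    ring
  · have e1 : ∫ ω, (∫ s in t..T, discount r (s - t) * (r (s - t) - r (T - t))
        * utility γ ((caraRule M a γ α (beta M.mu0 T)).cons s (X s ω))) ∂P
        = ∫ ω, (∫ s in t..T, d s * g s * Real.exp (-noise M z t s ω)) ∂P := by
      refine integral_congr_ae ?_
      filter_upwards [hXY] with ω hω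
      refine intervalIntegral.integral_congr fun s hs => ?_
      have hs' := mem_Icc_of_uIcc ht hs
      rw [hω s hs', eu s hs'.2]
      ring
    rw [e1, ← intervalIntegral_integral_swap (f := fun s ω => d s * g s
      * Real.exp (-noise M z t s ω)) (by rw [uIoc_of_le ht.2]; exact intY),
      nonlocalCoeff, mul_neg, neg_mul, ← intervalIntegral.integral_const_mul,
      ← intervalIntegral.integral_mul_const, ← intervalIntegral.integral_neg]
    refine intervalIntegral.integral_congr fun s hs => ?_
    have hs' := mem_Icc_of_uIcc ht hs
    rw [integral_const_mul, hz.integral_exp_noise ht.1 hs'.1]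
    have e2 : Real.exp (-γ * (α s + wealthMean M a γ T α t W s))
        = Real.exp (-γ * (α s - α t + ∫ τ in t..s, beta M.mu0 T τ * driftB M a γ T α τ))
          * Real.exp (-γ * (α t + beta M.mu0 T t * W)) := by
      rw [← Real.exp_add, wealthMean]
      ring_nf
    simp only [hd, hg, e2]
    ring

end Nonlocal

/-! ### The modified HJB equation -/

/-- The existence clause of `IsNonlocalTerm` is what pins down the value. -/
lemma IsNonlocalTerm.unique {m L : ℕ} {Ω : Type*} [mΩ : MeasurableSpace Ω] {P : Measure Ω}
    {ℱ : Filtration ℝ≥0 mΩ} {z : Fin L → ℝ≥0 → Ω → ℝ} {M : Market m L} {T : ℝ} {r : ℝ → ℝ}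
    {u : ℝ → ℝ} {R : FeedbackRule m} {t W K K' : ℝ}
    (h : IsNonlocalTerm M ℱ z P T r u R t W K) (h' : IsNonlocalTerm M ℱ z P T r u R t W K') :
    K = K' := by
  obtain ⟨X, hX⟩ := h.1
  rw [(h.2 X hX).2, (h'.2 X hX).2]

section Modified

variable {m L : ℕ} {Ω : Type*} [mΩ : MeasurableSpace Ω] {P : Measure Ω} [IsProbabilityMeasure P]
  {ℱ : Filtration ℝ≥0 mΩ} {z : Fin L → ℝ≥0 → Ω → ℝ} {M : Market m L} {a γ T : ℝ}
  {r α : ℝ → ℝ}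

/-- For `b = β` the coefficient of `W` vanishes by the Riccati equation, so the condition at a
single nonzero wealth is already the equation of `α` and implies the condition at all others. -/
theorem IsBrownianBasis.solvesModifiedHJB_iff (hz : IsBrownianBasis ℱ z P) (ha : 0 < a)
    (hγ : 0 < γ) (hT : 0 < T) (hr : ContinuousOn r (Icc 0 T)) :
    SolvesModifiedHJB M ℱ z P (utility γ) (bequest a γ) r T (guess a γ α (beta M.mu0 T))
        (caraRule M a γ α (beta M.mu0 T)) ↔ SolvesAlphaEq M a γ T r α := by
  have hβ : ∀ t ∈ Icc 0 T, 0 < beta M.mu0 T t := fun t ht => beta_pos M.mu0_pos ht.2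
  have dβ : ∀ t ∈ Icc 0 T, HasDerivWithinAt (beta M.mu0 T)
      (beta M.mu0 T t ^ 2 - M.mu0 * beta M.mu0 T t) (Icc 0 T) t := fun t ht =>
    (hasDerivAt_beta M.mu0_pos ht.2).hasDerivWithinAt
  have uβ := fun t ht => (dβ t ht).derivWithin (uniqueDiffOn_Icc hT t ht)
  have eq_iff := fun t (ht : t ∈ Icc 0 T) hα' W hW =>
    isHamiltonianMax_time_iff M (α := α) ha hγ hT ht (hβ t ht) hα'
      (dβ t ht).differentiableWithinAt (W := W) hW (r (T - t)) (nonlocalCoeff M a γ T r α t)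
  have eq_iff' : ∀ t ∈ Icc 0 T, DifferentiableWithinAt ℝ α (Icc 0 T) t → ∀ W ≠ 0,
      (IsHamiltonianMax M (utility γ) (guess a γ α (beta M.mu0 T)) t W
        (r (T - t) * guess a γ α (beta M.mu0 T) t W
          + a * nonlocalCoeff M a γ T r α t * Real.exp (-γ * (α t + beta M.mu0 T t * W))
          - timeDeriv 0 T (guess a γ α (beta M.mu0 T)) t W) ↔ -r (T - t)
        + nonlocalCoeff M a γ T r α t - γ * derivWithin α (Icc 0 T) t + beta M.mu0 T t
        - 1 / 2 * M.kappa + γ * α t * beta M.mu0 T t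
        - beta M.mu0 T t * Real.log (a * γ * beta M.mu0 T t) = 0) := fun t ht hα' W hW => by
    rw [eq_iff t ht hα' W hW, uβ t ht, sub_self, mul_zero, zero_mul]
  constructor
  · intro h
    have dα := h.smooth.differentiableOn_left ha hγ
    refine ⟨?_, ((guess_eq_bequest_iff ha hγ T).1 h.terminal).1, fun t ht => ?_⟩
    · rw [show (1 : WithTop ℕ∞) = 0 + 1 from rfl,
        contDiffOn_succ_iff_derivWithin (uniqueDiffOn_Icc hT)]
      exact ⟨dα, by simp, contDiffOn_zero.2 (h.smooth.continuousOn_derivWithin_left ha hγ hT)⟩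
    · obtain ⟨K, hK, hmax, -⟩ := h.hjb t ht 1 one_ne_zero
      rw [hK.unique (hz.isNonlocalTerm ha hγ hr dα.continuousOn ht 1)] at hmax
      exact (eq_iff' t ht (dα t ht) 1 one_ne_zero).1 hmax
  · intro h
    have dα := h.smooth.differentiableOn one_ne_zero
    have cβ := continuousOn_beta M.mu0_pos 0 T
    refine ⟨isC12_guess hT dα (fun t ht => (dβ t ht).differentiableWithinAt)
      (h.smooth.continuousOn_derivWithin (uniqueDiffOn_Icc hT) le_rfl)
      (((cβ.pow 2).sub (continuousOn_const.mul cβ)).congr uβ),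
      (guess_eq_bequest_iff ha hγ T).2 ⟨h.terminal, beta_terminal M.mu0_pos T⟩,
      fun t ht W hW => ⟨_, hz.isNonlocalTerm ha hγ hr h.smooth.continuousOn ht W, ?_, ?_⟩⟩
    · exact (eq_iff' t ht (dα t ht) W hW).2 (h.eqn t ht)
    · exact isHamiltonianMax_caraRule M ha hγ (hβ t ht) hW

/-! ### The law of the equilibrium portfolio -/

lemma IsBrownianBasis.integral_noise (hz : IsBrownianBasis ℱ z P) (t s : ℝ) :
    Integrable (noise M z t s) P ∧ ∫ ω, noise M z t s ω ∂P = 0 := by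
  have hi : ∀ k, Integrable (fun ω => loading M k * increment (z k) t s ω) P := fun k =>
    (((hz.component k).memLp_increment t s).integrable one_le_two).const_mul _
  refine ⟨integrable_finsetSum _ fun k _ => hi k, ?_⟩
  simp only [noise]
  rw [integral_finsetSum _ fun k _ => hi k]
  exact Finset.sum_eq_zero fun k _ => by
    rw [integral_const_mul, (hz.component k).integral_increment, mul_zero]

/-- The mean of the wealth process. -/
lemma IsWealthProcess.integral_eq (hz : IsBrownianBasis ℱ z P) (ha : 0 < a) (hγ : 0 < γ)
    {t : ℝ} (ht : 0 ≤ t) (hT : t ≤ T) (hα : ContinuousOn α (Icc t T)) {W : ℝ} {X : ℝ → Ω → ℝ}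
    (hX : IsWealthProcess M ℱ z P T (caraRule M a γ α (beta M.mu0 T)) t W X) {s : ℝ}
    (hs : s ∈ Icc t T) :
    ∫ ω, X s ω ∂P = (beta M.mu0 T s)⁻¹ * wealthMean M a γ T α t W s := by
  have h1 : ∀ᵐ ω ∂P, X s ω = explicitWealth M z a γ T α t W s ω := by
    filter_upwards [hX.ae_eq_explicit hz ha hγ ht hT hα] with ω hω
    exact hω s hs
  obtain ⟨hi, h0⟩ := hz.integral_noise (M := M) t s
  rw [integral_congr_ae h1]
  simp only [explicitWealth]
  rw [integral_const_mul, integral_add (integrable_const _) (hi.div_const γ), integral_div, h0]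
  simp

/-- Some coordinate of `Σ⁻¹ (μ - μ₀ 1)` is nonzero, and there the share is a constant over wealth.
The convention `0⁻¹ = 0` covers zero wealth, and one `φ` serves all `α`. -/
lemma share_caraRule_injective (hγ : 0 < γ) (he : M.excess ≠ 0) {s : ℝ} (hs : s ≤ T) :
    ∃ φ : (Fin m → ℝ) → ℝ, Measurable φ ∧ ∀ (α : ℝ → ℝ) (x : ℝ),
      φ ((caraRule M a γ α (beta M.mu0 T)).share s x) = x := by
  have hv : M.cov⁻¹ *ᵥ M.excess ≠ 0 := fun h => he (by
    rw [← cov_mulVec_inv M M.excess, h, Matrix.mulVec_zero])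
  obtain ⟨i, hi⟩ := Function.ne_iff.1 hv
  have hi' : (M.cov⁻¹ *ᵥ M.excess) i ≠ 0 := hi
  have hp := beta_pos M.mu0_pos hs
  refine ⟨fun y => (y i * (γ * beta M.mu0 T s / (M.cov⁻¹ *ᵥ M.excess) i))⁻¹, by fun_prop,
    fun α x => ?_⟩
  simp only [FeedbackRule.share, caraRule, Pi.smul_apply, smul_eq_mul]
  rcases eq_or_ne x 0 with rfl | hx
  · simp
  · field_simp

/-- If all laws agreed, mean wealth would agree, as wealth is a function of the share.
Differentiating `wealthMean` gives equality of `B`, hence of `α`, hence of the discount factors. -/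
theorem IsBrownianBasis.exists_map_share_ne (hz : IsBrownianBasis ℱ z P) (ha : 0 < a)
    (hγ : 0 < γ) (hT : 0 < T) {r₁ r₂ α₁ α₂ : ℝ → ℝ} (hr₁ : ContinuousOn r₁ (Icc 0 T))
    (hr₂ : ContinuousOn r₂ (Icc 0 T)) (hne : ∃ τ ∈ Icc 0 T, discount r₁ τ ≠ discount r₂ τ)
    (he : M.excess ≠ 0) (h₁ : SolvesAlphaEq M a γ T r₁ α₁) (h₂ : SolvesAlphaEq M a γ T r₂ α₂)
    {W : ℝ} {X₁ X₂ : ℝ → Ω → ℝ}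
    (hX₁ : IsWealthProcess M ℱ z P T (caraRule M a γ α₁ (beta M.mu0 T)) 0 W X₁)
    (hX₂ : IsWealthProcess M ℱ z P T (caraRule M a γ α₂ (beta M.mu0 T)) 0 W X₂) :
    ∃ s ∈ Ioc 0 T,
      P.map (fun ω => (caraRule M a γ α₁ (beta M.mu0 T)).share s (X₁ s ω)) ≠
      P.map (fun ω => (caraRule M a γ α₂ (beta M.mu0 T)).share s (X₂ s ω)) := by
  by_contra! hcon
  have c₁ := h₁.smooth.continuousOn
  have c₂ := h₂.smooth.continuousOn
  have measX : ∀ {α : ℝ → ℝ} {X : ℝ → Ω → ℝ},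
      IsWealthProcess M ℱ z P T (caraRule M a γ α (beta M.mu0 T)) 0 W X →
      ∀ s ∈ Icc 0 T, Measurable (X s) := fun hX s hs => (hX.adapted s hs).mono (ℱ.le _) le_rfl
  have measS : ∀ (α : ℝ → ℝ) (s : ℝ),
      Measurable ((caraRule M a γ α (beta M.mu0 T)).share s) := fun α s => by
    unfold FeedbackRule.share caraRule
    fun_prop
  have hmean : ∀ s ∈ Icc 0 T, wealthMean M a γ T α₁ 0 W s = wealthMean M a γ T α₂ 0 W s := by
    intro s hs
    -- Time `0` is not covered by the assumption on the laws; there the means agree because the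
    -- initial wealth is common.
    rcases hs.1.eq_or_lt with rfl | hs0
    · simp [wealthMean]
    obtain ⟨φ, mφ, hφ⟩ := share_caraRule_injective (a := a) hγ he hs.2
    have hlaw : ∀ {α : ℝ → ℝ} {X : ℝ → Ω → ℝ},
        IsWealthProcess M ℱ z P T (caraRule M a γ α (beta M.mu0 T)) 0 W X →
        ∫ ω, X s ω ∂P = ∫ y, φ y ∂(P.map fun ω =>
          (caraRule M a γ α (beta M.mu0 T)).share s (X s ω)) := fun {α X} hX => by
      have hm : Measurable fun ω => (caraRule M a γ α (beta M.mu0 T)).share s (X s ω) :=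
        (measS α s).comp (measX hX s hs)
      rw [integral_map hm.aemeasurable mφ.aestronglyMeasurable]
      simp only [hφ]
    have h3 := (hlaw hX₁).trans ((congrArg (fun μ => ∫ y, φ y ∂μ) (hcon s ⟨hs0, hs.2⟩)).trans
      (hlaw hX₂).symm)
    rw [hX₁.integral_eq hz ha hγ le_rfl hT.le c₁ hs, hX₂.integral_eq hz ha hγ le_rfl hT.le c₂ hs]
      at h3
    exact mul_left_cancel₀ (inv_ne_zero (beta_pos M.mu0_pos hs.2).ne') h3
  have hα : EqOn α₁ α₂ (Icc 0 T) := fun s hs => by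
    have d₁ := hasDerivWithinAt_wealthMean M ha hγ c₁ W hs
    have d₂ := (hasDerivWithinAt_wealthMean M ha hγ c₂ W hs).congr_of_mem hmean hs
    have e := (uniqueDiffOn_Icc hT s hs).eq_deriv _ d₁ d₂
    have e' := mul_left_cancel₀ (beta_pos M.mu0_pos hs.2).ne' e
    simp only [driftB] at e'
    linarith
  obtain ⟨τ, hτ, hτne⟩ := hne
  exact hτne (h₁.discount_eqOn M ha hγ hT hr₁ hr₂ h₂ hα hτ)

end Modified

end CARA

/-! ### Assembly of the theorem -/

theorem mainTheorem8 {m L : ℕ} {Ω : Type*} [mΩ : MeasurableSpace Ω]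
    (P : Measure Ω) [IsProbabilityMeasure P]
    (ℱ : Filtration ℝ≥0 mΩ) (z : Fin L → ℝ≥0 → Ω → ℝ) (hz : CARA.IsBrownianBasis ℱ z P)
    (M : CARA.Market m L) (a γ T : ℝ) (ha : 0 < a) (hγ : 0 < γ) (hT : 0 < T) :
    -- `β` is positive and solves the Riccati equation with `β(T) = 1`
    ((∀ t ∈ Icc 0 T, 0 < CARA.beta M.mu0 T t ∧
        HasDerivAt (CARA.beta M.mu0 T)
          (CARA.beta M.mu0 T t ^ 2 - M.mu0 * CARA.beta M.mu0 T t) t) ∧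
      CARA.beta M.mu0 T T = 1) ∧
    -- constant discount rate
    (∀ ρ : ℝ, ∀ α b : ℝ → ℝ, (∀ t ∈ Icc 0 T, 0 < b t) →
      (CARA.SolvesHJB M (CARA.utility γ) (CARA.bequest a γ) (fun _ => ρ) 0 T
          (CARA.guess a γ α b) (CARA.caraRule M a γ α b) ↔
        EqOn b (CARA.beta M.mu0 T) (Icc 0 T) ∧
        EqOn α (CARA.alphaStd M a γ T (fun _ => ρ)) (Icc 0 T))) ∧
    -- non-constant discount rate
    (∀ r : ℝ → ℝ, ContinuousOn r (Icc 0 T) →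
      -- pre-commitment
      (∀ α b : ℝ → ℝ, (∀ t ∈ Icc 0 T, 0 < b t) →
        (CARA.SolvesHJB M (CARA.utility γ) (CARA.bequest a γ) r 0 T
            (CARA.guess a γ α b) (CARA.caraRule M a γ α b) ↔
          EqOn b (CARA.beta M.mu0 T) (Icc 0 T) ∧
          EqOn α (CARA.alphaStd M a γ T r) (Icc 0 T))) ∧
      -- naive `t₀`-agent
      (∀ t₀ ∈ Ico 0 T, ∀ α b : ℝ → ℝ, (∀ t ∈ Icc t₀ T, 0 < b t) →
        (CARA.SolvesHJB M (CARA.utility γ) (CARA.bequest a γ) (fun s => r (s - t₀)) t₀ T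
            (CARA.guess a γ α b) (CARA.caraRule M a γ α b) ↔
          EqOn b (CARA.beta M.mu0 T) (Icc t₀ T) ∧
          EqOn α (CARA.alphaStd M a γ T (fun s => r (s - t₀))) (Icc t₀ T))) ∧
      -- the maximising rules for a general guess, and the resulting form of the modified HJB
      -- equation
      (∀ α b : ℝ → ℝ, ∀ t ∈ Icc 0 T, ∀ W : ℝ, W ≠ 0 → 0 < b t →
        DifferentiableWithinAt ℝ α (Icc 0 T) t → DifferentiableWithinAt ℝ b (Icc 0 T) t →
        (∀ (c : ℝ) (w : Fin m → ℝ),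
          CARA.IsHamiltonianMax M (CARA.utility γ) (CARA.guess a γ α b) t W
              (CARA.hamiltonianOf M (CARA.utility γ) (CARA.guess a γ α b) t W c w) ↔
            c = α t + b t * W - Real.log (a * γ * b t) / γ ∧
            w = (1 / (γ * b t * W)) • (M.cov⁻¹ *ᵥ M.excess)) ∧
        (∀ K : ℝ,
          CARA.IsHamiltonianMax M (CARA.utility γ) (CARA.guess a γ α b) t W
              (r (T - t) * CARA.guess a γ α b t W + K
                - CARA.timeDeriv 0 T (CARA.guess a γ α b) t W) ↔
            -a * r (T - t) * Real.exp (-γ * (α t + b t * W)) + K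
                - a * γ * (derivWithin α (Icc 0 T) t + derivWithin b (Icc 0 T) t * W)
                  * Real.exp (-γ * (α t + b t * W))
              = -a * b t * Real.exp (-γ * (α t + b t * W))
                + a / 2 * M.kappa * Real.exp (-γ * (α t + b t * W))
                + (M.mu0 * W - α t - b t * W + Real.log (a * γ * b t) / γ)
                  * (a * γ * b t * Real.exp (-γ * (α t + b t * W))))) ∧
      -- for `b = β` the non-local term has the form `a A(α, t) exp(-γ (α(t) + β(t) W))`
      (∀ α : ℝ → ℝ, ContinuousOn α (Icc 0 T) → ∀ t ∈ Icc 0 T, ∀ W : ℝ,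
        CARA.IsNonlocalTerm M ℱ z P T r (CARA.utility γ)
          (CARA.caraRule M a γ α (CARA.beta M.mu0 T)) t W
          (a * CARA.nonlocalCoeff M a γ T r α t
            * Real.exp (-γ * (α t + CARA.beta M.mu0 T t * W)))) ∧
      -- the guess with `b = β` solves the modified HJB equation exactly when `α` solves its
      -- integro-differential equation
      (∀ α : ℝ → ℝ,
        CARA.SolvesModifiedHJB M ℱ z P (CARA.utility γ) (CARA.bequest a γ) r T
            (CARA.guess a γ α (CARA.beta M.mu0 T))
            (CARA.caraRule M a γ α (CARA.beta M.mu0 T)) ↔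
          CARA.SolvesAlphaEq M a γ T r α) ∧
      -- and such an `α` exists and is unique on `[0, T]`
      (∃ α : ℝ → ℝ, CARA.SolvesAlphaEq M a γ T r α ∧
        ∀ α' : ℝ → ℝ, CARA.SolvesAlphaEq M a γ T r α' → EqOn α' α (Icc 0 T))) ∧
    -- the equilibrium portfolio depends on the discount factor
    (∀ r₁ r₂ : ℝ → ℝ, ContinuousOn r₁ (Icc 0 T) → ContinuousOn r₂ (Icc 0 T) →
      (∃ τ ∈ Icc 0 T, CARA.discount r₁ τ ≠ CARA.discount r₂ τ) → M.excess ≠ 0 →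
      ∀ α₁ α₂ : ℝ → ℝ,
      CARA.SolvesModifiedHJB M ℱ z P (CARA.utility γ) (CARA.bequest a γ) r₁ T
        (CARA.guess a γ α₁ (CARA.beta M.mu0 T)) (CARA.caraRule M a γ α₁ (CARA.beta M.mu0 T)) →
      CARA.SolvesModifiedHJB M ℱ z P (CARA.utility γ) (CARA.bequest a γ) r₂ T
        (CARA.guess a γ α₂ (CARA.beta M.mu0 T)) (CARA.caraRule M a γ α₂ (CARA.beta M.mu0 T)) →
      ∀ (W₀ : ℝ) (X₁ X₂ : ℝ → Ω → ℝ),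
      CARA.IsWealthProcess M ℱ z P T (CARA.caraRule M a γ α₁ (CARA.beta M.mu0 T)) 0 W₀ X₁ →
      CARA.IsWealthProcess M ℱ z P T (CARA.caraRule M a γ α₂ (CARA.beta M.mu0 T)) 0 W₀ X₂ →
      ∃ s ∈ Ioc 0 T,
        P.map (fun ω => (CARA.caraRule M a γ α₁ (CARA.beta M.mu0 T)).share s (X₁ s ω)) ≠
        P.map (fun ω => (CARA.caraRule M a γ α₂ (CARA.beta M.mu0 T)).share s (X₂ s ω))) := by
  refine ⟨⟨fun t ht => ⟨CARA.beta_pos M.mu0_pos ht.2, CARA.hasDerivAt_beta M.mu0_pos ht.2⟩,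
    CARA.beta_terminal M.mu0_pos T⟩, fun ρ α b hb =>
    CARA.solvesHJB_guess_iff M ha hγ hT continuousOn_const hb, fun r hr =>
    ⟨fun α b hb => CARA.solvesHJB_guess_iff M ha hγ hT hr hb, fun t₀ ht₀ α b hb => ?_,
      fun α b t ht W hW hb hα hb' => ⟨fun c w => ?_, fun K => ?_⟩,
      fun α hα t ht W => hz.isNonlocalTerm ha hγ hr hα ht W,
      fun α => hz.solvesModifiedHJB_iff ha hγ hT hr, ?_⟩, ?_⟩
  · exact CARA.solvesHJB_guess_iff M ha hγ ht₀.2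
      (CARA.continuousOn_comp_sub hr (Ico_subset_Icc_self ht₀)) hb
  · rw [CARA.isHamiltonianMax_guess_iff M ha hγ hb hW,
      CARA.hamiltonianOf_guess_eq_iff M ha hγ hb hW]
  · rw [CARA.isHamiltonianMax_guess_iff M ha hγ hb hW, CARA.timeDeriv_guess hT ht hα hb',
      CARA.hamiltonianMax, CARA.guess]
    have e : r (T - t) * (-a * Real.exp (-γ * (α t + b t * W))) + K
        - a * γ * (derivWithin α (Icc 0 T) t + derivWithin b (Icc 0 T) t * W)
          * Real.exp (-γ * (α t + b t * W))
        = -a * r (T - t) * Real.exp (-γ * (α t + b t * W)) + K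
          - a * γ * (derivWithin α (Icc 0 T) t + derivWithin b (Icc 0 T) t * W)
            * Real.exp (-γ * (α t + b t * W)) := by ring
    rw [e]
  · obtain ⟨α, hα⟩ := CARA.exists_solvesAlphaEq M ha hγ hT hr
    exact ⟨α, hα, fun α' hα' => hα.eqOn M ha hγ hT hr hα'⟩
  · intro r₁ r₂ hr₁ hr₂ hne he α₁ α₂ h₁ h₂ W₀ X₁ X₂ hX₁ hX₂
    exact hz.exists_map_share_ne ha hγ hT hr₁ hr₂ hne he
      ((hz.solvesModifiedHJB_iff ha hγ hT hr₁).1 h₁)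
      ((hz.solvesModifiedHJB_iff ha hγ hT hr₂).1 h₂) hX₁ hX₂
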